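/- **Setting.** Fix constants $0<\rho\le\bar v$. There are $T$ rounds of second-price auctions. In round $t$ the buyer's value is $v_t$ and the highest competing bid is $p_t$; the $v_t$ are i.i.d. from a distribution $F$ on $[0,\bar v]$, the $p_t$ are i.i.d. from a distribution $G$ on $[0,\bar v]$, and the two sequences are independent. The budget is $B=\rho T$. Put $r_t=(v_t-p_t)^+$ and $c_t=p_t\mathbf 1[v_t\ge p_t]$. **Throttling.** A throttling strategy decides in each round, knowing its history, $v_t$ and a random seed $\gamma_t$ (the seeds are independent of $(v,p)$), whether to enter ($x_t=1$) or not ($x_t=0$); it earns $x_tr_t$ and pays $x_tc_t$, and it must satisfy $\sum_{t\le T}x_tc_t\le\rho T$ for all values and competing bids in $[0,\bar v]$ and all seeds. The history consists of $(v_\tau,x_\tau,p_\tau)_{\tau<t}$ under full information feedback and of $(v_\tau,x_\tau,x_\tau p_\tau)_{\tau<t}$ under partial information feedback. Let $R^{\mathrm{Th}}_T$ be the optimal expected total revenue, i.e. the supremum over all such strategies for the given $F,G,T$. **OGD-CB.** Start with $\mathcal I_1=\emptyset$, $\lambda_1=0$, $B_1=\rho T$. In round $t=1$ set $x_1=1$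 and $\lambda_2=\lambda_1$. In round $t\ge2$ let $\epsilon_t=\sqrt{(\ln2+2\ln T)/(2|\mathcal I_t|)}$, $$\tilde r_t=\frac1{|\mathcal I_t|}\sum_{\tau\in\mathcal I_t}(v_t-p_\tau)^++\epsilon_tv_t,\qquad \tilde c_t=\frac1{|\mathcal I_t|}\sum_{\tau\in\mathcal I_t}p_\tau\mathbf 1[v_t\ge p_\tau]-2\epsilon_tv_t,$$ $x_t=\mathbf 1[\tilde r_t\ge\lambda_t\tilde c_t]$ and $\lambda_{t+1}=\bigl(\lambda_t+\tfrac1{\bar v\sqrt t}(x_t\tilde c_t-\rho)\bigr)^+$. After each round, $\mathcal I_{t+1}=\mathcal I_t\cup\{t\}$ if $p_t$ is observed (always under full information; if and only if $x_t=1$ under partial information) and $\mathcal I_{t+1}=\mathcal I_t$ otherwise; $B_{t+1}=B_t-x_tc_t$, and the algorithm stops (enters no further round) as soon as $B_{t+1}<\bar v$. Let $R^{\mathrm{OGD}}_T$ be its expected total revenue. **Adaptive pacing (Balseiro and Gur).** Its parameters are an upper bound $\bar\mu\ge\bar v/\rho$ on the multipliers, an initial multiplier $\mu_1\in[0,\bar\mu]$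 and a step size $\varepsilon=\varepsilon_T=\Theta(T^{-1/2})$, i.e. $a/\sqrt T\le\varepsilon\le b/\sqrt T$ with constants $a,b$, $a>0$. Starting from remaining budget $\tilde B_1=\rho T$, in round $t$ it bids $b_t=\min\{v_t/(1+\mu_t),\tilde B_t\}$, wins if and only if $p_t\le b_t$, then pays $z_t=p_t\mathbf 1[p_t\le b_t]$ and earns $(v_t-p_t)\mathbf 1[p_t\le b_t]$; it sets $\tilde B_{t+1}=\tilde B_t-z_t$ and takes for $\mu_{t+1}$ the projection of $\mu_t-\varepsilon(\rho-z_t)$ to $[0,\bar\mu]$. Let $R^{\mathrm{Pa}}_T$ be its expected total revenue. **Theorem.** Let $\rho,\bar v,\bar\mu,a,b$ be as above. There is a constant $C$, depending only on $\rho,\bar v,\bar\mu,a,b$, such that under full and under partial information feedback, for all $F,G$ on $[0,\bar v]$ with $$\mathbb E_{v\sim F,\,p\sim G}\bigl[p\,\mathbf 1[v\ge p]\bigr]\le\rho,$$ all $T\ge2$, all $\mu_1\in[0,\bar\mu]$ and all $\varepsilon\in[a/\sqrt T,b/\sqrt T]$, $$\bigl|R^{\mathrm{Th}}_T-R^{\mathrm{Pa}}_T\bigr|\le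 C\sqrt{T\log T}\qquad\text{and}\qquad\bigl|R^{\mathrm{OGD}}_T-R^{\mathrm{Pa}}_T\bigr|\le C\sqrt{T\log T}.$$ In particular the supremum $R^{\mathrm{Th}}_T$ is finite. -/

import Mathlib

open MeasureTheory Set

noncomputable section

namespace Auction

/-! A market path is a sequence `ω : ℕ → ℝ × ℝ`. The pair `ω k = (v, p)` holds the buyer's value and
the highest competing bid of round `k + 1`, so that the rounds `1, …, T` are the indices
`k ∈ Finset.range T`. -/

/-- The revenue `(v - p)⁺` of a round in which the buyer enters with value `v` and bids truthfully
against the highest competing bid `p`. -/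
def roundRevenue (v p : ℝ) : ℝ := max (v - p) 0

/-- The cost `p · 1[v ≥ p]` of a round in which the buyer enters and bids truthfully. -/
def roundCost (v p : ℝ) : ℝ := if p ≤ v then p else 0

/-- The law of the market path: all values are i.i.d. with law `F`, all highest competing bids are
i.i.d. with law `G`, and the two sequences are independent. -/
def marketLaw (F G : Measure ℝ) [IsProbabilityMeasure F] [IsProbabilityMeasure G] :
    Measure (ℕ → ℝ × ℝ) :=
  Measure.infinitePi (fun _ : ℕ => F.prod G)

/-- What the buyer observes at the end of a round: with full information feedback always the highest
competing bid, with partial information feedback only if she entered. -/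
inductive Feedback
  | fullInfo
  | partialInfo

/-! ### Throttling strategies -/

/-- The history of `n` completed rounds; the entry of a round is `(v, x, p)` with full, and
`(v, x, x p)` with partial information feedback. -/
abbrev History (n : ℕ) : Type := Fin n → ℝ × Bool × ℝ

/-- The history entry of a round with value `v`, decision `x` and highest competing bid `p`. -/
def Feedback.entry : Feedback → ℝ → Bool → ℝ → ℝ × Bool × ℝ
  | .fullInfo, v, x, p => (v, x, p)
  | .partialInfo, v, x, p => (v, x, if x then p else 0)

/-- A (randomized) throttling strategy: after `n` completed rounds with history `h`, on seeing the
value `v` and the random seed `g` of the next round, the buyer enters that round if and only if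
`decision n h v g = true`. The seeds have an arbitrary joint law. -/
structure ThrottlingStrategy where
  Seed : Type
  [measurableSeed : MeasurableSpace Seed]
  seedLaw : Measure (ℕ → Seed)
  [isProbabilityMeasure_seedLaw : IsProbabilityMeasure seedLaw]
  decision : (n : ℕ) → History n → ℝ → Seed → Bool
  measurable_decision : ∀ n : ℕ,
    Measurable (fun q : History n × ℝ × Seed => decision n q.1 q.2.1 q.2.2)

attribute [instance] ThrottlingStrategy.measurableSeed
attribute [instance] ThrottlingStrategy.isProbabilityMeasure_seedLaw

namespace ThrottlingStrategy

/-- The history that the buyer has seen after `n` rounds when she follows `β`. -/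
def history (fb : Feedback) (β : ThrottlingStrategy) (ω : ℕ → ℝ × ℝ) (γ : ℕ → β.Seed) :
    (n : ℕ) → History n
  | 0 => Fin.elim0
  | n + 1 =>
    Fin.snoc (α := fun _ => ℝ × Bool × ℝ) (history fb β ω γ n)
      (fb.entry (ω n).1 (β.decision n (history fb β ω γ n) (ω n).1 (γ n)) (ω n).2)

/-- The decision in round `k + 1` of a buyer who follows `β`. -/
def action (fb : Feedback) (β : ThrottlingStrategy) (ω : ℕ → ℝ × ℝ) (γ : ℕ → β.Seed) (k : ℕ) :
    Bool :=
  β.decision k (history fb β ω γ k) (ω k).1 (γ k)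

/-- The total revenue of `β` over `T` rounds. -/
def revenue (fb : Feedback) (β : ThrottlingStrategy) (T : ℕ) (ω : ℕ → ℝ × ℝ) (γ : ℕ → β.Seed) : ℝ :=
  ∑ k ∈ Finset.range T, if β.action fb ω γ k then roundRevenue (ω k).1 (ω k).2 else 0

/-- The total payment of `β` over `T` rounds. -/
def expenditure (fb : Feedback) (β : ThrottlingStrategy) (T : ℕ) (ω : ℕ → ℝ × ℝ)
    (γ : ℕ → β.Seed) : ℝ :=
  ∑ k ∈ Finset.range T, if β.action fb ω γ k then roundCost (ω k).1 (ω k).2 else 0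

/-- The total payment over `T` rounds never exceeds the budget `B = ρ T`, whatever the values and
competing bids in `[0, vmax]` and whatever the seeds. -/
def RespectsBudget (fb : Feedback) (β : ThrottlingStrategy) (vmax ρ : ℝ) (T : ℕ) : Prop :=
  ∀ (ω : ℕ → ℝ × ℝ) (γ : ℕ → β.Seed), (∀ k, ω k ∈ Icc 0 vmax ×ˢ Icc 0 vmax) →
    β.expenditure fb T ω γ ≤ ρ * T

/-- The expectation of the total revenue of `β` over values, competing bids and seeds. -/
def expectedRevenue (fb : Feedback) (β : ThrottlingStrategy) (T : ℕ) (F G : Measure ℝ)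
    [IsProbabilityMeasure F] [IsProbabilityMeasure G] : ℝ :=
  ∫ q, β.revenue fb T q.1 q.2 ∂((marketLaw F G).prod β.seedLaw)

end ThrottlingStrategy

/-- The expected revenues that throttling strategies within the budget `ρ T` can reach; the optimal
throttling strategy has the supremum of this set as its expected revenue. -/
def throttlingRevenues (fb : Feedback) (vmax ρ : ℝ) (T : ℕ) (F G : Measure ℝ)
    [IsProbabilityMeasure F] [IsProbabilityMeasure G] : Set ℝ :=
  {R | ∃ β : ThrottlingStrategy, β.RespectsBudget fb vmax ρ T ∧ R = β.expectedRevenue fb T F G}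

/-! ### The OGD-CB algorithm -/

/-- The variables of OGD-CB at the start of a round: the set of (indices of) rounds whose competing
bid has been observed, the pricing variable `lam`, the remaining budget, and whether the loop is
still running (i.e. has not been left by `break`). -/
structure OGDCBState where
  observed : Finset ℕ
  lam : ℝ
  budget : ℝ
  running : Bool

namespace OGDCB

/-- The confidence radius `√((ln 2 + 2 ln T) / (2 n))` for `n` observations. -/
def radius (T n : ℕ) : ℝ := √((Real.log 2 + 2 * Real.log T) / (2 * n))

/-- The optimistic estimate of the expected revenue of entering with value `v`. -/
def estRevenue (T : ℕ) (ω : ℕ → ℝ × ℝ) (I : Finset ℕ) (v : ℝ) : ℝ :=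
  (∑ τ ∈ I, roundRevenue v (ω τ).2) / I.card + radius T I.card * v

/-- The optimistic estimate of the expected cost of entering with value `v`. -/
def estCost (T : ℕ) (ω : ℕ → ℝ × ℝ) (I : Finset ℕ) (v : ℝ) : ℝ :=
  (∑ τ ∈ I, roundCost v (ω τ).2) / I.card - 2 * radius T I.card * v

/-- The decision of OGD-CB in round `k + 1` from the state `s`: never enter once the loop has been
left, always enter in the first round, and otherwise enter if and only if the estimated revenue is
at least `lam` times the estimated cost. -/
def decision (T : ℕ) (ω : ℕ → ℝ × ℝ) (k : ℕ) (s : OGDCBState) : Bool :=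
  s.running && (k == 0 ||
    decide (s.lam * estCost T ω s.observed (ω k).1 ≤ estRevenue T ω s.observed (ω k).1))

/-- The step size `1 / (vmax √t)` of the gradient step in round `t = k + 1`. -/
def stepSize (vmax : ℝ) (k : ℕ) : ℝ := 1 / (vmax * √((k : ℝ) + 1))

/-- The pricing variable after round `k + 1` with decision `x`: unchanged in the first round, a
projected gradient step otherwise. -/
def nextLam (vmax ρ : ℝ) (T : ℕ) (ω : ℕ → ℝ × ℝ) (k : ℕ) (s : OGDCBState) (x : Bool) : ℝ :=
  if k = 0 then s.lam
  else max 0 (s.lam + stepSize vmax k *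
    ((if x then estCost T ω s.observed (ω k).1 else 0) - ρ))

/-- The observed rounds after round `k + 1` with decision `x`. -/
def nextObserved : Feedback → ℕ → Finset ℕ → Bool → Finset ℕ
  | .fullInfo, k, I, _ => insert k I
  | .partialInfo, k, I, x => if x then insert k I else I

/-- The remaining budget after round `k + 1` with decision `x`. -/
def nextBudget (ω : ℕ → ℝ × ℝ) (k : ℕ) (s : OGDCBState) (x : Bool) : ℝ :=
  s.budget - if x then roundCost (ω k).1 (ω k).2 else 0

/-- Round `k + 1` of OGD-CB; the loop is left if less than `vmax` of the budget remains. -/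
def step (fb : Feedback) (vmax ρ : ℝ) (T : ℕ) (ω : ℕ → ℝ × ℝ) (k : ℕ) (s : OGDCBState) :
    OGDCBState :=
  if s.running then
    { observed := nextObserved fb k s.observed (decision T ω k s)
      lam := nextLam vmax ρ T ω k s (decision T ω k s)
      budget := nextBudget ω k s (decision T ω k s)
      running := decide (vmax ≤ nextBudget ω k s (decision T ω k s)) }
  else s

/-- The state of OGD-CB (with inputs `ρ` and `T`) after `k` rounds on the market path `ω`. -/
def state (fb : Feedback) (vmax ρ : ℝ) (T : ℕ) (ω : ℕ → ℝ × ℝ) : ℕ → OGDCBState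
  | 0 => { observed := ∅, lam := 0, budget := ρ * T, running := true }
  | k + 1 => step fb vmax ρ T ω k (state fb vmax ρ T ω k)

/-- The total revenue of OGD-CB over `T` rounds. -/
def revenue (fb : Feedback) (vmax ρ : ℝ) (T : ℕ) (ω : ℕ → ℝ × ℝ) : ℝ :=
  ∑ k ∈ Finset.range T,
    if decision T ω k (state fb vmax ρ T ω k) then roundRevenue (ω k).1 (ω k).2 else 0

/-- The expectation of the total revenue of OGD-CB over values and competing bids. -/
def expectedRevenue (fb : Feedback) (vmax ρ : ℝ) (T : ℕ) (F G : Measure ℝ)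
    [IsProbabilityMeasure F] [IsProbabilityMeasure G] : ℝ :=
  ∫ ω, revenue fb vmax ρ T ω ∂(marketLaw F G)

end OGDCB

/-! ### The adaptive pacing strategy of Balseiro and Gur -/

/-- The variables of adaptive pacing at the start of a round: the multiplier and the remaining
budget. -/
structure PacingState where
  mult : ℝ
  budget : ℝ

namespace Pacing

/-- The bid `min {v / (1 + μ), remaining budget}`. -/
def bid (s : PacingState) (v : ℝ) : ℝ := min (v / (1 + s.mult)) s.budget

/-- The payment in a round with value `v` and highest competing bid `p`. -/
def payment (s : PacingState) (v p : ℝ) : ℝ := if p ≤ bid s v then p else 0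

/-- The revenue in a round with value `v` and highest competing bid `p`. -/
def gain (s : PacingState) (v p : ℝ) : ℝ := if p ≤ bid s v then v - p else 0

/-- One round with value `v` and highest competing bid `p`: the multiplier makes the gradient step
`μ - ε (ρ - z)`, with `z` the payment, and is projected to `[0, μbar]`. -/
def step (ρ μbar ε : ℝ) (v p : ℝ) (s : PacingState) : PacingState :=
  { mult := max 0 (min μbar (s.mult - ε * (ρ - payment s v p)))
    budget := s.budget - payment s v p }

/-- The state of adaptive pacing after `k` rounds on the market path `ω`, with budget `ρ T`, initial
multiplier `μ₁`, upper bound `μbar` on the multipliers and step size `ε`. -/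
def state (ρ μbar μ₁ ε : ℝ) (T : ℕ) (ω : ℕ → ℝ × ℝ) : ℕ → PacingState
  | 0 => { mult := μ₁, budget := ρ * T }
  | k + 1 => step ρ μbar ε (ω k).1 (ω k).2 (state ρ μbar μ₁ ε T ω k)

/-- The total revenue of adaptive pacing over `T` rounds. -/
def revenue (ρ μbar μ₁ ε : ℝ) (T : ℕ) (ω : ℕ → ℝ × ℝ) : ℝ :=
  ∑ k ∈ Finset.range T, gain (state ρ μbar μ₁ ε T ω k) (ω k).1 (ω k).2

/-- The expectation of the total revenue of adaptive pacing over values and competing bids. -/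
def expectedRevenue (ρ μbar μ₁ ε : ℝ) (T : ℕ) (F G : Measure ℝ)
    [IsProbabilityMeasure F] [IsProbabilityMeasure G] : ℝ :=
  ∫ ω, revenue ρ μbar μ₁ ε T ω ∂(marketLaw F G)

end Pacing

end Auction

end

/-! All three revenues are compared with one benchmark, `T * meanRevenue F G`, the expected revenue
of entering every round and bidding truthfully. No policy exceeds it: a throttling buyer and OGD-CB
collect some of the nonnegative truthful revenues, and a shaded bid wins only rounds that the
truthful bid would win. So it is enough that each policy loses at most a multiple of `√(T log T)`
against the benchmark. This is plausible because `meanCost F G ≤ ρ`: on average the budget does not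
bind, and only fluctuations, dual updates and estimation errors can cost anything.

For throttling, the witness enters while its remaining budget is at least `vmax`. If it ever skips a
round, it has spent more than `ρ T - vmax`; as entered rounds cost at most `ρ` on average, the
number of skipped rounds is bounded by the fluctuation of a martingale, of order `√T`
(`integral_abs_sum_le`).

For pacing, `Pacing.gain_ge` bounds the loss of a round by `μ (c - ρ) + μ (ρ - z)`, where `c` is the
truthful cost and `z` the payment. The first term has nonpositive mean, since `μ` depends on the
past only. The second sums to the regret of online gradient descent against the multiplier `0`. The
multiplier also bounds overspending, so that the budget runs low only near the end
(`Pacing.loss_le`).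

OGD-CB follows the same pattern with estimates in place of means. Optimism
(`OGDCB.entry_mul_mean_ge`) makes its decision nearly maximize the Lagrangian. Confidence radii are
paid only in entered rounds; each of these adds an observation under either feedback, so their sum
is of order `√(T log T)`. Accuracy of the estimates (`OGDCB.measureReal_deviation_le`) rests on an
exponential supermartingale, because the set of observed bids is chosen adaptively.

Conditional expectations are replaced throughout by resampling one round of the product law
(`integral_resample_round`): whatever depends on the past only is constant in the inner integral. -/

namespace Auction

/-! ### Bounded market paths and resampling of one round. -/

/-- All values and competing bids of the path lie in `[0, vmax]`. -/
def InBox (vmax : ℝ) (ω : ℕ → ℝ × ℝ) : Prop := ∀ k, ω k ∈ Icc 0 vmax ×ˢ Icc 0 vmax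

theorem InBox.update {vmax : ℝ} {ω : ℕ → ℝ × ℝ} (h : InBox vmax ω) (k : ℕ) {z : ℝ × ℝ}
    (hz : z ∈ Icc 0 vmax ×ˢ Icc 0 vmax) : InBox vmax (Function.update ω k z) := by
  intro j
  by_cases hj : j = k
  · subst hj; simpa using hz
  · simpa [Function.update_of_ne hj] using h j

theorem InBox.value_mem {vmax : ℝ} {ω : ℕ → ℝ × ℝ} (h : InBox vmax ω) (k : ℕ) :
    (ω k).1 ∈ Icc 0 vmax := (h k).1

theorem InBox.vmax_nonneg {vmax : ℝ} {ω : ℕ → ℝ × ℝ} (h : InBox vmax ω) : 0 ≤ vmax :=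
  (h.value_mem 0).1.trans (h.value_mem 0).2

instance (F G : Measure ℝ) [IsProbabilityMeasure F] [IsProbabilityMeasure G] :
    IsProbabilityMeasure (marketLaw F G) := by
  unfold marketLaw; infer_instance

theorem measurable_update_round (k : ℕ) :
    Measurable (fun q : (ℕ → ℝ × ℝ) × (ℝ × ℝ) => Function.update q.1 k q.2) := by
  rw [measurable_pi_iff]
  intro j
  by_cases hj : j = k
  · subst hj; simpa using measurable_snd
  · simp only [Function.update_of_ne hj]
    exact (measurable_pi_apply j).comp measurable_fst

theorem ae_mem_box {F G : Measure ℝ} {vmax : ℝ} (hF : ∀ᵐ v ∂F, v ∈ Icc 0 vmax) (hG : ∀ᵐ p ∂G, p ∈ Icc 0 vmax) :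
    ∀ᵐ z ∂(F.prod G), z ∈ Icc 0 vmax ×ˢ Icc 0 vmax := by
  have h1 : ∀ᵐ z ∂(F.prod G), z.1 ∈ Icc 0 vmax := Measure.quasiMeasurePreserving_fst.ae hF
  have h2 : ∀ᵐ z ∂(F.prod G), z.2 ∈ Icc 0 vmax := Measure.quasiMeasurePreserving_snd.ae hG
  filter_upwards [h1, h2] with z hz1 hz2 using ⟨hz1, hz2⟩

section Law

variable {F G : Measure ℝ} [IsProbabilityMeasure F] [IsProbabilityMeasure G] {vmax : ℝ}

/-- Resampling the `k`-th round leaves the law of the market path unchanged. -/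
theorem map_update_marketLaw (F G : Measure ℝ) [IsProbabilityMeasure F] [IsProbabilityMeasure G]
    (k : ℕ) :
    Measure.map (fun q : (ℕ → ℝ × ℝ) × (ℝ × ℝ) => Function.update q.1 k q.2)
      ((marketLaw F G).prod (F.prod G)) = marketLaw F G := by
  -- It suffices to compare finite cylinders. The preimage of a cylinder splits into the constraints
  -- on the rounds other than `k`, imposed on the old path, and the constraint on round `k`, imposed
  -- on the fresh one.
  refine Measure.eq_infinitePi _ fun s t ht => ?_
  have hs : MeasurableSet ((s : Set ℕ).pi t) :=
    MeasurableSet.pi s.countable_toSet fun i _ => ht i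
  rw [Measure.map_apply (measurable_update_round k) hs]
  have hpre : (fun q : (ℕ → ℝ × ℝ) × (ℝ × ℝ) => Function.update q.1 k q.2) ⁻¹' ((s : Set ℕ).pi t)
      = (((s.erase k : Finset ℕ) : Set ℕ).pi t) ×ˢ (if k ∈ s then t k else univ) := by
    ext q
    simp only [mem_preimage, mem_pi, Finset.mem_coe, mem_prod, Finset.mem_erase]
    constructor
    · intro h
      refine ⟨fun i hi => by simpa [Function.update_of_ne hi.1] using h i hi.2, ?_⟩
      split_ifs with hk
      · simpa using h k hk
      · trivial
    · rintro ⟨h1, h2⟩ i hi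
      by_cases hik : i = k
      · subst hik; simpa [hi] using h2
      · simpa [Function.update_of_ne hik] using h1 i ⟨hik, hi⟩
  rw [hpre, Measure.prod_prod, marketLaw, Measure.infinitePi_pi _ (fun i _ => ht i)]
  split_ifs with hk
  · rw [← Finset.mul_prod_erase s _ hk, mul_comm]
  · rw [measure_univ, mul_one, Finset.erase_eq_of_notMem hk]

theorem ae_inBox (hF : ∀ᵐ v ∂F, v ∈ Icc 0 vmax) (hG : ∀ᵐ p ∂G, p ∈ Icc 0 vmax) :
    ∀ᵐ ω ∂marketLaw F G, InBox vmax ω := by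
  refine ae_all_iff.2 fun k => ?_
  exact (measurePreserving_eval_infinitePi (fun _ : ℕ => F.prod G) k).quasiMeasurePreserving.ae
    (ae_mem_box hF hG)

theorem integrable_of_inBox (hF : ∀ᵐ v ∂F, v ∈ Icc 0 vmax) (hG : ∀ᵐ p ∂G, p ∈ Icc 0 vmax)
    {f : (ℕ → ℝ × ℝ) → ℝ} (hm : Measurable f) (K : ℝ) (hK : ∀ ω, InBox vmax ω → |f ω| ≤ K) :
    Integrable f (marketLaw F G) :=
  Integrable.of_bound hm.aestronglyMeasurable K ((ae_inBox hF hG).mono fun ω h => hK ω h)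

theorem integral_le_of_inBox (hF : ∀ᵐ v ∂F, v ∈ Icc 0 vmax) (hG : ∀ᵐ p ∂G, p ∈ Icc 0 vmax)
    {f g : (ℕ → ℝ × ℝ) → ℝ} (hf : Integrable f (marketLaw F G)) (hg : Integrable g (marketLaw F G))
    (h : ∀ ω, InBox vmax ω → f ω ≤ g ω) : ∫ ω, f ω ∂marketLaw F G ≤ ∫ ω, g ω ∂marketLaw F G :=
  integral_mono_ae hf hg ((ae_inBox hF hG).mono h)

/-- Fubini for the resampled path. The inner integral plays the part of a conditional expectation
given all rounds except `k`, so no filtration is needed. -/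
theorem integral_resample_round (hF : ∀ᵐ v ∂F, v ∈ Icc 0 vmax) (hG : ∀ᵐ p ∂G, p ∈ Icc 0 vmax)
    {f : (ℕ → ℝ × ℝ) → ℝ} (hm : Measurable f) (K : ℝ) (hK : ∀ ω, InBox vmax ω → |f ω| ≤ K)
    (k : ℕ) :
    ∫ ω, f ω ∂marketLaw F G
      = ∫ ω, ∫ z, f (Function.update ω k z) ∂(F.prod G) ∂marketLaw F G := by
  have hint := integrable_of_inBox hF hG hm K hK
  rw [← map_update_marketLaw F G k] at hint
  conv_lhs => rw [← map_update_marketLaw F G k]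
  rw [integral_map (measurable_update_round k).aemeasurable hm.aestronglyMeasurable]
  exact integral_prod _ (hint.comp_measurable (measurable_update_round k))

theorem integral_nonpos_of_round (hF : ∀ᵐ v ∂F, v ∈ Icc 0 vmax) (hG : ∀ᵐ p ∂G, p ∈ Icc 0 vmax)
    {f : (ℕ → ℝ × ℝ) → ℝ} (hm : Measurable f) (K : ℝ) (hK : ∀ ω, InBox vmax ω → |f ω| ≤ K)
    (k : ℕ) (h : ∀ ω, InBox vmax ω → ∫ z, f (Function.update ω k z) ∂(F.prod G) ≤ 0) :
    ∫ ω, f ω ∂marketLaw F G ≤ 0 := by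
  rw [integral_resample_round hF hG hm K hK k]
  exact integral_nonpos_of_ae ((ae_inBox hF hG).mono h)

/-- A bounded function whose mean over the competing bid of the `k`-th round, everything else being
fixed, is never positive has a nonpositive mean. -/
theorem integral_nonpos_of_price (hF : ∀ᵐ v ∂F, v ∈ Icc 0 vmax) (hG : ∀ᵐ p ∂G, p ∈ Icc 0 vmax)
    {f : (ℕ → ℝ × ℝ) → ℝ} (hm : Measurable f) (K : ℝ) (hK : ∀ ω, InBox vmax ω → |f ω| ≤ K)
    (k : ℕ)
    (h : ∀ ω, InBox vmax ω → ∫ p, f (Function.update ω k ((ω k).1, p)) ∂G ≤ 0) :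
    ∫ ω, f ω ∂marketLaw F G ≤ 0 := by
  refine integral_nonpos_of_round hF hG hm K hK k fun ω hω => ?_
  have hint : Integrable (fun z => f (Function.update ω k z)) (F.prod G) :=
    Integrable.of_bound (hm.comp ((measurable_update_round k).comp
      measurable_prodMk_left)).aestronglyMeasurable K
      ((ae_mem_box hF hG).mono fun z hz => hK _ (hω.update k hz))
  rw [integral_prod _ hint]
  refine integral_nonpos_of_ae (hF.mono fun v hv => ?_)
  -- The bid `0` is a dummy: it gives a path in the box whose value in round `k` is `v`, and `h`
  -- overwrites the bid anyway.
  have h0 : (v, (0 : ℝ)) ∈ Icc 0 vmax ×ˢ Icc 0 vmax := ⟨hv, le_rfl, hω.vmax_nonneg⟩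
  simpa using h _ (hω.update k h0)

theorem integral_eq_zero_of_price (hF : ∀ᵐ v ∂F, v ∈ Icc 0 vmax) (hG : ∀ᵐ p ∂G, p ∈ Icc 0 vmax)
    {f : (ℕ → ℝ × ℝ) → ℝ} (hm : Measurable f) (K : ℝ) (hK : ∀ ω, InBox vmax ω → |f ω| ≤ K)
    (k : ℕ)
    (h : ∀ ω, InBox vmax ω → ∫ p, f (Function.update ω k ((ω k).1, p)) ∂G = 0) :
    ∫ ω, f ω ∂marketLaw F G = 0 := by
  refine le_antisymm (integral_nonpos_of_price hF hG hm K hK k fun ω hω => (h ω hω).le) ?_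
  have := integral_nonpos_of_price hF hG hm.neg K (by simpa using hK) k
    fun ω hω => by simp [integral_neg, h ω hω]
  simpa [integral_neg] using this

theorem integral_eq_zero_of_round (hF : ∀ᵐ v ∂F, v ∈ Icc 0 vmax) (hG : ∀ᵐ p ∂G, p ∈ Icc 0 vmax)
    {f : (ℕ → ℝ × ℝ) → ℝ} (hm : Measurable f) (K : ℝ) (hK : ∀ ω, InBox vmax ω → |f ω| ≤ K)
    (k : ℕ) (h : ∀ ω, InBox vmax ω → ∫ z, f (Function.update ω k z) ∂(F.prod G) = 0) :
    ∫ ω, f ω ∂marketLaw F G = 0 := by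
  rw [integral_resample_round hF hG hm K hK k]
  exact integral_eq_zero_of_ae ((ae_inBox hF hG).mono h)

/-- Serves events that involve the past and the value of round `k`: with the round frozen at `z`, a
bound for each fixed value suffices. -/
theorem measure_le_of_resample (hF : ∀ᵐ v ∂F, v ∈ Icc 0 vmax) (hG : ∀ᵐ p ∂G, p ∈ Icc 0 vmax)
    {s : Set (ℕ → ℝ × ℝ)} (hs : MeasurableSet s) (k : ℕ) (c : ENNReal)
    (h : ∀ z ∈ Icc 0 vmax ×ˢ Icc 0 vmax, marketLaw F G {ω | Function.update ω k z ∈ s} ≤ c) :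
    marketLaw F G s ≤ c := by
  conv_lhs => rw [← map_update_marketLaw F G k]
  rw [Measure.map_apply (measurable_update_round k) hs,
    Measure.prod_apply_symm (measurable_update_round k hs)]
  calc _ ≤ ∫⁻ _, c ∂(F.prod G) := lintegral_mono_ae ((ae_mem_box hF hG).mono h)
    _ = c := by simp

/-- The first absolute moment of a sum of bounded orthogonal increments. -/
theorem integral_abs_sum_le (hF : ∀ᵐ v ∂F, v ∈ Icc 0 vmax) (hG : ∀ᵐ p ∂G, p ∈ Icc 0 vmax)
    {D : ℕ → (ℕ → ℝ × ℝ) → ℝ} (hm : ∀ k, Measurable (D k)) {K : ℝ} (hK0 : 0 < K)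
    (hK : ∀ k ω, InBox vmax ω → |D k ω| ≤ K)
    (horth : ∀ n, ∫ ω, (∑ k ∈ Finset.range n, D k ω) * D n ω ∂marketLaw F G = 0)
    (T : ℕ) (hT : 0 < T) :
    ∫ ω, |∑ k ∈ Finset.range T, D k ω| ∂marketLaw F G ≤ K * √T := by
  have hM (n : ℕ) : Measurable fun ω => ∑ k ∈ Finset.range n, D k ω :=
    Finset.measurable_fun_sum _ fun k _ => hm k
  have hMK (n : ℕ) (ω) (hω : InBox vmax ω) : |∑ k ∈ Finset.range n, D k ω| ≤ n * K := by
    refine (Finset.abs_sum_le_sum_abs _ _).trans ?_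
    simpa using Finset.sum_le_card_nsmul (Finset.range n) _ K fun k _ => hK k ω hω
  have hsqi (n : ℕ) : Integrable (fun ω => (∑ k ∈ Finset.range n, D k ω) ^ 2) (marketLaw F G) :=
    integrable_of_inBox hF hG ((hM n).pow_const 2) ((n * K) ^ 2) fun ω hω => by
      rw [abs_pow]; gcongr; exact hMK n ω hω
  have hsq (n : ℕ) : ∫ ω, (∑ k ∈ Finset.range n, D k ω) ^ 2 ∂marketLaw F G ≤ n * K ^ 2 := by
    induction n with
    | zero => simp
    | succ n ih =>
      have h1 : Integrable (fun ω => (∑ k ∈ Finset.range n, D k ω) * D n ω) (marketLaw F G) :=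
        integrable_of_inBox hF hG ((hM n).mul (hm n)) (n * K * K) fun ω hω => by
          rw [abs_mul]
          exact mul_le_mul (hMK n ω hω) (hK n ω hω) (abs_nonneg _) (by positivity)
      have h2 : Integrable (fun ω => D n ω ^ 2) (marketLaw F G) :=
        integrable_of_inBox hF hG ((hm n).pow_const 2) (K ^ 2) fun ω hω => by
          rw [abs_pow]; gcongr; exact hK n ω hω
      have h3 : ∫ ω, D n ω ^ 2 ∂marketLaw F G ≤ K ^ 2 := by
        have := integral_le_of_inBox hF hG h2 (integrable_const (K ^ 2)) fun ω hω => by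
          rw [← sq_abs]; gcongr; exact hK n ω hω
        simpa using this
      have h4 : ∀ ω, (∑ k ∈ Finset.range (n + 1), D k ω) ^ 2
          = (∑ k ∈ Finset.range n, D k ω) ^ 2
            + (2 * ((∑ k ∈ Finset.range n, D k ω) * D n ω) + D n ω ^ 2) := fun ω => by
        rw [Finset.sum_range_succ]; ring
      have h5 : Integrable (fun ω => 2 * ((∑ k ∈ Finset.range n, D k ω) * D n ω) + D n ω ^ 2)
          (marketLaw F G) := (h1.const_mul 2).add h2
      simp_rw [h4]
      rw [integral_add (hsqi n) h5, integral_add (h1.const_mul 2) h2,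
        integral_const_mul, horth n]
      push_cast
      linarith
  have hT' : 0 < √(T : ℝ) := Real.sqrt_pos.2 (by exact_mod_cast hT)
  -- The step from the second to the first moment is `|M| ≤ M² / (2 K √T) + K √T / 2`; with `E M² ≤
  -- T K²` both halves contribute `K √T / 2`.
  have hle := integral_le_of_inBox hF hG
    (f := fun ω => |∑ k ∈ Finset.range T, D k ω|)
    (g := fun ω => (1 / (2 * (K * √T))) * (∑ k ∈ Finset.range T, D k ω) ^ 2 + K * √T / 2)
    (integrable_of_inBox hF hG (hM T).abs (T * K) fun ω hω => by rw [abs_abs]; exact hMK T ω hω)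
    (((hsqi T).const_mul _).add (integrable_const _)) fun ω _ => by
      have hpos : 0 < K * √T := by positivity
      rw [← sq_abs]
      have := sq_nonneg (|∑ k ∈ Finset.range T, D k ω| - K * √T)
      rw [show 1 / (2 * (K * √T)) * |∑ k ∈ Finset.range T, D k ω| ^ 2 + K * √T / 2
        = (|∑ k ∈ Finset.range T, D k ω| ^ 2 + (K * √T) ^ 2) / (2 * (K * √T)) by field_simp,
        le_div_iff₀ (by positivity)]
      linarith
  refine hle.trans ?_
  rw [integral_add ((hsqi T).const_mul _) (integrable_const _), integral_const_mul]
  have h5 : 1 / (2 * (K * √T)) * ∫ ω, (∑ k ∈ Finset.range T, D k ω) ^ 2 ∂marketLaw F G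
      ≤ 1 / (2 * (K * √T)) * (T * K ^ 2) := by gcongr; exact hsq T
  have h6 : 1 / (2 * (K * √T)) * (T * K ^ 2) = K * √T / 2 := by
    have : (T : ℝ) = √T * √T := (Real.mul_self_sqrt (Nat.cast_nonneg T)).symm
    rw [this, Real.sqrt_mul_self (Real.sqrt_nonneg _)]
    field_simp
  simp only [integral_const, probReal_univ, smul_eq_mul, one_mul]
  linarith

end Law

/-! ### Revenue and cost of one round, and the benchmark of entering always. -/

theorem measurable_roundRevenue : Measurable fun z : ℝ × ℝ => roundRevenue z.1 z.2 := by
  unfold roundRevenue; fun_prop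

theorem measurable_roundCost : Measurable fun z : ℝ × ℝ => roundCost z.1 z.2 :=
  Measurable.ite (measurableSet_le measurable_snd measurable_fst) measurable_snd measurable_const

theorem roundRevenue_mem_Icc {vmax v p : ℝ} (hv : v ∈ Icc 0 vmax) (hp : p ∈ Icc 0 vmax) :
    roundRevenue v p ∈ Icc 0 v :=
  ⟨le_max_right _ _, max_le (by linarith [hp.1]) hv.1⟩

theorem roundCost_mem_Icc {vmax v p : ℝ} (hv : v ∈ Icc 0 vmax) (hp : p ∈ Icc 0 vmax) :
    roundCost v p ∈ Icc 0 v := by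
  unfold roundCost
  split_ifs with h
  · exact ⟨hp.1, h⟩
  · exact ⟨le_rfl, hv.1⟩

theorem measurable_decide_le {α : Type*} [MeasurableSpace α] {f g : α → ℝ} (hf : Measurable f)
    (hg : Measurable g) : Measurable fun a => decide (f a ≤ g a) := by
  refine measurable_to_bool ?_
  have : (fun a => decide (f a ≤ g a)) ⁻¹' {true} = {a | f a ≤ g a} := by ext; simp
  rw [this]
  exact measurableSet_le hf hg

theorem measurable_ite_bool {α : Type*} [MeasurableSpace α] {b : α → Bool} {f g : α → ℝ}
    (hb : Measurable b) (hf : Measurable f) (hg : Measurable g) :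
    Measurable fun a => if b a then f a else g a :=
  Measurable.ite (hb (measurableSet_singleton true)) hf hg

section Law

variable {F G : Measure ℝ} [IsProbabilityMeasure F] [IsProbabilityMeasure G] {vmax : ℝ}

/-- The expected revenue of one round in which the buyer enters and bids truthfully. -/
noncomputable def meanRevenue (F G : Measure ℝ) : ℝ := ∫ z, roundRevenue z.1 z.2 ∂(F.prod G)

/-- The expected cost of one round in which the buyer enters and bids truthfully. -/
noncomputable def meanCost (F G : Measure ℝ) : ℝ := ∫ z, roundCost z.1 z.2 ∂(F.prod G)

theorem integral_round (F G : Measure ℝ) [IsProbabilityMeasure F] [IsProbabilityMeasure G]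
    {h : ℝ × ℝ → ℝ} (hm : Measurable h) (k : ℕ) :
    ∫ ω, h (ω k) ∂marketLaw F G = ∫ z, h z ∂(F.prod G) := by
  have := (measurePreserving_eval_infinitePi (fun _ : ℕ => F.prod G) k).map_eq
  rw [← this, integral_map (measurable_pi_apply k).aemeasurable hm.aestronglyMeasurable]
  rfl

theorem integrable_round_of_mem (hF : ∀ᵐ v ∂F, v ∈ Icc 0 vmax) (hG : ∀ᵐ p ∂G, p ∈ Icc 0 vmax)
    {h : ℝ × ℝ → ℝ} (hm : Measurable h) (K : ℝ)
    (hK : ∀ z ∈ Icc 0 vmax ×ˢ Icc 0 vmax, |h z| ≤ K) : Integrable h (F.prod G) :=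
  Integrable.of_bound hm.aestronglyMeasurable K ((ae_mem_box hF hG).mono hK)

theorem abs_roundRevenue_le {z : ℝ × ℝ} (hz : z ∈ Icc 0 vmax ×ˢ Icc 0 vmax) :
    |roundRevenue z.1 z.2| ≤ vmax := by
  have h := roundRevenue_mem_Icc hz.1 hz.2
  rw [abs_of_nonneg h.1]
  exact h.2.trans hz.1.2

theorem abs_roundCost_le {z : ℝ × ℝ} (hz : z ∈ Icc 0 vmax ×ˢ Icc 0 vmax) :
    |roundCost z.1 z.2| ≤ vmax := by
  have h := roundCost_mem_Icc hz.1 hz.2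
  rw [abs_of_nonneg h.1]
  exact h.2.trans hz.1.2

theorem integrable_roundCost (hF : ∀ᵐ v ∂F, v ∈ Icc 0 vmax) (hG : ∀ᵐ p ∂G, p ∈ Icc 0 vmax) :
    Integrable (fun z : ℝ × ℝ => roundCost z.1 z.2) (F.prod G) :=
  integrable_round_of_mem hF hG measurable_roundCost vmax fun _ hz => abs_roundCost_le hz

theorem measurable_roundRevenue_eval (k : ℕ) :
    Measurable fun ω : ℕ → ℝ × ℝ => roundRevenue (ω k).1 (ω k).2 :=
  measurable_roundRevenue.comp (measurable_pi_apply k)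

theorem measurable_roundCost_eval (k : ℕ) :
    Measurable fun ω : ℕ → ℝ × ℝ => roundCost (ω k).1 (ω k).2 :=
  measurable_roundCost.comp (measurable_pi_apply k)

theorem integrable_sum_roundRevenue (hF : ∀ᵐ v ∂F, v ∈ Icc 0 vmax)
    (hG : ∀ᵐ p ∂G, p ∈ Icc 0 vmax) (T : ℕ) :
    Integrable (fun ω => ∑ k ∈ Finset.range T, roundRevenue (ω k).1 (ω k).2) (marketLaw F G) :=
  integrable_finsetSum _ fun k _ => integrable_of_inBox hF hG (measurable_roundRevenue_eval k) vmax
    fun _ hω => abs_roundRevenue_le (hω k)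

theorem integral_sum_roundRevenue (hF : ∀ᵐ v ∂F, v ∈ Icc 0 vmax)
    (hG : ∀ᵐ p ∂G, p ∈ Icc 0 vmax) (T : ℕ) :
    ∫ ω, ∑ k ∈ Finset.range T, roundRevenue (ω k).1 (ω k).2 ∂marketLaw F G
      = T * meanRevenue F G := by
  rw [integral_finsetSum _ fun k _ => integrable_of_inBox hF hG (measurable_roundRevenue_eval k)
    vmax fun _ hω => abs_roundRevenue_le (hω k)]
  simp [integral_round F G measurable_roundRevenue, meanRevenue]

theorem meanCost_mem_Icc (hF : ∀ᵐ v ∂F, v ∈ Icc 0 vmax) (hG : ∀ᵐ p ∂G, p ∈ Icc 0 vmax) :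
    meanCost F G ∈ Icc 0 vmax := by
  constructor
  · exact integral_nonneg_of_ae ((ae_mem_box hF hG).mono fun z hz =>
      (roundCost_mem_Icc hz.1 hz.2).1)
  · have := integral_mono_ae (integrable_roundCost hF hG) (integrable_const vmax)
      ((ae_mem_box hF hG).mono fun z hz => (roundCost_mem_Icc hz.1 hz.2).2.trans hz.1.2)
    simpa [meanCost] using this

/-- The revenue of a policy is compared with that of entering every round: it cannot be larger,
and a pathwise bound on the loss gives a bound on the expected loss. -/
theorem mean_sub_le_of_loss (hF : ∀ᵐ v ∂F, v ∈ Icc 0 vmax) (hG : ∀ᵐ p ∂G, p ∈ Icc 0 vmax)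
    {T : ℕ} {R L : (ℕ → ℝ × ℝ) → ℝ} (hR : Measurable R) (KR : ℝ)
    (hRK : ∀ ω, InBox vmax ω → |R ω| ≤ KR) (hL : Integrable L (marketLaw F G))
    (h : ∀ ω, InBox vmax ω → ∑ k ∈ Finset.range T, roundRevenue (ω k).1 (ω k).2 - R ω ≤ L ω) :
    T * meanRevenue F G - ∫ ω, L ω ∂marketLaw F G ≤ ∫ ω, R ω ∂marketLaw F G := by
  have hRi := integrable_of_inBox hF hG hR KR hRK
  have := integral_le_of_inBox hF hG ((integrable_sum_roundRevenue hF hG T).sub hRi) hL h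
  simp only [Pi.sub_apply] at this
  rw [integral_sub (integrable_sum_roundRevenue hF hG T) hRi,
    integral_sum_roundRevenue hF hG T] at this
  linarith

/-- Nonnegativity of `R` makes its integrability unnecessary, since a nonintegrable function has
integral `0`. -/
theorem le_mean_of_le (hF : ∀ᵐ v ∂F, v ∈ Icc 0 vmax) (hG : ∀ᵐ p ∂G, p ∈ Icc 0 vmax)
    {T : ℕ} {R : (ℕ → ℝ × ℝ) → ℝ}
    (h0 : ∀ ω, InBox vmax ω → 0 ≤ R ω)
    (h : ∀ ω, InBox vmax ω → R ω ≤ ∑ k ∈ Finset.range T, roundRevenue (ω k).1 (ω k).2) :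
    ∫ ω, R ω ∂marketLaw F G ≤ T * meanRevenue F G := by
  rw [← integral_sum_roundRevenue hF hG T]
  exact integral_mono_of_nonneg ((ae_inBox hF hG).mono h0) (integrable_sum_roundRevenue hF hG T)
    ((ae_inBox hF hG).mono h)

end Law

/-! ### Throttling: entering while solvent. -/

namespace ThrottlingStrategy

/-- The payments recorded in a history. -/
noncomputable def spentOf {n : ℕ} (h : History n) : ℝ :=
  ∑ i, if (h i).2.1 then roundCost (h i).1 (h i).2.2 else 0

theorem measurable_spentOf (n : ℕ) : Measurable (spentOf : History n → ℝ) := by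
  refine Finset.measurable_fun_sum _ fun i _ => ?_
  have hi : Measurable fun h : History n => h i := measurable_pi_apply i
  refine measurable_ite_bool (measurable_fst.comp (measurable_snd.comp hi)) ?_ measurable_const
  exact measurable_roundCost.comp
    ((measurable_fst.comp hi).prodMk (measurable_snd.comp (measurable_snd.comp hi)))

/-- The strategy that enters as long as the remaining budget is at least `vmax`. -/
noncomputable def enterWhileSolvent (vmax B : ℝ) : ThrottlingStrategy where
  Seed := Unit
  seedLaw := Measure.dirac fun _ => ()
  decision _ h _ _ := decide (spentOf h + vmax ≤ B)
  measurable_decision n := measurable_decide_le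
    (((measurable_spentOf n).comp measurable_fst).add_const vmax) measurable_const

/-- The payments over `n` rounds of a buyer who enters as long as her remaining budget is at least
`vmax`. -/
noncomputable def solventSpent (vmax B : ℝ) (ω : ℕ → ℝ × ℝ) : ℕ → ℝ
  | 0 => 0
  | n + 1 => solventSpent vmax B ω n
      + if solventSpent vmax B ω n + vmax ≤ B then roundCost (ω n).1 (ω n).2 else 0

/-- The buyer can reconstruct her spending under both feedbacks: partial information hides only bids
of skipped rounds, which cost nothing. -/
theorem spentOf_history (fb : Feedback) (vmax B : ℝ) (ω : ℕ → ℝ × ℝ)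
    (γ : ℕ → (enterWhileSolvent vmax B).Seed) (n : ℕ) :
    spentOf ((enterWhileSolvent vmax B).history fb ω γ n) = solventSpent vmax B ω n := by
  induction n with
  | zero => simp [spentOf, solventSpent]
  | succ n ih =>
    have hd : (enterWhileSolvent vmax B).decision n
        ((enterWhileSolvent vmax B).history fb ω γ n) (ω n).1 (γ n)
        = decide (solventSpent vmax B ω n + vmax ≤ B) := by
      rw [← ih]; rfl
    rw [spentOf, Fin.sum_univ_castSucc]
    simp only [history, Fin.snoc_castSucc, Fin.snoc_last, hd]
    rw [spentOf] at ih
    rw [ih, solventSpent]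
    congr 1
    cases fb <;> by_cases h : solventSpent vmax B ω n + vmax ≤ B <;> simp [Feedback.entry, h]

theorem action_enterWhileSolvent (fb : Feedback) (vmax B : ℝ) (ω : ℕ → ℝ × ℝ)
    (γ : ℕ → (enterWhileSolvent vmax B).Seed) (n : ℕ) :
    (enterWhileSolvent vmax B).action fb ω γ n
      = decide (solventSpent vmax B ω n + vmax ≤ B) := by
  rw [← spentOf_history fb vmax B ω γ n]; rfl

theorem solventSpent_eq_sum (vmax B : ℝ) (ω : ℕ → ℝ × ℝ) (n : ℕ) :
    solventSpent vmax B ω n = ∑ k ∈ Finset.range n,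
      if solventSpent vmax B ω k + vmax ≤ B then roundCost (ω k).1 (ω k).2 else 0 := by
  induction n with
  | zero => rfl
  | succ n ih => rw [Finset.sum_range_succ, ← ih]; rfl

theorem monotone_solventSpent {vmax : ℝ} (B : ℝ) {ω : ℕ → ℝ × ℝ} (hω : InBox vmax ω) :
    Monotone (solventSpent vmax B ω) := by
  refine monotone_nat_of_le_succ fun n => ?_
  rw [solventSpent]
  have := (roundCost_mem_Icc (hω n).1 (hω n).2).1
  split_ifs <;> linarith

/-- An entered round costs at most `vmax`, and this much is left by the entry rule. -/
theorem solventSpent_le {vmax B : ℝ} (hB : 0 ≤ B) {ω : ℕ → ℝ × ℝ} (hω : InBox vmax ω) (n : ℕ) :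
    solventSpent vmax B ω n ≤ B := by
  induction n with
  | zero => exact hB
  | succ n ih =>
    rw [solventSpent]
    have := (roundCost_mem_Icc (hω n).1 (hω n).2).2
    have := (hω n).1.2
    split_ifs <;> linarith

/-- Spending is predictable: resampling a round does not affect what was spent before it. -/
theorem solventSpent_congr (vmax B : ℝ) {ω ω' : ℕ → ℝ × ℝ} {n : ℕ} (h : ∀ j < n, ω j = ω' j) :
    solventSpent vmax B ω n = solventSpent vmax B ω' n := by
  induction n with
  | zero => rfl
  | succ n ih => rw [solventSpent, solventSpent, ih fun j hj => h j (by omega), h n (by omega)]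

theorem measurable_solventSpent (vmax B : ℝ) (n : ℕ) :
    Measurable fun ω => solventSpent vmax B ω n := by
  induction n with
  | zero => exact measurable_const
  | succ n ih =>
    exact ih.add (Measurable.ite (measurableSet_le (ih.add_const _) measurable_const)
      (measurable_roundCost_eval n) measurable_const)

theorem respectsBudget_enterWhileSolvent (fb : Feedback) (vmax : ℝ) {ρ : ℝ} (hρ : 0 ≤ ρ) (T : ℕ) :
    (enterWhileSolvent vmax (ρ * T)).RespectsBudget fb vmax ρ T := by
  intro ω γ hω
  have h := solventSpent_le (B := ρ * T) (by positivity) hω T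
  rw [solventSpent_eq_sum] at h
  simpa [expenditure, action_enterWhileSolvent] using h

/-- Truthful revenue is nonnegative in every round, so skipping rounds never raises the total,
whatever the strategy knows. -/
theorem expectedRevenue_le {F G : Measure ℝ} [IsProbabilityMeasure F] [IsProbabilityMeasure G]
    {vmax : ℝ} (hF : ∀ᵐ v ∂F, v ∈ Icc 0 vmax) (hG : ∀ᵐ p ∂G, p ∈ Icc 0 vmax) (fb : Feedback)
    (β : ThrottlingStrategy) (T : ℕ) : β.expectedRevenue fb T F G ≤ T * meanRevenue F G := by
  rw [← integral_sum_roundRevenue hF hG T]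
  have hint : Integrable (fun q : (ℕ → ℝ × ℝ) × (ℕ → β.Seed) =>
      ∑ k ∈ Finset.range T, roundRevenue (q.1 k).1 (q.1 k).2) ((marketLaw F G).prod β.seedLaw) :=
    (integrable_sum_roundRevenue hF hG T).comp_fst β.seedLaw
  have hr (v p : ℝ) : 0 ≤ roundRevenue v p := le_max_right _ _
  calc β.expectedRevenue fb T F G
      ≤ ∫ q : (ℕ → ℝ × ℝ) × (ℕ → β.Seed), ∑ k ∈ Finset.range T, roundRevenue (q.1 k).1 (q.1 k).2
          ∂((marketLaw F G).prod β.seedLaw) := by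
        refine integral_mono_of_nonneg (Filter.Eventually.of_forall fun q => ?_) hint
          (Filter.Eventually.of_forall fun q => ?_)
        · refine Finset.sum_nonneg fun k _ => ?_
          split_ifs
          exacts [hr _ _, le_rfl]
        · refine Finset.sum_le_sum fun k _ => ?_
          split_ifs
          exacts [le_rfl, hr _ _]
    _ = _ := by
        rw [integral_fun_fst (fun ω : ℕ → ℝ × ℝ =>
          ∑ k ∈ Finset.range T, roundRevenue (ω k).1 (ω k).2)]
        simp

/-- If entering always costs at most `ρ` per round on average, entering while solvent loses at most
of the order of `√T`. -/
theorem expectedRevenue_enterWhileSolvent_ge {F G : Measure ℝ} [IsProbabilityMeasure F]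
    [IsProbabilityMeasure G] {vmax ρ : ℝ} (hρ : 0 < ρ) (hvmax : 0 < vmax)
    (hF : ∀ᵐ v ∂F, v ∈ Icc 0 vmax) (hG : ∀ᵐ p ∂G, p ∈ Icc 0 vmax) (hc : meanCost F G ≤ ρ)
    (fb : Feedback) (T : ℕ) (hT : 0 < T) :
    T * meanRevenue F G - vmax / ρ * (vmax + vmax * √T)
      ≤ (enterWhileSolvent vmax (ρ * T)).expectedRevenue fb T F G := by
  set S : (ℕ → ℝ × ℝ) → ℕ → ℝ := solventSpent vmax (ρ * T) with hS
  set A : ℕ → (ℕ → ℝ × ℝ) → ℝ := fun k ω => if S ω k + vmax ≤ ρ * T then 1 else 0 with hA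
  have hAm (k : ℕ) : Measurable (A k) := Measurable.ite (measurableSet_le
    ((measurable_solventSpent _ _ k).add_const _) measurable_const) measurable_const
    measurable_const
  have hA01 (k ω) : A k ω = 0 ∨ A k ω = 1 := by simp only [hA]; split_ifs <;> simp
  set D : ℕ → (ℕ → ℝ × ℝ) → ℝ := fun k ω => A k ω * (roundCost (ω k).1 (ω k).2 - meanCost F G)
    with hD
  have hcm := meanCost_mem_Icc hF hG
  have hDm (k : ℕ) : Measurable (D k) := (hAm k).mul ((measurable_roundCost_eval k).sub_const _)
  have hDK (k : ℕ) (ω) (hω : InBox vmax ω) : |D k ω| ≤ vmax := by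
    have h1 := roundCost_mem_Icc (hω k).1 (hω k).2
    have h2 := (hω k).1.2
    have h3 : |roundCost (ω k).1 (ω k).2 - meanCost F G| ≤ vmax := by
      rw [abs_le]; constructor <;> linarith [h1.1, h1.2, hcm.1, hcm.2]
    rcases hA01 k ω with h | h <;> simp only [hD, h]
    · simpa using hvmax.le
    · simpa using h3
  have hAinv (k n : ℕ) (hk : k ≤ n) (ω z) : A k (Function.update ω n z) = A k ω := by
    simp only [hA, hS]
    rw [solventSpent_congr vmax (ρ * T) (ω' := ω) fun j hj => Function.update_of_ne (by omega) _ _]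
  have horth (n : ℕ) :
      ∫ ω, (∑ k ∈ Finset.range n, D k ω) * D n ω ∂marketLaw F G = 0 := by
    refine integral_eq_zero_of_round hF hG
      ((Finset.measurable_fun_sum _ fun k _ => hDm k).mul (hDm n)) (n * vmax * vmax)
      (fun ω hω => ?_) n fun ω hω => ?_
    · rw [abs_mul]
      refine mul_le_mul ?_ (hDK n ω hω) (abs_nonneg _) (by positivity)
      refine (Finset.abs_sum_le_sum_abs _ _).trans ?_
      simpa using Finset.sum_le_card_nsmul (Finset.range n) _ vmax fun k _ => hDK k ω hω
    -- Orthogonality: round `n` affects neither the earlier increments nor the decision to enter it,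
    -- and the remaining factor, cost minus mean cost, averages to `0`.
    · have h1 (z) : ∑ k ∈ Finset.range n, D k (Function.update ω n z)
          = ∑ k ∈ Finset.range n, D k ω := by
        refine Finset.sum_congr rfl fun k hk => ?_
        have hk' := Finset.mem_range.1 hk
        simp only [hD]
        rw [hAinv k n hk'.le, Function.update_of_ne hk'.ne]
      have h2 (z) : D n (Function.update ω n z)
          = A n ω * (roundCost z.1 z.2 - meanCost F G) := by
        simp only [hD]
        rw [hAinv n n le_rfl, Function.update_self]
      simp_rw [h1, h2]
      rw [integral_const_mul, integral_const_mul,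
        integral_sub (integrable_roundCost hF hG) (integrable_const _)]
      simp [meanCost]
  have hM := integral_abs_sum_le hF hG hDm hvmax hDK horth T hT
  have hMint : Integrable (fun ω => |∑ k ∈ Finset.range T, D k ω|) (marketLaw F G) :=
    (integrable_finsetSum _ fun k _ => integrable_of_inBox hF hG (hDm k) vmax (hDK k)).abs
  have hrev : (enterWhileSolvent vmax (ρ * T)).expectedRevenue fb T F G
      = ∫ ω, ∑ k ∈ Finset.range T, A k ω * roundRevenue (ω k).1 (ω k).2 ∂marketLaw F G := by
    have h1 (q : (ℕ → ℝ × ℝ) × (ℕ → (enterWhileSolvent vmax (ρ * T)).Seed)) :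
        (enterWhileSolvent vmax (ρ * T)).revenue fb T q.1 q.2
          = ∑ k ∈ Finset.range T, A k q.1 * roundRevenue (q.1 k).1 (q.1 k).2 := by
      simp [revenue, action_enterWhileSolvent, hA, hS]
    simp_rw [expectedRevenue, h1]
    rw [integral_fun_fst (fun ω : ℕ → ℝ × ℝ =>
      ∑ k ∈ Finset.range T, A k ω * roundRevenue (ω k).1 (ω k).2)]
    simp
  rw [hrev]
  have key := mean_sub_le_of_loss (T := T) hF hG
    (R := fun ω => ∑ k ∈ Finset.range T, A k ω * roundRevenue (ω k).1 (ω k).2)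
    (L := fun ω => vmax / ρ * (vmax + |∑ k ∈ Finset.range T, D k ω|))
    (Finset.measurable_fun_sum _ fun k _ => (hAm k).mul (measurable_roundRevenue_eval k))
    (T * vmax) (fun ω hω => ?_) (((integrable_const _).add hMint).const_mul _) (fun ω hω => ?_)
  · rw [integral_const_mul, integral_add (integrable_const _) hMint] at key
    simp only [integral_const, probReal_univ, smul_eq_mul, one_mul] at key
    refine le_trans ?_ key
    gcongr
  · refine (Finset.abs_sum_le_sum_abs _ _).trans ?_
    have h1 (k : ℕ) : |A k ω * roundRevenue (ω k).1 (ω k).2| ≤ vmax := by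
      rcases hA01 k ω with h | h <;> rw [h]
      · simpa using hvmax.le
      · simpa using abs_roundRevenue_le (hω k)
    simpa using Finset.sum_le_card_nsmul (Finset.range T) _ vmax fun k _ => h1 k
  -- `N` counts the skipped rounds; each of them loses at most `vmax`.
  · set N : ℝ := ∑ k ∈ Finset.range T, (1 - A k ω) with hN
    have hloss : ∑ k ∈ Finset.range T, roundRevenue (ω k).1 (ω k).2
        - ∑ k ∈ Finset.range T, A k ω * roundRevenue (ω k).1 (ω k).2 ≤ vmax * N := by
      rw [← Finset.sum_sub_distrib, hN, Finset.mul_sum]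
      refine Finset.sum_le_sum fun k _ => ?_
      have h1 := le_of_abs_le (abs_roundRevenue_le (hω k))
      rcases hA01 k ω with h | h <;> rw [h] <;> linarith
    have hsum : S ω T = ∑ k ∈ Finset.range T, D k ω + meanCost F G * (T - N) := by
      rw [hS, solventSpent_eq_sum, hN, Finset.sum_sub_distrib]
      simp only [Finset.sum_const, Finset.card_range, nsmul_eq_mul, mul_one, sub_sub_cancel]
      rw [Finset.mul_sum, ← Finset.sum_add_distrib]
      refine Finset.sum_congr rfl fun k _ => ?_
      simp only [hD, hA, hS]
      split_ifs <;> ring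
    have hN0 : 0 ≤ T - N := by
      rw [hN, Finset.sum_sub_distrib]
      simp only [Finset.sum_const, Finset.card_range, nsmul_eq_mul, mul_one, sub_sub_cancel]
      exact Finset.sum_nonneg fun k _ => by rcases hA01 k ω with h | h <;> simp [h]
    -- A skipped round shows that more than `ρ T - vmax` is spent, while `hsum` bounds the spending
    -- by the martingale plus `ρ (T - N)`. Comparing the two leaves `ρ N`.
    have hNle : ρ * N ≤ vmax + |∑ k ∈ Finset.range T, D k ω| := by
      by_cases hall : ∀ k ∈ Finset.range T, A k ω = 1
      · have : N = 0 := by rw [hN]; exact Finset.sum_eq_zero fun k hk => by rw [hall k hk, sub_self]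
        rw [this, mul_zero]; positivity
      · push Not at hall
        obtain ⟨k, hk, hAk⟩ := hall
        have h1 : ¬ (S ω k + vmax ≤ ρ * T) := fun h => hAk (by simp [hA, h])
        have h2 := monotone_solventSpent (ρ * T) hω (Finset.mem_range.1 hk).le
        have h3 := le_abs_self (∑ k ∈ Finset.range T, D k ω)
        have h4 : meanCost F G * (T - N) ≤ ρ * (T - N) := by gcongr
        rw [← hS] at h2
        push Not at h1
        linarith
    refine hloss.trans ?_
    rw [div_mul_eq_mul_div, le_div_iff₀ hρ]
    nlinarith

end ThrottlingStrategy

/-- A predicate on rounds that can only switch from true to false holds exactly before some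
round `τ`. -/
theorem exists_threshold (P : ℕ → Prop) [DecidablePred P] (hP : Antitone P) (T : ℕ) :
    ∃ τ ≤ T, (∀ k < τ, P k) ∧ (τ < T → ¬ P τ) ∧ ∀ f : ℕ → ℝ,
      (∑ k ∈ Finset.range T, if P k then f k else 0) = ∑ k ∈ Finset.range τ, f k := by
  induction T with
  | zero => exact ⟨0, le_rfl, by simp, by simp, by simp⟩
  | succ T ih =>
    by_cases hT : P T
    · have hall : ∀ k < T + 1, P k := fun k hk => hP (Nat.lt_succ_iff.1 hk) hT
      exact ⟨T + 1, le_rfl, hall, by simp, fun f => Finset.sum_congr rfl fun k hk =>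
        if_pos (hall k (Finset.mem_range.1 hk))⟩
    · obtain ⟨τ, hτ, h1, h2, h3⟩ := ih
      refine ⟨τ, hτ.trans T.le_succ, h1, fun h => ?_, fun f => ?_⟩
      · rcases hτ.lt_or_eq with h' | rfl
        exacts [h2 h', hT]
      · rw [Finset.sum_range_succ, if_neg hT, add_zero, h3 f]

/-! ### Adaptive pacing. -/

namespace Pacing

section Pathwise

variable {vmax ρ μbar μ₁ ε : ℝ} {T : ℕ} {ω : ℕ → ℝ × ℝ}

theorem mult_mem_Icc (hμbar : 0 ≤ μbar) (hμ₁ : μ₁ ∈ Icc 0 μbar) (k : ℕ) :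
    (state ρ μbar μ₁ ε T ω k).mult ∈ Icc 0 μbar := by
  cases k with
  | zero => exact hμ₁
  | succ k => exact ⟨le_max_left _ _, max_le hμbar (min_le_left _ _)⟩

theorem payment_nonneg (hω : InBox vmax ω) (s : PacingState) (k : ℕ) :
    0 ≤ payment s (ω k).1 (ω k).2 := by
  unfold payment
  split_ifs
  exacts [(hω k).2.1, le_rfl]

theorem payment_le_of_nonneg {s : PacingState} {v p : ℝ} (hm : 0 ≤ s.mult) (hb : 0 ≤ s.budget)
    (hv : 0 ≤ v) : payment s v p ≤ min (v / (1 + s.mult)) s.budget := by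
  unfold payment bid
  split_ifs with h
  · exact h
  · exact le_min (by positivity) hb

theorem budget_nonneg (hρ : 0 ≤ ρ) (hμbar : 0 ≤ μbar) (hμ₁ : μ₁ ∈ Icc 0 μbar) (hω : InBox vmax ω)
    (k : ℕ) : 0 ≤ (state ρ μbar μ₁ ε T ω k).budget := by
  induction k with
  | zero => exact mul_nonneg hρ (Nat.cast_nonneg T)
  | succ k ih =>
    have := (payment_le_of_nonneg (p := (ω k).2) (mult_mem_Icc hμbar hμ₁ k).1 ih (hω k).1.1).trans
      (min_le_right _ _)
    exact sub_nonneg.2 this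

theorem antitone_budget (hω : InBox vmax ω) :
    Antitone fun k => (state ρ μbar μ₁ ε T ω k).budget :=
  antitone_nat_of_succ_le fun k => sub_le_self _ (payment_nonneg hω _ k)

/-- Winning against a positive bid at a large multiplier is possible only at a low price. This is
what keeps the multiplier away from `μbar` when it is about to rise. -/
theorem payment_mul_le (hρ : 0 ≤ ρ) (hμbar : 0 ≤ μbar) (hμ₁ : μ₁ ∈ Icc 0 μbar)
    (hω : InBox vmax ω) (k : ℕ) :
    payment (state ρ μbar μ₁ ε T ω k) (ω k).1 (ω k).2
      * (1 + (state ρ μbar μ₁ ε T ω k).mult) ≤ vmax := by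
  have hm := (mult_mem_Icc (ρ := ρ) (ε := ε) (T := T) (ω := ω) hμbar hμ₁ k).1
  have h := (payment_le_of_nonneg (p := (ω k).2) hm (budget_nonneg hρ hμbar hμ₁ hω k)
    (hω k).1.1).trans (min_le_left _ _)
  rw [le_div_iff₀ (by linarith)] at h
  exact h.trans (hω k).1.2

theorem payment_le (hρ : 0 ≤ ρ) (hμbar : 0 ≤ μbar) (hμ₁ : μ₁ ∈ Icc 0 μbar)
    (hω : InBox vmax ω) (k : ℕ) :
    payment (state ρ μbar μ₁ ε T ω k) (ω k).1 (ω k).2 ≤ vmax := by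
  have h := payment_mul_le (ε := ε) (T := T) hρ hμbar hμ₁ hω k
  have h1 := mul_nonneg (payment_nonneg hω (state ρ μbar μ₁ ε T ω k) k)
    (mult_mem_Icc (ρ := ρ) (ε := ε) (T := T) (ω := ω) hμbar hμ₁ k).1
  linarith

/-- The bid never exceeds the value, so a round won by pacing is also won by the truthful bid, at
the same price. -/
theorem gain_mem_Icc (hμbar : 0 ≤ μbar) (hμ₁ : μ₁ ∈ Icc 0 μbar) (hω : InBox vmax ω) (k : ℕ) :
    gain (state ρ μbar μ₁ ε T ω k) (ω k).1 (ω k).2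
      ∈ Icc 0 (roundRevenue (ω k).1 (ω k).2) := by
  have hm := (mult_mem_Icc (ρ := ρ) (ε := ε) (T := T) (ω := ω) hμbar hμ₁ k).1
  unfold gain roundRevenue
  split_ifs with h
  · have h1 : (ω k).1 / (1 + (state ρ μbar μ₁ ε T ω k).mult) ≤ (ω k).1 :=
      div_le_self (hω k).1.1 (by linarith)
    have h2 := (h.trans (min_le_left _ _)).trans h1
    exact ⟨by linarith, le_max_left _ _⟩
  · exact ⟨le_rfl, le_max_right _ _⟩

/-- While the budget does not bind, pacing earns at least the Lagrangian value of entering. -/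
theorem gain_ge {s : PacingState} {v p : ℝ} (hm : 0 ≤ s.mult) (hv : v ∈ Icc 0 vmax)
    (hb : vmax ≤ s.budget) :
    roundRevenue v p - s.mult * roundCost v p + s.mult * payment s v p ≤ gain s v p := by
  have h1 : v / (1 + s.mult) ≤ v := div_le_self hv.1 (by linarith)
  have hbid : bid s v = v / (1 + s.mult) := min_eq_left (h1.trans (hv.2.trans hb))
  unfold roundRevenue roundCost payment gain
  rw [hbid]
  by_cases hp : p ≤ v / (1 + s.mult)
  · have hpv := hp.trans h1
    rw [if_pos hp, if_pos hp, if_pos hpv, max_eq_left (by linarith)]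
    linarith
  · rw [if_neg hp, if_neg hp]
    rw [le_div_iff₀ (by linarith)] at hp
    -- Here `v / (1 + μ) < p`. If still `p ≤ v`, the round is lost by shading, but its Lagrangian
    -- value `v - (1 + μ) p` is negative.
    split_ifs with hpv
    · rw [max_eq_left (by linarith)]; linarith
    · rw [max_eq_right (by linarith)]; simp

/-- The one-step inequality of online gradient descent with comparator `0`: projection to `[0,
μbar]` does not increase the distance to `0`, and `|ρ - z| ≤ vmax`. -/
theorem sq_mult_succ_le (hρ : 0 ≤ ρ) (hρv : ρ ≤ vmax) (hμbar : 0 ≤ μbar)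
    (hμ₁ : μ₁ ∈ Icc 0 μbar) (hω : InBox vmax ω) (k : ℕ) :
    (state ρ μbar μ₁ ε T ω (k + 1)).mult ^ 2 ≤ (state ρ μbar μ₁ ε T ω k).mult ^ 2
      - 2 * ε * ((state ρ μbar μ₁ ε T ω k).mult
        * (ρ - payment (state ρ μbar μ₁ ε T ω k) (ω k).1 (ω k).2)) + ε ^ 2 * vmax ^ 2 := by
  set s := state ρ μbar μ₁ ε T ω k with hs
  set z := payment s (ω k).1 (ω k).2 with hz
  have hz0 : 0 ≤ z := payment_nonneg hω s k
  have hz1 : z ≤ vmax := payment_le hρ hμbar hμ₁ hω k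
  have hnext : (state ρ μbar μ₁ ε T ω (k + 1)).mult
      = max 0 (min μbar (s.mult - ε * (ρ - z))) := rfl
  have h1 : max 0 (min μbar (s.mult - ε * (ρ - z))) ≤ |s.mult - ε * (ρ - z)| :=
    max_le (abs_nonneg _) ((min_le_right _ _).trans (le_abs_self _))
  have h2 : max 0 (min μbar (s.mult - ε * (ρ - z))) ^ 2 ≤ (s.mult - ε * (ρ - z)) ^ 2 := by
    rw [← sq_abs (s.mult - ε * (ρ - z))]
    exact pow_le_pow_left₀ (le_max_left _ _) h1 2
  have h3 : (ρ - z) ^ 2 ≤ vmax ^ 2 := sq_le_sq' (by linarith) (by linarith)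
  rw [hnext]
  nlinarith [mul_le_mul_of_nonneg_left h3 (sq_nonneg ε)]

/-- For small steps the projection never cuts off the multiplier from above. -/
theorem mult_succ_ge (hρ : 0 < ρ) (hρv : ρ ≤ vmax) (hμbar : vmax / ρ ≤ μbar)
    (hμ₁ : μ₁ ∈ Icc 0 μbar) (hε : 0 ≤ ε) (hεv : ε * vmax ≤ 1) (hω : InBox vmax ω) (k : ℕ) :
    (state ρ μbar μ₁ ε T ω k).mult
      - ε * (ρ - payment (state ρ μbar μ₁ ε T ω k) (ω k).1 (ω k).2)
      ≤ (state ρ μbar μ₁ ε T ω (k + 1)).mult := by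
  have hvmax : 0 < vmax := hρ.trans_le hρv
  have hμbar0 : 0 ≤ μbar := (by positivity : 0 ≤ vmax / ρ).trans hμbar
  have hm := mult_mem_Icc (ρ := ρ) (ε := ε) (T := T) (ω := ω) hμbar0 hμ₁ k
  have hp := payment_mul_le (ε := ε) (T := T) hρ.le hμbar0 hμ₁ hω k
  have hz1 := payment_le (ε := ε) (T := T) hρ.le hμbar0 hμ₁ hω k
  have hnext : (state ρ μbar μ₁ ε T ω (k + 1)).mult = max 0 (min μbar
      ((state ρ μbar μ₁ ε T ω k).mult
        - ε * (ρ - payment (state ρ μbar μ₁ ε T ω k) (ω k).1 (ω k).2))) := rfl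
  rw [hnext]
  refine le_max_of_le_right (le_min ?_ le_rfl)
  set s := state ρ μbar μ₁ ε T ω k
  set z := payment s (ω k).1 (ω k).2
  rcases le_or_gt z ρ with hz | hz
  · have := mul_nonneg hε (sub_nonneg.2 hz)
    linarith [hm.2]
  -- The multiplier rises only if `z > ρ`. Then `z (1 + μ) ≤ vmax ≤ ρ μbar ≤ z μbar` leaves room `1`
  -- below `μbar`, and the step is at most `ε z ≤ 1`.
  · rw [div_le_iff₀ hρ] at hμbar
    have h1 : 1 + s.mult ≤ μbar := by
      have h2 : μbar * ρ ≤ μbar * z := by gcongr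
      have h3 : z * (1 + s.mult) ≤ z * μbar := by linarith
      exact le_of_mul_le_mul_left h3 (hρ.trans hz)
    have h4 : ε * z ≤ 1 := (mul_le_mul_of_nonneg_left hz1 hε).trans hεv
    have h5 := mul_nonneg hε hρ.le
    linarith

/-- The multiplier is a ledger of overspending: each round adds at least `ε (z - ρ)` to it, and it
never exceeds `μbar`. -/
theorem sum_payment_le (hρ : 0 < ρ) (hρv : ρ ≤ vmax) (hμbar : vmax / ρ ≤ μbar)
    (hμ₁ : μ₁ ∈ Icc 0 μbar) (hε : 0 < ε) (hεv : ε * vmax ≤ 1) (hω : InBox vmax ω) (n : ℕ) :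
    ∑ k ∈ Finset.range n, payment (state ρ μbar μ₁ ε T ω k) (ω k).1 (ω k).2
      ≤ ρ * n + μbar / ε := by
  have hvmax : 0 < vmax := hρ.trans_le hρv
  have hμbar0 : 0 ≤ μbar := (by positivity : 0 ≤ vmax / ρ).trans hμbar
  have h : ε * (∑ k ∈ Finset.range n, payment (state ρ μbar μ₁ ε T ω k) (ω k).1 (ω k).2 - ρ * n)
      ≤ (state ρ μbar μ₁ ε T ω n).mult := by
    induction n with
    | zero => simpa using (mult_mem_Icc (ρ := ρ) (ε := ε) (T := T) (ω := ω) hμbar0 hμ₁ 0).1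
    | succ n ih =>
      have := mult_succ_ge (T := T) hρ hρv hμbar hμ₁ hε.le hεv hω n
      rw [Finset.sum_range_succ]
      push_cast
      linarith
  have h1 := h.trans (mult_mem_Icc (ρ := ρ) (ε := ε) (T := T) (ω := ω) hμbar0 hμ₁ n).2
  have h2 := (le_div_iff₀' hε).2 h1
  linarith

/-- The regret of the multipliers against `0`, by telescoping their squares. -/
theorem sum_mult_mul_le (hρ : 0 ≤ ρ) (hρv : ρ ≤ vmax) (hμbar : 0 ≤ μbar)
    (hμ₁ : μ₁ ∈ Icc 0 μbar) (hε : 0 < ε) (hω : InBox vmax ω) (n : ℕ) :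
    ∑ k ∈ Finset.range n, (state ρ μbar μ₁ ε T ω k).mult
        * (ρ - payment (state ρ μbar μ₁ ε T ω k) (ω k).1 (ω k).2)
      ≤ μbar ^ 2 / (2 * ε) + ε * vmax ^ 2 / 2 * n := by
  have h : 2 * ε * ∑ k ∈ Finset.range n, (state ρ μbar μ₁ ε T ω k).mult
        * (ρ - payment (state ρ μbar μ₁ ε T ω k) (ω k).1 (ω k).2)
      ≤ μ₁ ^ 2 - (state ρ μbar μ₁ ε T ω n).mult ^ 2 + ε ^ 2 * vmax ^ 2 * n := by
    induction n with
    | zero => simp [state]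
    | succ n ih =>
      have := sq_mult_succ_le (ε := ε) (T := T) hρ hρv hμbar hμ₁ hω n
      rw [Finset.sum_range_succ]
      push_cast
      linarith
  have h1 : μ₁ ^ 2 ≤ μbar ^ 2 := pow_le_pow_left₀ hμ₁.1 hμ₁.2 2
  have h2 := sq_nonneg (state ρ μbar μ₁ ε T ω n).mult
  rw [show μbar ^ 2 / (2 * ε) + ε * vmax ^ 2 / 2 * n
    = (μbar ^ 2 + ε ^ 2 * vmax ^ 2 * n) / (2 * ε) by field_simp, le_div_iff₀' (by positivity)]
  linarith

theorem budget_eq (n : ℕ) : (state ρ μbar μ₁ ε T ω n).budget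
    = ρ * T - ∑ k ∈ Finset.range n, payment (state ρ μbar μ₁ ε T ω k) (ω k).1 (ω k).2 := by
  induction n with
  | zero => simp [state]
  | succ n ih => rw [Finset.sum_range_succ, ← sub_sub, ← ih]; rfl

/-- The horizon is split at the first round `τ` whose remaining budget is below `vmax`. Before it
`gain_ge` and the regret bound apply; after it every round may be lost, but few are left. The terms
`μ (c - ρ)` are kept, since only their expectation has a sign. -/
theorem loss_le (hρ : 0 < ρ) (hρv : ρ ≤ vmax) (hμbar : vmax / ρ ≤ μbar)
    (hμ₁ : μ₁ ∈ Icc 0 μbar) (hε : 0 < ε) (hεv : ε * vmax ≤ 1) (hω : InBox vmax ω) :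
    ∑ k ∈ Finset.range T, roundRevenue (ω k).1 (ω k).2 - revenue ρ μbar μ₁ ε T ω
      ≤ ∑ k ∈ Finset.range T, (if vmax ≤ (state ρ μbar μ₁ ε T ω k).budget then
          (state ρ μbar μ₁ ε T ω k).mult * (roundCost (ω k).1 (ω k).2 - ρ) else 0)
        + (vmax / ρ * (vmax + μbar / ε) + (μbar ^ 2 / (2 * ε) + ε * vmax ^ 2 / 2 * T)) := by
  have hvmax : 0 < vmax := hρ.trans_le hρv
  have hμbar0 : 0 ≤ μbar := (by positivity : 0 ≤ vmax / ρ).trans hμbar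
  obtain ⟨τ, hτT, hτ, hτ', hsum⟩ := exists_threshold
    (fun k => vmax ≤ (state ρ μbar μ₁ ε T ω k).budget)
    (fun i j hij h => le_trans h (antitone_budget hω hij)) T
  rw [hsum]
  have h1 : ∑ k ∈ Finset.range τ, gain (state ρ μbar μ₁ ε T ω k) (ω k).1 (ω k).2
      ≤ revenue ρ μbar μ₁ ε T ω :=
    Finset.sum_le_sum_of_subset_of_nonneg (Finset.range_subset_range.2 hτT)
      fun k _ _ => (gain_mem_Icc hμbar0 hμ₁ hω k).1
  have h2 : ∑ k ∈ Finset.range T, roundRevenue (ω k).1 (ω k).2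
      ≤ ∑ k ∈ Finset.range τ, roundRevenue (ω k).1 (ω k).2 + vmax * (T - τ) := by
    rw [← Finset.sum_range_add_sum_Ico _ hτT]
    gcongr
    have := Finset.sum_le_card_nsmul (Finset.Ico τ T)
      (fun k => roundRevenue (ω k).1 (ω k).2) vmax
      fun k _ => le_of_abs_le (abs_roundRevenue_le (hω k))
    rw [Nat.card_Ico, nsmul_eq_mul, Nat.cast_sub hτT] at this
    linarith
  -- If `τ < T`, then `ρ T - vmax` is less than the payments before `τ`, which are at most `ρ τ +
  -- μbar / ε`.
  have h3 : vmax * (T - τ : ℝ) ≤ vmax / ρ * (vmax + μbar / ε) := by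
    rw [div_mul_eq_mul_div, le_div_iff₀ hρ, mul_assoc]
    refine mul_le_mul_of_nonneg_left ?_ hvmax.le
    rcases hτT.lt_or_eq with h | rfl
    · have h4 := hτ' h
      rw [budget_eq, not_le] at h4
      have h5 := sum_payment_le (T := T) hρ hρv hμbar hμ₁ hε hεv hω τ
      linarith
    · rw [sub_self, zero_mul]; positivity
  have h4 : ∑ k ∈ Finset.range τ, (state ρ μbar μ₁ ε T ω k).mult
        * (ρ - payment (state ρ μbar μ₁ ε T ω k) (ω k).1 (ω k).2)
      ≤ μbar ^ 2 / (2 * ε) + ε * vmax ^ 2 / 2 * T := by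
    refine (sum_mult_mul_le (T := T) hρ.le hρv hμbar0 hμ₁ hε hω τ).trans ?_
    gcongr
  have h5 : ∑ k ∈ Finset.range τ, roundRevenue (ω k).1 (ω k).2
      ≤ ∑ k ∈ Finset.range τ, gain (state ρ μbar μ₁ ε T ω k) (ω k).1 (ω k).2
        + ∑ k ∈ Finset.range τ,
          (state ρ μbar μ₁ ε T ω k).mult * (roundCost (ω k).1 (ω k).2 - ρ)
        + ∑ k ∈ Finset.range τ, (state ρ μbar μ₁ ε T ω k).mult
          * (ρ - payment (state ρ μbar μ₁ ε T ω k) (ω k).1 (ω k).2) := by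
    rw [← Finset.sum_add_distrib, ← Finset.sum_add_distrib]
    refine Finset.sum_le_sum fun k hk => ?_
    have := gain_ge (p := (ω k).2) (mult_mem_Icc (ρ := ρ) (ε := ε) (T := T) (ω := ω) hμbar0 hμ₁ k).1
      (hω k).1 (hτ k (Finset.mem_range.1 hk))
    linarith
  linarith

end Pathwise

theorem state_congr (ρ μbar μ₁ ε : ℝ) (T : ℕ) {ω ω' : ℕ → ℝ × ℝ} {n : ℕ}
    (h : ∀ j < n, ω j = ω' j) : state ρ μbar μ₁ ε T ω n = state ρ μbar μ₁ ε T ω' n := by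
  induction n with
  | zero => rfl
  | succ n ih => rw [state, state, ih fun j hj => h j (by omega), h n (by omega)]

theorem state_update (ρ μbar μ₁ ε : ℝ) (T : ℕ) (ω : ℕ → ℝ × ℝ) (n : ℕ) (z : ℝ × ℝ) :
    state ρ μbar μ₁ ε T (Function.update ω n z) n = state ρ μbar μ₁ ε T ω n :=
  state_congr _ _ _ _ _ fun _ hj => Function.update_of_ne hj.ne _ _

theorem measurable_state (ρ μbar μ₁ ε : ℝ) (T n : ℕ) :
    (Measurable fun ω => (state ρ μbar μ₁ ε T ω n).mult) ∧
      Measurable fun ω => (state ρ μbar μ₁ ε T ω n).budget := by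
  induction n with
  | zero => exact ⟨measurable_const, measurable_const⟩
  | succ n ih =>
    have hv : Measurable fun ω : ℕ → ℝ × ℝ => (ω n).1 := measurable_fst.comp (measurable_pi_apply n)
    have hp : Measurable fun ω : ℕ → ℝ × ℝ => (ω n).2 := measurable_snd.comp (measurable_pi_apply n)
    have hbid : Measurable fun ω => bid (state ρ μbar μ₁ ε T ω n) (ω n).1 :=
      (hv.div (ih.1.const_add 1)).min ih.2
    have hpay : Measurable fun ω => payment (state ρ μbar μ₁ ε T ω n) (ω n).1 (ω n).2 :=
      Measurable.ite (measurableSet_le hp hbid) hp measurable_const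
    exact ⟨measurable_const.max (measurable_const.min
      (ih.1.sub ((measurable_const.sub hpay).const_mul ε))), ih.2.sub hpay⟩

theorem measurable_revenue (ρ μbar μ₁ ε : ℝ) (T : ℕ) : Measurable (revenue ρ μbar μ₁ ε T) := by
  refine Finset.measurable_fun_sum _ fun n _ => ?_
  have hv : Measurable fun ω : ℕ → ℝ × ℝ => (ω n).1 := measurable_fst.comp (measurable_pi_apply n)
  have hp : Measurable fun ω : ℕ → ℝ × ℝ => (ω n).2 := measurable_snd.comp (measurable_pi_apply n)
  have ih := measurable_state ρ μbar μ₁ ε T n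
  have hbid : Measurable fun ω => bid (state ρ μbar μ₁ ε T ω n) (ω n).1 :=
    (hv.div (ih.1.const_add 1)).min ih.2
  exact Measurable.ite (measurableSet_le hp hbid) (hv.sub hp) measurable_const

theorem revenue_nonneg {vmax ρ μbar μ₁ ε : ℝ} {T : ℕ} {ω : ℕ → ℝ × ℝ} (hμbar : 0 ≤ μbar)
    (hμ₁ : μ₁ ∈ Icc 0 μbar) (hω : InBox vmax ω) : 0 ≤ revenue ρ μbar μ₁ ε T ω :=
  Finset.sum_nonneg fun k _ => (gain_mem_Icc hμbar hμ₁ hω k).1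

theorem revenue_le {vmax ρ μbar μ₁ ε : ℝ} {T : ℕ} {ω : ℕ → ℝ × ℝ} (hμbar : 0 ≤ μbar)
    (hμ₁ : μ₁ ∈ Icc 0 μbar) (hω : InBox vmax ω) :
    revenue ρ μbar μ₁ ε T ω ≤ ∑ k ∈ Finset.range T, roundRevenue (ω k).1 (ω k).2 :=
  Finset.sum_le_sum fun k _ => (gain_mem_Icc hμbar hμ₁ hω k).2

/-- If entering always costs at most `ρ` per round on average, pacing loses at most of the order of
`√T` for step sizes of the order of `1 / √T`. -/
theorem expectedRevenue_ge {F G : Measure ℝ} [IsProbabilityMeasure F] [IsProbabilityMeasure G]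
    {vmax ρ μbar μ₁ ε : ℝ} (hρ : 0 < ρ) (hρv : ρ ≤ vmax) (hμbar : vmax / ρ ≤ μbar)
    (hμ₁ : μ₁ ∈ Icc 0 μbar) (hε : 0 < ε) (hεv : ε * vmax ≤ 1)
    (hF : ∀ᵐ v ∂F, v ∈ Icc 0 vmax) (hG : ∀ᵐ p ∂G, p ∈ Icc 0 vmax) (hc : meanCost F G ≤ ρ)
    (T : ℕ) :
    T * meanRevenue F G
      - (vmax / ρ * (vmax + μbar / ε) + (μbar ^ 2 / (2 * ε) + ε * vmax ^ 2 / 2 * T))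
      ≤ expectedRevenue ρ μbar μ₁ ε T F G := by
  have hvmax : 0 < vmax := hρ.trans_le hρv
  have hμbar0 : 0 ≤ μbar := (by positivity : 0 ≤ vmax / ρ).trans hμbar
  set W : ℕ → (ℕ → ℝ × ℝ) → ℝ := fun k ω => if vmax ≤ (state ρ μbar μ₁ ε T ω k).budget then
    (state ρ μbar μ₁ ε T ω k).mult * (roundCost (ω k).1 (ω k).2 - ρ) else 0 with hW
  have hWm (k : ℕ) : Measurable (W k) := by
    have h := measurable_state ρ μbar μ₁ ε T k
    exact Measurable.ite (measurableSet_le measurable_const h.2)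
      (h.1.mul ((measurable_roundCost_eval k).sub_const ρ)) measurable_const
  have hWK (k : ℕ) (ω) (hω : InBox vmax ω) : |W k ω| ≤ μbar * vmax := by
    have h1 := mult_mem_Icc (ρ := ρ) (ε := ε) (T := T) (ω := ω) hμbar0 hμ₁ k
    have h2 := roundCost_mem_Icc (hω k).1 (hω k).2
    have h3 := (hω k).1.2
    have h4 : |roundCost (ω k).1 (ω k).2 - ρ| ≤ vmax :=
      abs_le.2 ⟨by linarith [h2.1], by linarith [h2.2]⟩
    simp only [hW]
    split_ifs
    · rw [abs_mul, abs_of_nonneg h1.1]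
      exact mul_le_mul h1.2 h4 (abs_nonneg _) hμbar0
    · rw [abs_zero]; positivity
  have hWi (k : ℕ) : Integrable (W k) (marketLaw F G) :=
    integrable_of_inBox hF hG (hWm k) _ (hWK k)
  -- The state before the round is unaffected by resampling it, so the mean over the round is `0` or
  -- `μ (meanCost - ρ)`.
  have hW0 (k : ℕ) : ∫ ω, W k ω ∂marketLaw F G ≤ 0 := by
    refine integral_nonpos_of_round hF hG (hWm k) _ (hWK k) k fun ω hω => ?_
    simp only [hW, state_update, Function.update_self]
    split_ifs
    · rw [integral_const_mul, integral_sub (integrable_roundCost hF hG) (integrable_const _)]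
      refine mul_nonpos_of_nonneg_of_nonpos (mult_mem_Icc hμbar0 hμ₁ k).1 ?_
      simpa [meanCost] using hc
    · simp
  have hsumi := integrable_finsetSum (Finset.range T) fun k _ => hWi k
  have key := mean_sub_le_of_loss (T := T) hF hG (measurable_revenue ρ μbar μ₁ ε T) (T * vmax)
    (fun ω hω => ?_) (hsumi.add (integrable_const
      (vmax / ρ * (vmax + μbar / ε) + (μbar ^ 2 / (2 * ε) + ε * vmax ^ 2 / 2 * T))))
    fun ω hω => loss_le hρ hρv hμbar hμ₁ hε hεv hω
  · simp only [Pi.add_apply] at key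
    rw [integral_add hsumi (integrable_const _), integral_finsetSum _ fun k _ => hWi k] at key
    simp only [integral_const, probReal_univ, smul_eq_mul, one_mul] at key
    have := Finset.sum_nonpos fun k (_ : k ∈ Finset.range T) => hW0 k
    refine le_trans ?_ key
    linarith
  · rw [abs_of_nonneg (revenue_nonneg hμbar0 hμ₁ hω)]
    refine (revenue_le hμbar0 hμ₁ hω).trans ?_
    simpa using Finset.sum_le_card_nsmul (Finset.range T)
      (fun k => roundRevenue (ω k).1 (ω k).2) vmax
      fun k _ => le_of_abs_le (abs_roundRevenue_le (hω k))

theorem expectedRevenue_le {F G : Measure ℝ} [IsProbabilityMeasure F] [IsProbabilityMeasure G]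
    {vmax ρ μbar μ₁ ε : ℝ} (hμbar : 0 ≤ μbar) (hμ₁ : μ₁ ∈ Icc 0 μbar)
    (hF : ∀ᵐ v ∂F, v ∈ Icc 0 vmax) (hG : ∀ᵐ p ∂G, p ∈ Icc 0 vmax) (T : ℕ) :
    expectedRevenue ρ μbar μ₁ ε T F G ≤ T * meanRevenue F G :=
  le_mean_of_le hF hG (fun _ hω => revenue_nonneg hμbar hμ₁ hω)
    fun _ hω => revenue_le hμbar hμ₁ hω

theorem expectedRevenue_nonneg {F G : Measure ℝ} [IsProbabilityMeasure F] [IsProbabilityMeasure G]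
    {vmax ρ μbar μ₁ ε : ℝ} (hμbar : 0 ≤ μbar) (hμ₁ : μ₁ ∈ Icc 0 μbar)
    (hF : ∀ᵐ v ∂F, v ∈ Icc 0 vmax) (hG : ∀ᵐ p ∂G, p ∈ Icc 0 vmax) (T : ℕ) :
    0 ≤ expectedRevenue ρ μbar μ₁ ε T F G :=
  integral_nonneg_of_ae ((ae_inBox hF hG).mono fun _ hω => revenue_nonneg hμbar hμ₁ hω)

end Pacing

/-! ### OGD-CB: telescoping sums of square roots. -/

namespace OGDCB

theorem inv_sqrt_succ_le (n : ℕ) : 1 / √((n : ℝ) + 1) ≤ 2 * (√((n : ℝ) + 1) - √n) := by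
  have h1 : 0 < √((n : ℝ) + 1) := Real.sqrt_pos.2 (by positivity)
  have h2 : √(n : ℝ) ≤ √((n : ℝ) + 1) := Real.sqrt_le_sqrt (by linarith)
  have h3 : √((n : ℝ) + 1) ^ 2 = n + 1 := Real.sq_sqrt (by positivity)
  have h4 : √(n : ℝ) ^ 2 = n := Real.sq_sqrt (by positivity)
  rw [div_le_iff₀ h1]
  nlinarith [sq_nonneg (√((n : ℝ) + 1) - √n)]

theorem sum_inv_sqrt_le (n : ℕ) : ∑ k ∈ Finset.range n, 1 / √((k : ℝ) + 1) ≤ 2 * √n := by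
  induction n with
  | zero => simp
  | succ n ih =>
    rw [Finset.sum_range_succ]
    have := inv_sqrt_succ_le n
    push_cast
    linarith

/-- Summation by parts against increasing weights. It is applied to `u = λ²`, where the weight is
the inverse of a step size of order `1 / √t`. -/
theorem sum_sub_mul_sqrt_le {u : ℕ → ℝ} {U : ℝ} (h0 : ∀ k, 0 ≤ u k) (hU : ∀ k, u k ≤ U) (n : ℕ) :
    ∑ k ∈ Finset.range n, (u k - u (k + 1)) * √((k : ℝ) + 1) ≤ U * √n := by
  have h : ∑ k ∈ Finset.range n, (u k - u (k + 1)) * √((k : ℝ) + 1) + u n * √n ≤ U * √n := by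
    induction n with
    | zero => simp
    | succ n ih =>
      have h1 : √(n : ℝ) ≤ √((n : ℝ) + 1) := Real.sqrt_le_sqrt (by linarith)
      have h2 := mul_le_mul_of_nonneg_right (hU n) (sub_nonneg.2 h1)
      rw [Finset.sum_range_succ]
      push_cast
      linarith
  linarith [mul_nonneg (h0 n) (Real.sqrt_nonneg (n : ℝ))]

/-- The counterpart for `u = λ`, used to bound overspending. -/
theorem sum_succ_sub_mul_sqrt_le {u : ℕ → ℝ} (h0 : ∀ k, 0 ≤ u k) (n : ℕ) :
    ∑ k ∈ Finset.range n, (u (k + 1) - u k) * √((k : ℝ) + 1) ≤ u n * √n := by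
  induction n with
  | zero => simp
  | succ n ih =>
    have h1 : √(n : ℝ) ≤ √((n : ℝ) + 1) := Real.sqrt_le_sqrt (by linarith)
    have h2 := mul_le_mul_of_nonneg_left h1 (h0 n)
    rw [Finset.sum_range_succ]
    push_cast
    linarith

/-- The logarithmic factor in the confidence radius. -/
noncomputable def logFactor (T : ℕ) : ℝ := (Real.log 2 + 2 * Real.log T) / 2

theorem logFactor_nonneg (T : ℕ) : 0 ≤ logFactor T := by
  have h1 := Real.log_nonneg (one_le_two (α := ℝ))
  have h2 := Real.log_natCast_nonneg T
  unfold logFactor; linarith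

theorem radius_eq (T n : ℕ) : radius T n = √(logFactor T) / √n := by
  rw [radius, ← Real.sqrt_div (logFactor_nonneg T), logFactor, div_div]

theorem radius_nonneg (T n : ℕ) : 0 ≤ radius T n := Real.sqrt_nonneg _

/-- Without observations the division by `0` returns `0`. -/
theorem radius_zero (T : ℕ) : radius T 0 = 0 := by simp [radius]

/-- The right side telescopes in the number of observations. For `n ≥ 1` the factor `3` comes from
`√(n + 1) + √n ≤ 3 √n`. -/
theorem radius_le (T n : ℕ) : radius T n ≤ 3 * √(logFactor T) * (√((n : ℝ) + 1) - √n) := by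
  have h2 : √(n : ℝ) ≤ √((n : ℝ) + 1) := Real.sqrt_le_sqrt (by linarith)
  rcases Nat.eq_zero_or_pos n with rfl | hn
  · rw [radius_zero]
    exact mul_nonneg (by positivity) (sub_nonneg.2 h2)
  · have hn' : (1 : ℝ) ≤ n := by exact_mod_cast hn
    have h1 : 0 < √(n : ℝ) := Real.sqrt_pos.2 (by linarith)
    have h3 : √((n : ℝ) + 1) ^ 2 = n + 1 := Real.sq_sqrt (by positivity)
    have h4 : √(n : ℝ) ^ 2 = n := Real.sq_sqrt (by positivity)
    have h5 : √((n : ℝ) + 1) ≤ 2 * √n := by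
      rw [Real.sqrt_le_left (by positivity)]
      nlinarith
    have h6 : 1 ≤ 3 * (√((n : ℝ) + 1) - √n) * √n := by nlinarith
    rw [radius_eq, div_le_iff₀ h1]
    nlinarith [Real.sqrt_nonneg (logFactor T)]

/-! ### OGD-CB on a fixed path: price, spending and running time. -/

section Pathwise

variable (fb : Feedback) (vmax ρ : ℝ) (T : ℕ) (ω : ℕ → ℝ × ℝ)

/-- `1` if OGD-CB enters round `k + 1`, and `0` otherwise. -/
noncomputable def entry (k : ℕ) : ℝ := if decision T ω k (state fb vmax ρ T ω k) then 1 else 0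

/-- `1` if the loop of OGD-CB is still running at the start of round `k + 1`, and `0` otherwise. -/
noncomputable def active (k : ℕ) : ℝ := if (state fb vmax ρ T ω k).running then 1 else 0

/-- The confidence radius in round `k + 1`. -/
noncomputable def radiusAt (k : ℕ) : ℝ := radius T (state fb vmax ρ T ω k).observed.card

/-- The estimated cost in round `k + 1`. -/
noncomputable def estCostAt (k : ℕ) : ℝ :=
  estCost T ω (state fb vmax ρ T ω k).observed (ω k).1

/-- The estimated revenue in round `k + 1`. -/
noncomputable def estRevenueAt (k : ℕ) : ℝ :=
  estRevenue T ω (state fb vmax ρ T ω k).observed (ω k).1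

/-- The pricing variable in round `k + 1`. -/
noncomputable def lamAt (k : ℕ) : ℝ := (state fb vmax ρ T ω k).lam

/-- An upper bound on the pricing variable. -/
noncomputable def lamBound : ℝ := 3 / 2 * vmax / ρ + 1

theorem state_succ (k : ℕ) :
    state fb vmax ρ T ω (k + 1) = step fb vmax ρ T ω k (state fb vmax ρ T ω k) := rfl

theorem observed_subset_range (k : ℕ) :
    (state fb vmax ρ T ω k).observed ⊆ Finset.range k := by
  induction k with
  | zero => exact Finset.empty_subset _
  | succ k ih =>
    have h1 : (state fb vmax ρ T ω k).observed ⊆ Finset.range (k + 1) :=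
      ih.trans (Finset.range_subset_range.2 k.le_succ)
    have h2 : insert k (state fb vmax ρ T ω k).observed ⊆ Finset.range (k + 1) :=
      Finset.insert_subset (Finset.self_mem_range_succ k) h1
    rw [state_succ, step]
    split_ifs
    · cases fb
      · exact h2
      · simp only [nextObserved]
        split_ifs
        exacts [h2, h1]
    · exact h1

theorem notMem_observed (k : ℕ) : k ∉ (state fb vmax ρ T ω k).observed := fun h => by
  simpa using observed_subset_range fb vmax ρ T ω k h

theorem observed_subset_succ (k : ℕ) :
    (state fb vmax ρ T ω k).observed ⊆ (state fb vmax ρ T ω (k + 1)).observed := by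
  rw [state_succ, step]
  split_ifs
  · cases fb
    · exact Finset.subset_insert _ _
    · simp only [nextObserved]
      split_ifs
      exacts [Finset.subset_insert _ _, subset_rfl]
  · exact subset_rfl

theorem running_of_decision {k : ℕ} (h : decision T ω k (state fb vmax ρ T ω k) = true) :
    (state fb vmax ρ T ω k).running = true := by
  rw [decision, Bool.and_eq_true] at h
  exact h.1

theorem observed_succ_of_decision {k : ℕ} (h : decision T ω k (state fb vmax ρ T ω k) = true) :
    (state fb vmax ρ T ω (k + 1)).observed = insert k (state fb vmax ρ T ω k).observed := by
  rw [state_succ, step, if_pos (running_of_decision fb vmax ρ T ω h)]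
  cases fb <;> simp [nextObserved, h]

/-- Round `1` is always entered, so its bid is observed under either feedback. -/
theorem card_observed_pos {k : ℕ} (hk : k ≠ 0) :
    0 < (state fb vmax ρ T ω k).observed.card := by
  have h : ∀ n, 0 ∈ (state fb vmax ρ T ω (n + 1)).observed := by
    intro n
    induction n with
    | zero =>
      rw [observed_succ_of_decision fb vmax ρ T ω (by simp [decision, state])]
      exact Finset.mem_insert_self _ _
    | succ n ih => exact observed_subset_succ fb vmax ρ T ω (n + 1) ih
  obtain ⟨n, rfl⟩ := Nat.exists_eq_succ_of_ne_zero hk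
  exact Finset.card_pos.2 ⟨0, h n⟩

theorem entry_eq_zero_or_one (k : ℕ) :
    entry fb vmax ρ T ω k = 0 ∨ entry fb vmax ρ T ω k = 1 := by
  unfold entry; split_ifs <;> simp

theorem active_eq_zero_or_one (k : ℕ) :
    active fb vmax ρ T ω k = 0 ∨ active fb vmax ρ T ω k = 1 := by
  unfold active; split_ifs <;> simp

theorem entry_eq_zero_of_active {k : ℕ} (h : active fb vmax ρ T ω k = 0) :
    entry fb vmax ρ T ω k = 0 := by
  unfold entry
  split_ifs with hd
  · simp [active, running_of_decision fb vmax ρ T ω hd] at h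
  · rfl

theorem decision_eq_true_of_entry {k : ℕ} (h : entry fb vmax ρ T ω k = 1) :
    decision T ω k (state fb vmax ρ T ω k) = true := by
  by_contra hd
  simp [entry, hd] at h

theorem running_of_active {k : ℕ} (h : active fb vmax ρ T ω k = 1) :
    (state fb vmax ρ T ω k).running = true := by
  by_contra hd
  simp [active, hd] at h

theorem entry_zero : entry fb vmax ρ T ω 0 = 1 := by simp [entry, decision, state]

theorem lamAt_zero : lamAt fb vmax ρ T ω 0 = 0 := rfl

theorem estCostAt_zero : estCostAt fb vmax ρ T ω 0 = 0 := by
  simp [estCostAt, estCost, state, radius_zero]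

theorem lamAt_succ_of_not_running {k : ℕ} (h : active fb vmax ρ T ω k = 0) :
    lamAt fb vmax ρ T ω (k + 1) = lamAt fb vmax ρ T ω k := by
  have hr : (state fb vmax ρ T ω k).running ≠ true := fun hd => by simp [active, hd] at h
  rw [lamAt, state_succ, step, if_neg hr, lamAt]

theorem lamAt_one : lamAt fb vmax ρ T ω 1 = 0 := by
  simp [lamAt, state, step, nextLam]

theorem lamAt_succ {k : ℕ} (hk : k ≠ 0) (h : active fb vmax ρ T ω k = 1) :
    lamAt fb vmax ρ T ω (k + 1) = max 0 (lamAt fb vmax ρ T ω k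
      + 1 / (vmax * √((k : ℝ) + 1))
        * (entry fb vmax ρ T ω k * estCostAt fb vmax ρ T ω k - ρ)) := by
  rw [lamAt, state_succ, step, if_pos (running_of_active fb vmax ρ T ω h)]
  simp only [nextLam, if_neg hk, stepSize, lamAt, entry, estCostAt, ite_mul, one_mul, zero_mul]

/-- OGD-CB enters exactly if the optimistic Lagrangian value is nonnegative. -/
theorem entry_mul_eq_max {k : ℕ} (hk : k ≠ 0) (h : active fb vmax ρ T ω k = 1) :
    entry fb vmax ρ T ω k
        * (estRevenueAt fb vmax ρ T ω k - lamAt fb vmax ρ T ω k * estCostAt fb vmax ρ T ω k)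
      = max 0 (estRevenueAt fb vmax ρ T ω k
          - lamAt fb vmax ρ T ω k * estCostAt fb vmax ρ T ω k) := by
  have hr := running_of_active fb vmax ρ T ω h
  by_cases hle : lamAt fb vmax ρ T ω k * estCostAt fb vmax ρ T ω k ≤ estRevenueAt fb vmax ρ T ω k
  · have hd : entry fb vmax ρ T ω k = 1 := by
      have : decision T ω k (state fb vmax ρ T ω k) = true := by
        simp only [lamAt, estCostAt, estRevenueAt] at hle
        simp [decision, hr, hle]
      simp [entry, this]
    rw [hd, one_mul, max_eq_right (by linarith)]
  · have hd : entry fb vmax ρ T ω k = 0 := by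
      have : decision T ω k (state fb vmax ρ T ω k) = false := by
        simp only [lamAt, estCostAt, estRevenueAt] at hle
        simpa [decision, hr, hk] using hle
      simp [entry, this]
    rw [hd, zero_mul, max_eq_left (by linarith)]

/-- Every entered round adds an observation, so the radii of entered rounds belong to distinct
sample sizes and `radius_le` telescopes. Radii of skipped rounds, which may stay large under partial
information, are not counted. -/
theorem sum_entry_mul_radiusAt_le (n : ℕ) :
    ∑ k ∈ Finset.range n, entry fb vmax ρ T ω k * radiusAt fb vmax ρ T ω k
      ≤ 3 * √(logFactor T) * √n := by
  have h : ∑ k ∈ Finset.range n, entry fb vmax ρ T ω k * radiusAt fb vmax ρ T ω k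
      ≤ 3 * √(logFactor T) * √((state fb vmax ρ T ω n).observed.card : ℝ) := by
    induction n with
    | zero => rw [Finset.sum_range_zero]; positivity
    | succ n ih =>
      rw [Finset.sum_range_succ]
      rcases entry_eq_zero_or_one fb vmax ρ T ω n with h | h
      · rw [h, zero_mul, add_zero]
        refine ih.trans (mul_le_mul_of_nonneg_left (Real.sqrt_le_sqrt ?_) (by positivity))
        exact_mod_cast Finset.card_le_card (observed_subset_succ fb vmax ρ T ω n)
      · rw [observed_succ_of_decision fb vmax ρ T ω (decision_eq_true_of_entry fb vmax ρ T ω h),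
          Finset.card_insert_of_notMem (notMem_observed fb vmax ρ T ω n), h, one_mul, radiusAt]
        have := radius_le T (state fb vmax ρ T ω n).observed.card
        push_cast
        linarith
  refine h.trans (mul_le_mul_of_nonneg_left (Real.sqrt_le_sqrt ?_) (by positivity))
  have := Finset.card_le_card (observed_subset_range fb vmax ρ T ω n)
  rw [Finset.card_range] at this
  exact_mod_cast this

theorem radiusAt_nonneg (k : ℕ) : 0 ≤ radiusAt fb vmax ρ T ω k := radius_nonneg _ _

variable {fb vmax ρ T ω}

theorem mean_mem_Icc {I : Finset ℕ} {g : ℕ → ℝ} {v : ℝ} (hv : 0 ≤ v) (hg : ∀ τ, g τ ∈ Icc 0 v) :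
    (∑ τ ∈ I, g τ) / I.card ∈ Icc 0 v := by
  have h1 := Finset.sum_nonneg fun τ (_ : τ ∈ I) => (hg τ).1
  have h2 := Finset.sum_le_card_nsmul I g v fun τ _ => (hg τ).2
  rw [nsmul_eq_mul] at h2
  exact ⟨by positivity, div_le_of_le_mul₀ (by positivity) hv (by linarith)⟩

theorem estCostAt_mem (hω : InBox vmax ω) (k : ℕ) :
    estCostAt fb vmax ρ T ω k ∈ Icc (-(2 * radiusAt fb vmax ρ T ω k * (ω k).1))
      ((ω k).1 - 2 * radiusAt fb vmax ρ T ω k * (ω k).1) := by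
  have h := mean_mem_Icc (I := (state fb vmax ρ T ω k).observed) (hω k).1.1
    fun τ => roundCost_mem_Icc (hω k).1 (hω τ).2
  simp only [estCostAt, estCost, radiusAt]
  constructor <;> linarith [h.1, h.2]

theorem estRevenueAt_le (hω : InBox vmax ω) (k : ℕ) :
    estRevenueAt fb vmax ρ T ω k ≤ (ω k).1 + radiusAt fb vmax ρ T ω k * (ω k).1 := by
  have h := mean_mem_Icc (I := (state fb vmax ρ T ω k).observed) (hω k).1.1
    fun τ => roundRevenue_mem_Icc (hω k).1 (hω τ).2
  simp only [estRevenueAt, estRevenue, radiusAt]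
  linarith [h.2]

theorem estCostAt_le (hω : InBox vmax ω) (k : ℕ) : estCostAt fb vmax ρ T ω k ≤ vmax := by
  have h1 := (estCostAt_mem (fb := fb) (ρ := ρ) (T := T) hω k).2
  have h2 := mul_nonneg (radiusAt_nonneg fb vmax ρ T ω k) (hω k).1.1
  linarith [(hω k).1.2]

theorem lamAt_nonneg (k : ℕ) : 0 ≤ lamAt fb vmax ρ T ω k := by
  induction k with
  | zero => exact (lamAt_zero fb vmax ρ T ω).ge
  | succ k ih =>
    rcases active_eq_zero_or_one fb vmax ρ T ω k with h | h
    · rwa [lamAt_succ_of_not_running fb vmax ρ T ω h]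
    · rcases eq_or_ne k 0 with rfl | hk
      · exact (lamAt_one fb vmax ρ T ω).ge
      · rw [lamAt_succ fb vmax ρ T ω hk h]; exact le_max_left _ _

theorem lamBound_nonneg (hρ : 0 < ρ) (hvmax : 0 < vmax) : 0 ≤ lamBound vmax ρ := by
  unfold lamBound; positivity

/-- The pricing variable can only grow while the estimated cost exceeds `ρ`, and entering then
keeps it below the ratio of the estimates. -/
theorem lamAt_le (hρ : 0 < ρ) (hvmax : 0 < vmax) (hω : InBox vmax ω) (k : ℕ) :
    lamAt fb vmax ρ T ω k ≤ lamBound vmax ρ := by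
  induction k with
  | zero => exact lamBound_nonneg hρ hvmax
  | succ k ih =>
    rcases active_eq_zero_or_one fb vmax ρ T ω k with h | h
    · rwa [lamAt_succ_of_not_running fb vmax ρ T ω h]
    rcases eq_or_ne k 0 with rfl | hk
    · rw [zero_add, lamAt_one]; exact lamBound_nonneg hρ hvmax
    rw [lamAt_succ fb vmax ρ T ω hk h]
    refine max_le (lamBound_nonneg hρ hvmax) ?_
    have hη0 : 0 ≤ 1 / (vmax * √((k : ℝ) + 1)) := by positivity
    rcases le_or_gt (entry fb vmax ρ T ω k * estCostAt fb vmax ρ T ω k) ρ with hle | hgt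
    · have := mul_nonpos_of_nonneg_of_nonpos hη0 (sub_nonpos.2 hle)
      linarith
    · rcases entry_eq_zero_or_one fb vmax ρ T ω k with hx | hx
      · rw [hx, zero_mul] at hgt; linarith
      rw [hx, one_mul] at hgt ⊢
      have hmax := entry_mul_eq_max fb vmax ρ T ω hk h
      rw [hx, one_mul] at hmax
      have hpos : lamAt fb vmax ρ T ω k * estCostAt fb vmax ρ T ω k
          ≤ estRevenueAt fb vmax ρ T ω k := by
        have := le_max_left 0 (estRevenueAt fb vmax ρ T ω k
          - lamAt fb vmax ρ T ω k * estCostAt fb vmax ρ T ω k)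
        linarith
      have hc := (estCostAt_mem (fb := fb) (ρ := ρ) (T := T) hω k).2
      have hr := estRevenueAt_le (fb := fb) (ρ := ρ) (T := T) hω k
      have hv := (hω k).1
      -- The constant `3 / 2`: as `0 < ρ` is less than the estimated cost, which is at most `(1 - 2
      -- ε) v`, the optimistic bonus `ε v` is below `v / 2`.
      have hrad : estRevenueAt fb vmax ρ T ω k ≤ 3 / 2 * vmax := by linarith [hv.2]
      have h1 : lamAt fb vmax ρ T ω k * ρ ≤ lamAt fb vmax ρ T ω k * estCostAt fb vmax ρ T ω k :=
        mul_le_mul_of_nonneg_left hgt.le (lamAt_nonneg k)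
      have h2 : lamAt fb vmax ρ T ω k ≤ 3 / 2 * vmax / ρ := (le_div_iff₀ hρ).2 (by linarith)
      -- A single step raises the price by at most `1`, the last summand of `lamBound`.
      have h3 : 1 / (vmax * √((k : ℝ) + 1)) * (estCostAt fb vmax ρ T ω k - ρ) ≤ 1 := by
        have hs : 1 ≤ √((k : ℝ) + 1) := Real.one_le_sqrt.2 (by linarith [k.cast_nonneg (α := ℝ)])
        have hcv := estCostAt_le (fb := fb) (ρ := ρ) (T := T) hω k
        rw [div_mul_eq_mul_div, one_mul, div_le_one (by positivity)]
        nlinarith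
      unfold lamBound
      linarith

/-- The regret of a gradient step against the pricing variable `0`. -/
theorem active_mul_lamAt_le (hρ : 0 < ρ) (hρv : ρ ≤ vmax) (hω : InBox vmax ω) (k : ℕ) :
    active fb vmax ρ T ω k * lamAt fb vmax ρ T ω k
        * (ρ - entry fb vmax ρ T ω k * estCostAt fb vmax ρ T ω k)
      ≤ vmax / 2 * ((lamAt fb vmax ρ T ω k ^ 2 - lamAt fb vmax ρ T ω (k + 1) ^ 2)
          * √((k : ℝ) + 1))
        + vmax / 2 * (1 / √((k : ℝ) + 1))
        + 2 * lamBound vmax ρ * vmax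
          * (entry fb vmax ρ T ω k * radiusAt fb vmax ρ T ω k) := by
  have hvmax : 0 < vmax := hρ.trans_le hρv
  have hs : 0 < √((k : ℝ) + 1) := Real.sqrt_pos.2 (by positivity)
  have hX : 0 ≤ entry fb vmax ρ T ω k * radiusAt fb vmax ρ T ω k := by
    rcases entry_eq_zero_or_one fb vmax ρ T ω k with h | h <;> simp [h, radiusAt_nonneg]
  have hΛ := lamBound_nonneg hρ hvmax
  have hrest : 0 ≤ 2 * lamBound vmax ρ * vmax
      * (entry fb vmax ρ T ω k * radiusAt fb vmax ρ T ω k) := by positivity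
  have hrest' : 0 ≤ vmax / 2 * (1 / √((k : ℝ) + 1)) := by positivity
  rcases active_eq_zero_or_one fb vmax ρ T ω k with h | h
  · rw [lamAt_succ_of_not_running fb vmax ρ T ω h, h]
    simp only [zero_mul, sub_self, mul_zero]
    linarith
  rcases eq_or_ne k 0 with rfl | hk
  · rw [zero_add, lamAt_one, lamAt_zero]
    simp only [zero_mul, sub_self, mul_zero]
    linarith
  have hl := lamAt_succ fb vmax ρ T ω hk h
  have hl0 := lamAt_nonneg (fb := fb) (vmax := vmax) (ρ := ρ) (T := T) (ω := ω) k
  have hlΛ := lamAt_le (fb := fb) (T := T) hρ hvmax hω k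
  have hc := (estCostAt_mem (fb := fb) (ρ := ρ) (T := T) hω k).1
  have hcv := estCostAt_le (fb := fb) (ρ := ρ) (T := T) hω k
  have hr0 := radiusAt_nonneg fb vmax ρ T ω k
  have hrv : radiusAt fb vmax ρ T ω k * (ω k).1 ≤ radiusAt fb vmax ρ T ω k * vmax :=
    mul_le_mul_of_nonneg_left (hω k).1.2 hr0
  rw [h, one_mul]
  generalize lamAt fb vmax ρ T ω (k + 1) = l' at hl ⊢
  generalize lamAt fb vmax ρ T ω k = l at *
  generalize estCostAt fb vmax ρ T ω k = c at *
  generalize radiusAt fb vmax ρ T ω k = ε at *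
  generalize lamBound vmax ρ = Λ at *
  -- The estimated cost can be very negative, which would spoil the square of the gradient. Its
  -- positive part `y` lies in `[0, vmax]` and exceeds it by at most `2 vmax ε` in an entered round;
  -- this excess becomes the radius term.
  have hxc : ∃ y, entry fb vmax ρ T ω k * c ≤ y ∧ 0 ≤ y ∧ y ≤ vmax ∧
      y ≤ entry fb vmax ρ T ω k * c + 2 * vmax * (entry fb vmax ρ T ω k * ε) := by
    refine ⟨max 0 (entry fb vmax ρ T ω k * c), le_max_right _ _, le_max_left _ _, ?_, ?_⟩ <;>
      rcases entry_eq_zero_or_one fb vmax ρ T ω k with hx | hx <;> rw [hx]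
    · simpa using hvmax.le
    · simpa using ⟨hvmax.le, hcv⟩
    · simp
    · rw [one_mul, one_mul]
      have : 0 ≤ vmax * ε := by positivity
      refine max_le ?_ ?_ <;> linarith
  generalize entry fb vmax ρ T ω k = x at *
  obtain ⟨y, hy1, hy0, hyv, hy2⟩ := hxc
  set η := 1 / (vmax * √((k : ℝ) + 1)) with hη
  have hη0 : 0 < η := by positivity
  have h1 : l' ^ 2 ≤ (l + η * (y - ρ)) ^ 2 := by
    rw [← sq_abs (l + η * (y - ρ)), hl]
    refine pow_le_pow_left₀ (le_max_left _ _) (max_le (abs_nonneg _) ?_) 2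
    refine le_trans ?_ (le_abs_self _)
    gcongr
  have h2 : (y - ρ) ^ 2 ≤ vmax ^ 2 := sq_le_sq' (by linarith) (by linarith)
  have h3 : 2 * η * (l * (ρ - y)) ≤ l ^ 2 - l' ^ 2 + η ^ 2 * vmax ^ 2 := by
    nlinarith [mul_le_mul_of_nonneg_left h2 (sq_nonneg η)]
  have h4 : l * (ρ - y) ≤ vmax / 2 * ((l ^ 2 - l' ^ 2) * √((k : ℝ) + 1))
      + vmax / 2 * (1 / √((k : ℝ) + 1)) := by
    have h5 : l * (ρ - y) ≤ (l ^ 2 - l' ^ 2 + η ^ 2 * vmax ^ 2) / (2 * η) := by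
      rw [le_div_iff₀ (by positivity)]; linarith
    refine h5.trans_eq ?_
    rw [hη]; field_simp
  have h6 : l * (y - x * c) ≤ Λ * (2 * vmax * (x * ε)) :=
    mul_le_mul hlΛ (by linarith) (by linarith) hΛ
  linarith

theorem sum_active_mul_lamAt_le (hρ : 0 < ρ) (hρv : ρ ≤ vmax) (hω : InBox vmax ω) (n : ℕ) :
    ∑ k ∈ Finset.range n, active fb vmax ρ T ω k * lamAt fb vmax ρ T ω k
        * (ρ - entry fb vmax ρ T ω k * estCostAt fb vmax ρ T ω k)
      ≤ (vmax / 2 * lamBound vmax ρ ^ 2 + vmax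
        + 6 * lamBound vmax ρ * vmax * √(logFactor T)) * √n := by
  have hvmax : 0 < vmax := hρ.trans_le hρv
  have hΛ := lamBound_nonneg hρ hvmax
  have h1 := sum_sub_mul_sqrt_le (u := fun k => lamAt fb vmax ρ T ω k ^ 2)
    (U := lamBound vmax ρ ^ 2) (fun k => sq_nonneg _)
    (fun k => pow_le_pow_left₀ (lamAt_nonneg k) (lamAt_le hρ hvmax hω k) 2) n
  have h2 := sum_inv_sqrt_le n
  have h3 := sum_entry_mul_radiusAt_le fb vmax ρ T ω n
  refine (Finset.sum_le_sum fun k _ => active_mul_lamAt_le hρ hρv hω k).trans ?_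
  rw [Finset.sum_add_distrib, Finset.sum_add_distrib, ← Finset.mul_sum, ← Finset.mul_sum,
    ← Finset.mul_sum]
  have h4 := mul_le_mul_of_nonneg_left h1 (by positivity : 0 ≤ vmax / 2)
  have h5 := mul_le_mul_of_nonneg_left h2 (by positivity : 0 ≤ vmax / 2)
  have h6 := mul_le_mul_of_nonneg_left h3 (by positivity : 0 ≤ 2 * lamBound vmax ρ * vmax)
  linarith

/-- The price is not projected from above, so its increments dominate the estimated overspending. -/
theorem active_mul_le (hρ : 0 < ρ) (hvmax : 0 < vmax) (k : ℕ) :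
    active fb vmax ρ T ω k * (entry fb vmax ρ T ω k * estCostAt fb vmax ρ T ω k - ρ)
      ≤ vmax * ((lamAt fb vmax ρ T ω (k + 1) - lamAt fb vmax ρ T ω k) * √((k : ℝ) + 1)) := by
  rcases active_eq_zero_or_one fb vmax ρ T ω k with h | h
  · rw [lamAt_succ_of_not_running fb vmax ρ T ω h, h]; simp
  rcases eq_or_ne k 0 with rfl | hk
  · rw [zero_add, lamAt_one, lamAt_zero, estCostAt_zero, h]; simp [hρ.le]
  have hs : 0 < √((k : ℝ) + 1) := Real.sqrt_pos.2 (by positivity)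
  have hl := le_max_right 0 (lamAt fb vmax ρ T ω k + 1 / (vmax * √((k : ℝ) + 1))
        * (entry fb vmax ρ T ω k * estCostAt fb vmax ρ T ω k - ρ))
  rw [← lamAt_succ fb vmax ρ T ω hk h] at hl
  have h1 : (entry fb vmax ρ T ω k * estCostAt fb vmax ρ T ω k - ρ) / (vmax * √((k : ℝ) + 1))
      ≤ lamAt fb vmax ρ T ω (k + 1) - lamAt fb vmax ρ T ω k := by
    rw [div_eq_mul_one_div, mul_comm]; linarith
  rw [div_le_iff₀ (by positivity)] at h1
  rw [h, one_mul]
  linarith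

theorem sum_active_mul_le (hρ : 0 < ρ) (hvmax : 0 < vmax) (hω : InBox vmax ω) (n : ℕ) :
    ∑ k ∈ Finset.range n,
        active fb vmax ρ T ω k * (entry fb vmax ρ T ω k * estCostAt fb vmax ρ T ω k - ρ)
      ≤ lamBound vmax ρ * vmax * √n := by
  refine (Finset.sum_le_sum fun k _ => active_mul_le hρ hvmax k).trans ?_
  rw [← Finset.mul_sum]
  have h1 := sum_succ_sub_mul_sqrt_le (u := lamAt fb vmax ρ T ω) lamAt_nonneg n
  have h2 := mul_le_mul_of_nonneg_right (lamAt_le (fb := fb) (T := T) hρ hvmax hω n)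
    (Real.sqrt_nonneg (n : ℝ))
  have h3 := mul_le_mul_of_nonneg_left (h1.trans h2) hvmax.le
  linarith

theorem budget_eq (n : ℕ) : (state fb vmax ρ T ω n).budget
    = ρ * T - ∑ k ∈ Finset.range n, entry fb vmax ρ T ω k * roundCost (ω k).1 (ω k).2 := by
  induction n with
  | zero => simp [state]
  | succ n ih =>
    rw [Finset.sum_range_succ, ← sub_sub, ← ih, state_succ, step]
    split_ifs with h
    · simp [nextBudget, entry]
    · simp [entry, decision, h]

theorem budget_lt_of_active (n : ℕ) (h : active fb vmax ρ T ω n = 0) :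
    (state fb vmax ρ T ω n).budget < vmax := by
  induction n with
  | zero => simp [active, state] at h
  | succ n ih =>
    rcases active_eq_zero_or_one fb vmax ρ T ω n with h' | h'
    · have hr : (state fb vmax ρ T ω n).running ≠ true := fun hd => by simp [active, hd] at h'
      rw [state_succ, step, if_neg hr]
      exact ih h'
    · have hr := running_of_active fb vmax ρ T ω h'
      simp only [active, state_succ, step, if_pos hr] at h ⊢
      by_contra hle
      push Not at hle
      simp [hle] at h

theorem active_succ_eq_zero {n : ℕ} (h : active fb vmax ρ T ω n = 0) :
    active fb vmax ρ T ω (n + 1) = 0 := by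
  have hr : (state fb vmax ρ T ω n).running ≠ true := fun hd => by simp [active, hd] at h
  rw [active, state_succ, step, if_neg hr]
  exact h

theorem active_eq_zero_of_le {m n : ℕ} (hmn : m ≤ n) (h : active fb vmax ρ T ω m = 0) :
    active fb vmax ρ T ω n = 0 := by
  induction n, hmn using Nat.le_induction with
  | base => exact h
  | succ n _ ih => exact active_succ_eq_zero ih

end Pathwise

end OGDCB

/-! ### OGD-CB: mean outcomes at a given value, estimation errors and the loss on a path. -/

theorem integral_price_mem_Icc {G : Measure ℝ} [IsProbabilityMeasure G] {v : ℝ} {f : ℝ → ℝ}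
    (hf : ∀ᵐ p ∂G, f p ∈ Icc 0 v) : ∫ p, f p ∂G ∈ Icc 0 v := by
  refine ⟨integral_nonneg_of_ae (hf.mono fun p hp => hp.1), ?_⟩
  have := integral_mono_of_nonneg (hf.mono fun p hp => hp.1) (integrable_const (μ := G) v)
    (hf.mono fun p hp => hp.2)
  simpa using this

theorem mean_roundRevenue_mem_Icc {G : Measure ℝ} [IsProbabilityMeasure G] {vmax v : ℝ}
    (hG : ∀ᵐ p ∂G, p ∈ Icc 0 vmax) (hv : v ∈ Icc 0 vmax) :
    ∫ p, roundRevenue v p ∂G ∈ Icc 0 v :=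
  integral_price_mem_Icc (hG.mono fun _ hp => roundRevenue_mem_Icc hv hp)

theorem mean_roundCost_mem_Icc {G : Measure ℝ} [IsProbabilityMeasure G] {vmax v : ℝ}
    (hG : ∀ᵐ p ∂G, p ∈ Icc 0 vmax) (hv : v ∈ Icc 0 vmax) :
    ∫ p, roundCost v p ∂G ∈ Icc 0 v :=
  integral_price_mem_Icc (hG.mono fun _ hp => roundCost_mem_Icc hv hp)

namespace OGDCB

/-- The deviation of the sum of the observed outcomes of a round with value `v` from its mean. -/
noncomputable def deviation (G : Measure ℝ) (g : ℝ → ℝ → ℝ) (ω : ℕ → ℝ × ℝ) (I : Finset ℕ)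
    (v : ℝ) : ℝ := ∑ τ ∈ I, (g v (ω τ).2 - ∫ p, g v p ∂G)

/-- The event that the mean outcome of round `k + 1` is not within the confidence radius of the
empirical one. -/
def misestimated (fb : Feedback) (vmax ρ : ℝ) (T : ℕ) (G : Measure ℝ) (g : ℝ → ℝ → ℝ) (k : ℕ) :
    Set (ℕ → ℝ × ℝ) :=
  {ω | (state fb vmax ρ T ω k).observed.card * radiusAt fb vmax ρ T ω k * (ω k).1
    < |deviation G g ω (state fb vmax ρ T ω k).observed (ω k).1|}

/-- The number of the two estimates of round `k + 1` that are not accurate. -/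
noncomputable def errors (fb : Feedback) (vmax ρ : ℝ) (T : ℕ) (G : Measure ℝ) (k : ℕ)
    (ω : ℕ → ℝ × ℝ) : ℝ :=
  (misestimated fb vmax ρ T G roundRevenue k).indicator 1 ω
    + (misestimated fb vmax ρ T G roundCost k).indicator 1 ω

section Pathwise

variable {fb : Feedback} {vmax ρ : ℝ} {T : ℕ} {ω : ℕ → ℝ × ℝ} {G : Measure ℝ}

theorem errors_nonneg (k : ℕ) : 0 ≤ errors fb vmax ρ T G k ω :=
  add_nonneg (indicator_nonneg (fun _ _ => zero_le_one) _)
    (indicator_nonneg (fun _ _ => zero_le_one) _)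

theorem errors_le (k : ℕ) : errors fb vmax ρ T G k ω ≤ 2 := by
  have h (s : Set (ℕ → ℝ × ℝ)) : s.indicator (1 : (ℕ → ℝ × ℝ) → ℝ) ω ≤ 1 :=
    indicator_le_self' (fun _ _ => zero_le_one) ω
  unfold errors
  linarith [h (misestimated fb vmax ρ T G roundRevenue k),
    h (misestimated fb vmax ρ T G roundCost k)]

theorem notMem_or_one_le_errors (k : ℕ) :
    (ω ∉ misestimated fb vmax ρ T G roundRevenue k ∧ ω ∉ misestimated fb vmax ρ T G roundCost k)
      ∨ 1 ≤ errors fb vmax ρ T G k ω := by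
  have h (s : Set (ℕ → ℝ × ℝ)) : 0 ≤ s.indicator (1 : (ℕ → ℝ × ℝ) → ℝ) ω :=
    indicator_nonneg (fun _ _ => zero_le_one) ω
  by_cases h1 : ω ∈ misestimated fb vmax ρ T G roundRevenue k
  · right
    rw [errors, indicator_of_mem h1]
    simpa using h _
  · by_cases h2 : ω ∈ misestimated fb vmax ρ T G roundCost k
    · right
      rw [errors, indicator_of_mem h2]
      simpa using h _
    · exact Or.inl ⟨h1, h2⟩

theorem abs_mean_sub_le {g : ℝ → ℝ → ℝ} {k : ℕ} (hk : k ≠ 0)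
    (h : ω ∉ misestimated fb vmax ρ T G g k) :
    |(∑ τ ∈ (state fb vmax ρ T ω k).observed, g (ω k).1 (ω τ).2)
        / (state fb vmax ρ T ω k).observed.card - ∫ p, g (ω k).1 p ∂G|
      ≤ radiusAt fb vmax ρ T ω k * (ω k).1 := by
  have hn : (0 : ℝ) < (state fb vmax ρ T ω k).observed.card := by
    exact_mod_cast card_observed_pos fb vmax ρ T ω hk
  rw [misestimated, mem_ofPred_eq, not_lt, deviation, Finset.sum_sub_distrib, Finset.sum_const,
    nsmul_eq_mul] at h
  rw [div_sub' hn.ne', abs_div, abs_of_pos hn, div_le_iff₀ hn]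
  linarith

/-- Entering as OGD-CB does is, up to the estimation error, at least as good as maximizing the
Lagrangian. -/
theorem entry_mul_mean_ge [IsProbabilityMeasure G] (hρ : 0 < ρ) (hvmax : 0 < vmax)
    (hG : ∀ᵐ p ∂G, p ∈ Icc 0 vmax) (hω : InBox vmax ω) (k : ℕ) :
    active fb vmax ρ T ω k * (∫ p, roundRevenue (ω k).1 p ∂G)
      ≤ entry fb vmax ρ T ω k * (∫ p, roundRevenue (ω k).1 p ∂G)
        + active fb vmax ρ T ω k * lamAt fb vmax ρ T ω k * ((∫ p, roundCost (ω k).1 p ∂G) - ρ)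
        + active fb vmax ρ T ω k * lamAt fb vmax ρ T ω k
          * (ρ - entry fb vmax ρ T ω k * estCostAt fb vmax ρ T ω k)
        + 2 * vmax * (entry fb vmax ρ T ω k * radiusAt fb vmax ρ T ω k)
        + (1 + lamBound vmax ρ) * vmax * errors fb vmax ρ T G k ω := by
  have hv := (hω k).1
  have hr := mean_roundRevenue_mem_Icc hG hv
  have hc := mean_roundCost_mem_Icc hG hv
  have he := errors_nonneg (fb := fb) (vmax := vmax) (ρ := ρ) (T := T) (G := G) (ω := ω) k
  have hl0 := lamAt_nonneg (fb := fb) (vmax := vmax) (ρ := ρ) (T := T) (ω := ω) k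
  have hlΛ := lamAt_le (fb := fb) (T := T) hρ hvmax hω k
  have hΛ := lamBound_nonneg hρ hvmax
  have hε := radiusAt_nonneg fb vmax ρ T ω k
  have hK : 0 ≤ (1 + lamBound vmax ρ) * vmax * errors fb vmax ρ T G k ω := by positivity
  rcases active_eq_zero_or_one fb vmax ρ T ω k with h | h
  · rw [h, entry_eq_zero_of_active fb vmax ρ T ω h]
    simpa using hK
  rcases eq_or_ne k 0 with rfl | hk
  · rw [h, entry_zero, lamAt_zero]
    have : 0 ≤ vmax * radiusAt fb vmax ρ T ω 0 := by positivity
    linarith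
  have hεv : radiusAt fb vmax ρ T ω k * (ω k).1 ≤ radiusAt fb vmax ρ T ω k * vmax :=
    mul_le_mul_of_nonneg_left hv.2 hε
  have hεv0 := mul_nonneg hε hv.1
  rw [h]
  rcases notMem_or_one_le_errors (fb := fb) (vmax := vmax) (ρ := ρ) (T := T) (G := G) (ω := ω) k
    with ⟨hgr, hgc⟩ | hbad
  -- With accurate estimates, `r̂` lies between the mean revenue `r` and `r + 2 ε vmax`, and `ĉ` is
  -- at most the mean cost `c`. Hence `x (r̂ - λ ĉ) = max 0 (r̂ - λ ĉ) ≥ r - λ c`.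
  · have h1 := abs_le.1 (abs_mean_sub_le hk hgr)
    have h2 := abs_le.1 (abs_mean_sub_le hk hgc)
    have h3 : (∫ p, roundRevenue (ω k).1 p ∂G) ≤ estRevenueAt fb vmax ρ T ω k := by
      simp only [estRevenueAt, estRevenue]
      simp only [radiusAt] at h1
      linarith [h1.1]
    have h4 : estRevenueAt fb vmax ρ T ω k
        ≤ (∫ p, roundRevenue (ω k).1 p ∂G) + 2 * (radiusAt fb vmax ρ T ω k * vmax) := by
      refine le_trans ?_ (add_le_add_right (mul_le_mul_of_nonneg_left hεv zero_le_two) _)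
      simp only [estRevenueAt, estRevenue]
      simp only [radiusAt] at h1 ⊢
      linarith [h1.2]
    have h5 : estCostAt fb vmax ρ T ω k ≤ ∫ p, roundCost (ω k).1 p ∂G := by
      simp only [estCostAt, estCost]
      simp only [radiusAt] at h2 hεv0
      linarith [h2.2]
    have h6 := entry_mul_eq_max fb vmax ρ T ω hk h
    have h7 := le_max_right 0 (estRevenueAt fb vmax ρ T ω k
          - lamAt fb vmax ρ T ω k * estCostAt fb vmax ρ T ω k)
    rw [← h6] at h7
    have h8 := mul_le_mul_of_nonneg_left h5 hl0
    have h9 : entry fb vmax ρ T ω k * estRevenueAt fb vmax ρ T ω k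
        ≤ entry fb vmax ρ T ω k * ((∫ p, roundRevenue (ω k).1 p ∂G)
          + 2 * (radiusAt fb vmax ρ T ω k * vmax)) := by
      refine mul_le_mul_of_nonneg_left h4 ?_
      rcases entry_eq_zero_or_one fb vmax ρ T ω k with hx | hx <;> rw [hx]
      exact zero_le_one
    linarith
  -- In a misestimated round all quantities are bounded crudely, and the error term, at least `(1 +
  -- Λ) vmax`, pays for them.
  · have h1 : (1 + lamBound vmax ρ) * vmax * 1
        ≤ (1 + lamBound vmax ρ) * vmax * errors fb vmax ρ T G k ω := by gcongr
    have h2 := mul_nonneg hl0 hc.1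
    have h3 : lamAt fb vmax ρ T ω k * vmax ≤ lamBound vmax ρ * vmax := by gcongr
    have h4 := mul_le_mul_of_nonneg_left (estCostAt_le (fb := fb) (ρ := ρ) (T := T) hω k) hl0
    have h5 := mul_nonneg hε hvmax.le
    have h6 := mul_nonneg hl0 hvmax.le
    rcases entry_eq_zero_or_one fb vmax ρ T ω k with hx | hx <;> rw [hx] <;>
      linarith [hr.1, hr.2, hv.2]

/-- The true mean cost exceeds an accurate estimate by at most `3 ε v`: `2 ε v` of deliberate
optimism and `ε v` of sampling error. Round `1` has no data and is charged `vmax`. -/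
theorem entry_mul_mean_cost_le [IsProbabilityMeasure G] (hvmax : 0 < vmax)
    (hG : ∀ᵐ p ∂G, p ∈ Icc 0 vmax) (hω : InBox vmax ω) (k : ℕ) :
    entry fb vmax ρ T ω k * (∫ p, roundCost (ω k).1 p ∂G)
      ≤ active fb vmax ρ T ω k * (entry fb vmax ρ T ω k * estCostAt fb vmax ρ T ω k - ρ)
        + active fb vmax ρ T ω k * ρ
        + 3 * vmax * (entry fb vmax ρ T ω k * radiusAt fb vmax ρ T ω k)
        + vmax * errors fb vmax ρ T G k ω + if k = 0 then vmax else 0 := by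
  have hv := (hω k).1
  have hc := mean_roundCost_mem_Icc hG hv
  have he := errors_nonneg (fb := fb) (vmax := vmax) (ρ := ρ) (T := T) (G := G) (ω := ω) k
  have hε := radiusAt_nonneg fb vmax ρ T ω k
  have hve := mul_nonneg hvmax.le he
  have hvε := mul_nonneg hvmax.le hε
  rcases entry_eq_zero_or_one fb vmax ρ T ω k with hx | hx
  · rw [hx]
    split_ifs <;> linarith
  have h : active fb vmax ρ T ω k = 1 := by
    rcases active_eq_zero_or_one fb vmax ρ T ω k with h | h
    · rw [entry_eq_zero_of_active fb vmax ρ T ω h] at hx; norm_num at hx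
    · exact h
  rw [h, hx]
  rcases eq_or_ne k 0 with rfl | hk
  · rw [estCostAt_zero, if_pos rfl]
    linarith [hc.2, hv.2]
  rw [if_neg hk]
  have hεv : radiusAt fb vmax ρ T ω k * (ω k).1 ≤ radiusAt fb vmax ρ T ω k * vmax :=
    mul_le_mul_of_nonneg_left hv.2 hε
  rcases notMem_or_one_le_errors (fb := fb) (vmax := vmax) (ρ := ρ) (T := T) (G := G) (ω := ω) k
    with ⟨-, hgc⟩ | hbad
  · have h2 := abs_le.1 (abs_mean_sub_le hk hgc)
    have h5 : (∫ p, roundCost (ω k).1 p ∂G)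
        ≤ estCostAt fb vmax ρ T ω k + 3 * (radiusAt fb vmax ρ T ω k * (ω k).1) := by
      simp only [estCostAt, estCost]
      simp only [radiusAt] at h2 ⊢
      linarith [h2.1]
    linarith
  · have h1 : vmax * 1 ≤ vmax * errors fb vmax ρ T G k ω := by gcongr
    have h2 := (estCostAt_mem (fb := fb) (ρ := ρ) (T := T) hω k).1
    linarith [hc.2, hv.2]

/-- The part of the loss of OGD-CB that is bounded on every path. -/
noncomputable def lossBound (vmax ρ : ℝ) (T : ℕ) : ℝ :=
  vmax / ρ * (2 * vmax + 9 * vmax * √(logFactor T) * √T + lamBound vmax ρ * vmax * √T)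
    + (vmax / 2 * lamBound vmax ρ ^ 2 + vmax
        + 6 * lamBound vmax ρ * vmax * √(logFactor T)) * √T
    + 6 * vmax * √(logFactor T) * √T

/-- If the loop is left, more than `ρ T - vmax` has been spent. Spending is its martingale part plus
conditional means, which are `ρ` per active round up to the increase of the price, the radii and the
errors. The `2 vmax` collects the unspent remainder and round `1`. -/
theorem idle_rounds_le [IsProbabilityMeasure G] (hρ : 0 < ρ) (hvmax : 0 < vmax)
    (hG : ∀ᵐ p ∂G, p ∈ Icc 0 vmax) (hω : InBox vmax ω) :
    ρ * ∑ k ∈ Finset.range T, (1 - active fb vmax ρ T ω k)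
      ≤ |∑ k ∈ Finset.range T, entry fb vmax ρ T ω k
            * (roundCost (ω k).1 (ω k).2 - ∫ p, roundCost (ω k).1 p ∂G)|
        + vmax * ∑ k ∈ Finset.range T, errors fb vmax ρ T G k ω
        + (2 * vmax + 9 * vmax * √(logFactor T) * √T + lamBound vmax ρ * vmax * √T) := by
  have hΛ := lamBound_nonneg hρ hvmax
  have herr : 0 ≤ ∑ k ∈ Finset.range T, errors fb vmax ρ T G k ω :=
    Finset.sum_nonneg fun k _ => errors_nonneg k
  by_cases hall : ∀ k ∈ Finset.range T, active fb vmax ρ T ω k = 1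
  · have : ∑ k ∈ Finset.range T, (1 - active fb vmax ρ T ω k) = 0 :=
      Finset.sum_eq_zero fun k hk => by rw [hall k hk, sub_self]
    rw [this, mul_zero]
    positivity
  push Not at hall
  obtain ⟨k, hk, hk'⟩ := hall
  have hT : active fb vmax ρ T ω T = 0 := active_eq_zero_of_le (Finset.mem_range.1 hk).le
    ((active_eq_zero_or_one fb vmax ρ T ω k).resolve_right hk')
  have hb := budget_lt_of_active T hT
  rw [budget_eq] at hb
  have h1 : ∑ k ∈ Finset.range T, entry fb vmax ρ T ω k * roundCost (ω k).1 (ω k).2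
      = ∑ k ∈ Finset.range T, entry fb vmax ρ T ω k
            * (roundCost (ω k).1 (ω k).2 - ∫ p, roundCost (ω k).1 p ∂G)
        + ∑ k ∈ Finset.range T, entry fb vmax ρ T ω k * (∫ p, roundCost (ω k).1 p ∂G) := by
    rw [← Finset.sum_add_distrib]
    exact Finset.sum_congr rfl fun k _ => by ring
  have h2 := Finset.sum_le_sum fun k (_ : k ∈ Finset.range T) =>
    entry_mul_mean_cost_le (fb := fb) (ρ := ρ) (T := T) hvmax hG hω k
  simp only [Finset.sum_add_distrib] at h2
  rw [← Finset.mul_sum, ← Finset.mul_sum, ← Finset.sum_mul] at h2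
  have h3 := sum_active_mul_le (fb := fb) (T := T) hρ hvmax hω T
  have h4 := mul_le_mul_of_nonneg_left (sum_entry_mul_radiusAt_le fb vmax ρ T ω T)
    (by positivity : 0 ≤ 3 * vmax)
  have h5 : (∑ k ∈ Finset.range T, if k = 0 then vmax else 0) ≤ vmax := by
    rw [Finset.sum_ite_eq' (Finset.range T) 0 fun _ => vmax]
    split_ifs
    exacts [le_rfl, hvmax.le]
  have h6 := le_abs_self (∑ k ∈ Finset.range T, entry fb vmax ρ T ω k
            * (roundCost (ω k).1 (ω k).2 - ∫ p, roundCost (ω k).1 p ∂G))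
  rw [Finset.sum_sub_distrib]
  simp only [Finset.sum_const, Finset.card_range, nsmul_eq_mul, mul_one]
  linarith

/-- With `r̄` the mean revenue at the given value, `(1 - x) r = (1 - x) (r - r̄) + (1 - x) r̄`. The
first part is centred; the second is bounded by `entry_mul_mean_ge` in active rounds and by `vmax`
in idle ones. The summands left on the right are those that need an expectation. -/
theorem loss_le [IsProbabilityMeasure G] (hρ : 0 < ρ) (hρv : ρ ≤ vmax)
    (hG : ∀ᵐ p ∂G, p ∈ Icc 0 vmax) (hω : InBox vmax ω) :
    ∑ k ∈ Finset.range T, roundRevenue (ω k).1 (ω k).2 - revenue fb vmax ρ T ω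
      ≤ ∑ k ∈ Finset.range T, ((1 - entry fb vmax ρ T ω k)
            * (roundRevenue (ω k).1 (ω k).2 - ∫ p, roundRevenue (ω k).1 p ∂G)
          + active fb vmax ρ T ω k * lamAt fb vmax ρ T ω k
            * ((∫ p, roundCost (ω k).1 p ∂G) - ρ)
          + (vmax / ρ * vmax + (1 + lamBound vmax ρ) * vmax) * errors fb vmax ρ T G k ω)
        + vmax / ρ * |∑ k ∈ Finset.range T, entry fb vmax ρ T ω k
            * (roundCost (ω k).1 (ω k).2 - ∫ p, roundCost (ω k).1 p ∂G)|
        + lossBound vmax ρ T := by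
  have hvmax : 0 < vmax := hρ.trans_le hρv
  have hrev : revenue fb vmax ρ T ω
      = ∑ k ∈ Finset.range T, entry fb vmax ρ T ω k * roundRevenue (ω k).1 (ω k).2 := by
    simp [revenue, entry]
  have h1 (k : ℕ) : roundRevenue (ω k).1 (ω k).2
        - entry fb vmax ρ T ω k * roundRevenue (ω k).1 (ω k).2
      ≤ (1 - entry fb vmax ρ T ω k)
            * (roundRevenue (ω k).1 (ω k).2 - ∫ p, roundRevenue (ω k).1 p ∂G)
          + active fb vmax ρ T ω k * lamAt fb vmax ρ T ω k
            * ((∫ p, roundCost (ω k).1 p ∂G) - ρ)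
          + (1 + lamBound vmax ρ) * vmax * errors fb vmax ρ T G k ω
          + vmax * (1 - active fb vmax ρ T ω k)
          + active fb vmax ρ T ω k * lamAt fb vmax ρ T ω k
            * (ρ - entry fb vmax ρ T ω k * estCostAt fb vmax ρ T ω k)
          + 2 * vmax * (entry fb vmax ρ T ω k * radiusAt fb vmax ρ T ω k) := by
    have h2 := entry_mul_mean_ge (fb := fb) (T := T) hρ hvmax hG hω k
    have h3 := mean_roundRevenue_mem_Icc hG (hω k).1
    have h4 : (1 - active fb vmax ρ T ω k) * (∫ p, roundRevenue (ω k).1 p ∂G)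
        ≤ (1 - active fb vmax ρ T ω k) * vmax := by
      refine mul_le_mul_of_nonneg_left (h3.2.trans (hω k).1.2) ?_
      rcases active_eq_zero_or_one fb vmax ρ T ω k with h | h <;> rw [h] <;> norm_num
    linarith
  have h2 := Finset.sum_le_sum fun k (_ : k ∈ Finset.range T) => h1 k
  rw [hrev, ← Finset.sum_sub_distrib]
  refine h2.trans ?_
  have h3 := idle_rounds_le (fb := fb) (T := T) hρ hvmax hG hω
  have h4 := sum_active_mul_lamAt_le (fb := fb) (T := T) hρ hρv hω T
  have h5 := mul_le_mul_of_nonneg_left (sum_entry_mul_radiusAt_le fb vmax ρ T ω T)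
    (by positivity : 0 ≤ 2 * vmax)
  have h6 := mul_le_mul_of_nonneg_left h3 (by positivity : 0 ≤ vmax / ρ)
  rw [← mul_assoc (vmax / ρ) ρ, div_mul_cancel₀ _ hρ.ne'] at h6
  simp only [Finset.sum_add_distrib, ← Finset.mul_sum]
  unfold lossBound
  linarith

end Pathwise

/-! ### OGD-CB: independence of the current round. -/

section Congr

variable (fb : Feedback) (vmax ρ : ℝ) (T : ℕ)

theorem estCost_congr {ω ω' : ℕ → ℝ × ℝ} {I : Finset ℕ} (h : ∀ τ ∈ I, ω τ = ω' τ) (v : ℝ) :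
    estCost T ω I v = estCost T ω' I v := by
  rw [estCost, estCost, Finset.sum_congr rfl fun τ hτ => by rw [h τ hτ]]

theorem estRevenue_congr {ω ω' : ℕ → ℝ × ℝ} {I : Finset ℕ} (h : ∀ τ ∈ I, ω τ = ω' τ) (v : ℝ) :
    estRevenue T ω I v = estRevenue T ω' I v := by
  rw [estRevenue, estRevenue, Finset.sum_congr rfl fun τ hτ => by rw [h τ hτ]]

theorem deviation_congr (G : Measure ℝ) (g : ℝ → ℝ → ℝ) {ω ω' : ℕ → ℝ × ℝ} {I : Finset ℕ}
    (h : ∀ τ ∈ I, ω τ = ω' τ) (v : ℝ) : deviation G g ω I v = deviation G g ω' I v :=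
  Finset.sum_congr rfl fun τ hτ => by rw [h τ hτ]

theorem decision_congr {ω ω' : ℕ → ℝ × ℝ} {k : ℕ} {s : OGDCBState}
    (h : ∀ τ ∈ s.observed, ω τ = ω' τ) (hk : (ω k).1 = (ω' k).1) :
    decision T ω k s = decision T ω' k s := by
  rw [decision, decision, hk, estCost_congr T h, estRevenue_congr T h]

theorem state_congr {ω ω' : ℕ → ℝ × ℝ} {n : ℕ} (h : ∀ j < n, ω j = ω' j) :
    state fb vmax ρ T ω n = state fb vmax ρ T ω' n := by
  induction n with
  | zero => rfl
  | succ n ih =>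
    have hI : ∀ τ ∈ (state fb vmax ρ T ω n).observed, ω τ = ω' τ := fun τ hτ =>
      h τ ((Finset.mem_range.1 (observed_subset_range fb vmax ρ T ω n hτ)).trans n.lt_succ_self)
    have hn : ω n = ω' n := h n n.lt_succ_self
    rw [state_succ, state_succ, ← ih fun j hj => h j (hj.trans n.lt_succ_self), step, step,
      decision_congr T hI (by rw [hn]), nextLam, nextLam, nextBudget, nextBudget, hn,
      estCost_congr T hI]

theorem state_update (ω : ℕ → ℝ × ℝ) {k n : ℕ} (hk : k ≤ n) (z : ℝ × ℝ) :
    state fb vmax ρ T (Function.update ω n z) k = state fb vmax ρ T ω k :=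
  state_congr fb vmax ρ T fun _ hj => Function.update_of_ne (by omega) _ _

theorem update_eq_of_mem_observed (ω : ℕ → ℝ × ℝ) {k n : ℕ} (hk : k ≤ n) (z : ℝ × ℝ) :
    ∀ τ ∈ (state fb vmax ρ T ω k).observed, Function.update ω n z τ = ω τ := fun τ hτ =>
  Function.update_of_ne (by
    have := Finset.mem_range.1 (observed_subset_range fb vmax ρ T ω k hτ)
    omega) _ _

/-- The decision uses the value of its own round but not the competing bid. Hence terms with a
decision are averaged over the bid only, through `integral_nonpos_of_price` and
`integral_eq_zero_of_price`. -/
theorem decision_update_price (ω : ℕ → ℝ × ℝ) {k n : ℕ} (hk : k ≤ n) (p : ℝ) :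
    decision T (Function.update ω n ((ω n).1, p)) k
        (state fb vmax ρ T (Function.update ω n ((ω n).1, p)) k)
      = decision T ω k (state fb vmax ρ T ω k) := by
  rw [state_update fb vmax ρ T ω hk]
  refine decision_congr T (update_eq_of_mem_observed fb vmax ρ T ω hk _) ?_
  rcases eq_or_ne k n with rfl | hkn
  · rw [Function.update_self]
  · rw [Function.update_of_ne hkn]

theorem entry_update_price (ω : ℕ → ℝ × ℝ) {k n : ℕ} (hk : k ≤ n) (p : ℝ) :
    entry fb vmax ρ T (Function.update ω n ((ω n).1, p)) k = entry fb vmax ρ T ω k := by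
  rw [entry, entry, decision_update_price fb vmax ρ T ω hk]

/-- Whether a bid is recorded is settled before the bid is known; this makes selective observation
unbiased. -/
theorem observed_succ_update_price (ω : ℕ → ℝ × ℝ) (k : ℕ) (p : ℝ) :
    (state fb vmax ρ T (Function.update ω k ((ω k).1, p)) (k + 1)).observed
      = (state fb vmax ρ T ω (k + 1)).observed := by
  have h := decision_update_price fb vmax ρ T ω (le_refl k) p
  rw [state_update fb vmax ρ T ω le_rfl] at h
  rw [state_succ, state_succ, step, step, state_update fb vmax ρ T ω le_rfl, h]
  split_ifs <;> rfl

theorem observed_succ_eq_or (ω : ℕ → ℝ × ℝ) (k : ℕ) :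
    (state fb vmax ρ T ω (k + 1)).observed = (state fb vmax ρ T ω k).observed ∨
      (state fb vmax ρ T ω (k + 1)).observed = insert k (state fb vmax ρ T ω k).observed := by
  rw [state_succ, step]
  split_ifs
  · cases fb
    · exact Or.inr rfl
    · simp only [nextObserved]
      split_ifs
      exacts [Or.inr rfl, Or.inl rfl]
  · exact Or.inl rfl

end Congr

/-! ### OGD-CB: measurability. -/

section Measurability

variable (fb : Feedback) (vmax ρ : ℝ) (T : ℕ)

theorem measurable_value (k : ℕ) : Measurable fun ω : ℕ → ℝ × ℝ => (ω k).1 :=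
  measurable_fst.comp (measurable_pi_apply k)

theorem measurable_price (k : ℕ) : Measurable fun ω : ℕ → ℝ × ℝ => (ω k).2 :=
  measurable_snd.comp (measurable_pi_apply k)

/-- The random index set takes countably many values, so each may be treated as fixed. -/
theorem measurable_sum_observed {g : ℝ → ℝ → ℝ} (hg : Measurable fun z : ℝ × ℝ => g z.1 z.2)
    {I : (ℕ → ℝ × ℝ) → Finset ℕ} (hI : Measurable I) {v : (ℕ → ℝ × ℝ) → ℝ} (hv : Measurable v) :
    Measurable fun ω => ∑ τ ∈ I ω, g (v ω) (ω τ).2 := by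
  have h : Measurable fun q : (ℕ → ℝ × ℝ) × Finset ℕ => ∑ τ ∈ q.2, g (v q.1) (q.1 τ).2 :=
    measurable_from_prod_countable_left fun J => Finset.measurable_fun_sum _ fun τ _ =>
      hg.comp (hv.prodMk (measurable_price τ))
  exact h.comp (measurable_id.prodMk hI)

theorem measurable_comp_card {f : ℕ → ℝ} {I : (ℕ → ℝ × ℝ) → Finset ℕ} (hI : Measurable I) :
    Measurable fun ω => f (I ω).card :=
  (Measurable.of_discrete (f := fun J : Finset ℕ => f J.card)).comp hI

theorem measurable_estCost {I : (ℕ → ℝ × ℝ) → Finset ℕ} (hI : Measurable I) (k : ℕ) :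
    Measurable fun ω => estCost T ω (I ω) (ω k).1 :=
  ((measurable_sum_observed measurable_roundCost hI (measurable_value k)).div
    (measurable_comp_card (f := fun n => (n : ℝ)) hI)).sub
    (((measurable_comp_card (f := radius T) hI).const_mul 2).mul (measurable_value k))

theorem measurable_estRevenue {I : (ℕ → ℝ × ℝ) → Finset ℕ} (hI : Measurable I) (k : ℕ) :
    Measurable fun ω => estRevenue T ω (I ω) (ω k).1 :=
  ((measurable_sum_observed measurable_roundRevenue hI (measurable_value k)).div
    (measurable_comp_card (f := fun n => (n : ℝ)) hI)).add
    ((measurable_comp_card (f := radius T) hI).mul (measurable_value k))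

theorem measurable_decision_of {s : (ℕ → ℝ × ℝ) → OGDCBState} (k : ℕ)
    (hI : Measurable fun ω => (s ω).observed) (hl : Measurable fun ω => (s ω).lam)
    (hr : Measurable fun ω => (s ω).running) : Measurable fun ω => decision T ω k (s ω) :=
  (Measurable.of_discrete (f := fun q : Bool × Bool => q.1 && (k == 0 || q.2))).comp
    (hr.prodMk (measurable_decide_le (hl.mul (measurable_estCost T hI k))
      (measurable_estRevenue T hI k)))

theorem measurable_state (n : ℕ) :
    (Measurable fun ω => (state fb vmax ρ T ω n).observed) ∧
    (Measurable fun ω => (state fb vmax ρ T ω n).lam) ∧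
    (Measurable fun ω => (state fb vmax ρ T ω n).budget) ∧
    (Measurable fun ω => (state fb vmax ρ T ω n).running) := by
  induction n with
  | zero => exact ⟨measurable_const, measurable_const, measurable_const, measurable_const⟩
  | succ n ih =>
    obtain ⟨hI, hl, hb, hr⟩ := ih
    have hd := measurable_decision_of T n hI hl hr
    have hrs : MeasurableSet {ω | (state fb vmax ρ T ω n).running = true} :=
      hr (measurableSet_singleton true)
    have hB : Measurable fun ω =>
        nextBudget ω n (state fb vmax ρ T ω n) (decision T ω n (state fb vmax ρ T ω n)) :=
      hb.sub (measurable_ite_bool hd (measurable_roundCost_eval n) measurable_const)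
    have hL : Measurable fun ω => nextLam vmax ρ T ω n (state fb vmax ρ T ω n)
        (decision T ω n (state fb vmax ρ T ω n)) := by
      unfold nextLam
      split_ifs
      · exact hl
      · exact measurable_const.max (hl.add (((measurable_ite_bool hd (measurable_estCost T hI n)
          measurable_const).sub_const ρ).const_mul _))
    have hO : Measurable fun ω => nextObserved fb n (state fb vmax ρ T ω n).observed
        (decision T ω n (state fb vmax ρ T ω n)) :=
      (Measurable.of_discrete (f := fun q : Finset ℕ × Bool => nextObserved fb n q.1 q.2)).comp
        (hI.prodMk hd)
    simp only [state_succ, step, apply_ite OGDCBState.observed, apply_ite OGDCBState.lam,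
      apply_ite OGDCBState.budget, apply_ite OGDCBState.running]
    exact ⟨Measurable.ite hrs hO hI, Measurable.ite hrs hL hl, Measurable.ite hrs hB hb,
      Measurable.ite hrs (measurable_decide_le measurable_const hB) hr⟩

theorem measurable_entry (k : ℕ) : Measurable fun ω => entry fb vmax ρ T ω k := by
  obtain ⟨hI, hl, -, hr⟩ := measurable_state fb vmax ρ T k
  exact measurable_ite_bool (measurable_decision_of T k hI hl hr) measurable_const measurable_const

theorem measurable_active (k : ℕ) : Measurable fun ω => active fb vmax ρ T ω k :=
  measurable_ite_bool (measurable_state fb vmax ρ T k).2.2.2 measurable_const measurable_const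

theorem measurable_revenue : Measurable (revenue fb vmax ρ T) := by
  refine Finset.measurable_fun_sum _ fun k _ => ?_
  obtain ⟨hI, hl, -, hr⟩ := measurable_state fb vmax ρ T k
  exact measurable_ite_bool (measurable_decision_of T k hI hl hr) (measurable_roundRevenue_eval k)
    measurable_const

theorem measurable_mean {g : ℝ → ℝ → ℝ} (hg : Measurable fun z : ℝ × ℝ => g z.1 z.2)
    (G : Measure ℝ) [IsProbabilityMeasure G] : Measurable fun v => ∫ p, g v p ∂G :=
  (StronglyMeasurable.integral_prod_right' (f := fun z : ℝ × ℝ => g z.1 z.2)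
    hg.stronglyMeasurable).measurable

theorem measurable_deviation {g : ℝ → ℝ → ℝ} (hg : Measurable fun z : ℝ × ℝ => g z.1 z.2)
    (G : Measure ℝ) [IsProbabilityMeasure G] (k : ℕ) {v : (ℕ → ℝ × ℝ) → ℝ} (hv : Measurable v) :
    Measurable fun ω => deviation G g ω (state fb vmax ρ T ω k).observed (v ω) :=
  measurable_sum_observed (g := fun v p => g v p - ∫ p, g v p ∂G)
    (hg.sub ((measurable_mean hg G).comp measurable_fst)) (measurable_state fb vmax ρ T k).1 hv

theorem measurableSet_misestimated {g : ℝ → ℝ → ℝ} (hg : Measurable fun z : ℝ × ℝ => g z.1 z.2)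
    (G : Measure ℝ) [IsProbabilityMeasure G] (k : ℕ) :
    MeasurableSet (misestimated fb vmax ρ T G g k) := by
  have hI := (measurable_state fb vmax ρ T k).1
  exact measurableSet_lt (((measurable_comp_card (f := fun n => (n : ℝ)) hI).mul
    (measurable_comp_card (f := radius T) hI)).mul (measurable_value k))
    (measurable_deviation fb vmax ρ T hg G k (measurable_value k)).abs

end Measurability

/-! ### OGD-CB: concentration under adaptive sampling. -/

/-- The exponential process of the observed deviations from the mean at the value `v`. -/
noncomputable def expDeviation (fb : Feedback) (vmax ρ : ℝ) (T : ℕ) (G : Measure ℝ)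
    (g : ℝ → ℝ → ℝ) (v s : ℝ) (k : ℕ) (ω : ℕ → ℝ × ℝ) : ℝ :=
  Real.exp (s * deviation G g ω (state fb vmax ρ T ω k).observed v
    - (state fb vmax ρ T ω k).observed.card * (s ^ 2 * v ^ 2 / 8))

theorem exp_two_mul_logFactor {T : ℕ} (hT : 0 < T) : Real.exp (2 * logFactor T) = 2 * T ^ 2 := by
  have hT' : (0 : ℝ) < T := by exact_mod_cast hT
  rw [logFactor, mul_div_cancel₀ _ two_ne_zero, Real.exp_add, Real.exp_log two_pos,
    two_mul (Real.log T), Real.exp_add, Real.exp_log hT', sq]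

/-- The slope `s = ± 4 ε / v` is the Chernoff choice for `n` observations: the exponent is at least
`4 n ε² - 2 n ε² = 2 n ε²`, which is `2 * logFactor T`. -/
theorem le_expDeviation (fb : Feedback) {vmax : ℝ} (ρ : ℝ) {T : ℕ} {G : Measure ℝ}
    {g : ℝ → ℝ → ℝ} {v : ℝ} (hT : 0 < T) (hv : 0 < v) {k : ℕ}
    {ω : ℕ → ℝ × ℝ} {σ : ℝ} (hσ : σ ^ 2 = 1) (hn : 0 < (state fb vmax ρ T ω k).observed.card)
    (h : (state fb vmax ρ T ω k).observed.card * radius T (state fb vmax ρ T ω k).observed.card * v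
      ≤ σ * deviation G g ω (state fb vmax ρ T ω k).observed v) :
    2 * (T : ℝ) ^ 2 ≤ expDeviation fb vmax ρ T G g v
      (σ * (4 * radius T (state fb vmax ρ T ω k).observed.card / v)) k ω := by
  rw [← exp_two_mul_logFactor hT, expDeviation, Real.exp_le_exp]
  set n := (state fb vmax ρ T ω k).observed.card
  have hn' : (0 : ℝ) < n := by exact_mod_cast hn
  have hr2 : radius T n ^ 2 * n = logFactor T := by
    rw [radius_eq, div_pow, Real.sq_sqrt (logFactor_nonneg T), Real.sq_sqrt hn'.le,
      div_mul_cancel₀ _ hn'.ne']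
  have h1 := mul_le_mul_of_nonneg_left h
    (div_nonneg (mul_nonneg zero_le_four (radius_nonneg T n)) hv.le)
  have h2 : 4 * radius T n / v * (n * radius T n * v) = 4 * logFactor T := by
    rw [← hr2]; field_simp
  have h3 : (n : ℝ) * ((σ * (4 * radius T n / v)) ^ 2 * v ^ 2 / 8) = 2 * logFactor T := by
    rw [mul_pow, hσ, ← hr2]; field_simp; ring
  rw [h3]
  linarith

section

variable {F G : Measure ℝ} [IsProbabilityMeasure F] [IsProbabilityMeasure G] {vmax : ℝ}
  (fb : Feedback) (ρ : ℝ) (T : ℕ) {g : ℝ → ℝ → ℝ} {v : ℝ}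

/-- Hoeffding's lemma for the outcome of a round. -/
theorem integral_exp_sub_mean_le (hg : Measurable fun z : ℝ × ℝ => g z.1 z.2)
    (hgv : ∀ᵐ p ∂G, g v p ∈ Icc 0 v) (s : ℝ) :
    ∫ p, Real.exp (s * (g v p - ∫ q, g v q ∂G) - s ^ 2 * v ^ 2 / 8) ∂G ≤ 1 := by
  have hm : AEMeasurable (fun p => g v p) G := (hg.comp measurable_prodMk_left).aemeasurable
  have h := (ProbabilityTheory.hasSubgaussianMGF_of_mem_Icc hm hgv).mgf_le s
  have hc : ((((‖v - 0‖₊ / 2) ^ 2 : NNReal) : ℝ) * s ^ 2 / 2) = s ^ 2 * v ^ 2 / 8 := by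
    push_cast
    rw [sub_zero, div_pow, Real.norm_eq_abs, sq_abs]
    ring
  rw [hc, ProbabilityTheory.mgf] at h
  simp_rw [Real.exp_sub]
  rw [integral_div, div_le_one (Real.exp_pos _)]
  exact h

theorem measurable_expDeviation (hg : Measurable fun z : ℝ × ℝ => g z.1 z.2) (s : ℝ) (k : ℕ) :
    Measurable (expDeviation fb vmax ρ T G g v s k) :=
  Real.measurable_exp.comp (((measurable_deviation fb vmax ρ T hg G k measurable_const).const_mul
    s).sub ((measurable_comp_card (f := fun n => (n : ℝ))
      (measurable_state fb vmax ρ T k).1).mul_const _))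

theorem abs_expDeviation_le (hG : ∀ᵐ p ∂G, p ∈ Icc 0 vmax)
    (hgv : ∀ p ∈ Icc 0 vmax, g v p ∈ Icc 0 v) (s : ℝ) (k : ℕ) (ω : ℕ → ℝ × ℝ)
    (hω : InBox vmax ω) :
    |expDeviation fb vmax ρ T G g v s k ω| ≤ Real.exp (|s| * (k * v)) := by
  have hmean := integral_price_mem_Icc (hG.mono hgv)
  have hv : 0 ≤ v := hmean.1.trans hmean.2
  have hdev : |deviation G g ω (state fb vmax ρ T ω k).observed v| ≤ k * v := by
    refine (Finset.abs_sum_le_sum_abs _ _).trans ?_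
    have h1 := Finset.sum_le_card_nsmul (state fb vmax ρ T ω k).observed
      (fun τ => |g v (ω τ).2 - ∫ p, g v p ∂G|) v fun τ _ => by
        have h2 := hgv _ (hω τ).2
        exact abs_le.2 ⟨by linarith [h2.1, hmean.2], by linarith [h2.2, hmean.1]⟩
    rw [nsmul_eq_mul] at h1
    refine h1.trans (mul_le_mul_of_nonneg_right ?_ hv)
    have := Finset.card_le_card (observed_subset_range fb vmax ρ T ω k)
    rw [Finset.card_range] at this
    exact_mod_cast this
  rw [expDeviation, Real.abs_exp, Real.exp_le_exp]
  have h1 := (le_abs_self (s * deviation G g ω (state fb vmax ρ T ω k).observed v))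
  rw [abs_mul] at h1
  have h2 := mul_le_mul_of_nonneg_left hdev (abs_nonneg s)
  have h3 : 0 ≤ ((state fb vmax ρ T ω k).observed.card : ℝ) * (s ^ 2 * v ^ 2 / 8) := by positivity
  linarith

theorem integrable_expDeviation (hF : ∀ᵐ v ∂F, v ∈ Icc 0 vmax) (hG : ∀ᵐ p ∂G, p ∈ Icc 0 vmax)
    (hg : Measurable fun z : ℝ × ℝ => g z.1 z.2)
    (hgv : ∀ p ∈ Icc 0 vmax, g v p ∈ Icc 0 v) (s : ℝ) (k : ℕ) :
    Integrable (expDeviation fb vmax ρ T G g v s k) (marketLaw F G) :=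
  integrable_of_inBox hF hG (measurable_expDeviation fb ρ T hg s k) _
    (abs_expDeviation_le fb ρ T hG hgv s k)

/-- The exponential process is a supermartingale, although which competing bids are observed
depends on the past. -/
theorem integral_expDeviation_le (hF : ∀ᵐ v ∂F, v ∈ Icc 0 vmax) (hG : ∀ᵐ p ∂G, p ∈ Icc 0 vmax)
    (hg : Measurable fun z : ℝ × ℝ => g z.1 z.2)
    (hgv : ∀ p ∈ Icc 0 vmax, g v p ∈ Icc 0 v) (s : ℝ) (k : ℕ) :
    ∫ ω, expDeviation fb vmax ρ T G g v s k ω ∂marketLaw F G ≤ 1 := by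
  induction k with
  | zero => simp [expDeviation, state, deviation]
  | succ k ih =>
    have h1 := integrable_expDeviation (F := F) fb ρ T hF hG hg hgv s k
    have h2 := integrable_expDeviation (F := F) fb ρ T hF hG hg hgv s (k + 1)
    suffices h : ∫ ω, (expDeviation fb vmax ρ T G g v s (k + 1) ω
        - expDeviation fb vmax ρ T G g v s k ω) ∂marketLaw F G ≤ 0 by
      rw [integral_sub h2 h1] at h
      linarith
    refine integral_nonpos_of_price hF hG
      ((measurable_expDeviation fb ρ T hg s (k + 1)).sub (measurable_expDeviation fb ρ T hg s k))
      (Real.exp (|s| * ((k + 1 : ℕ) * v)) + Real.exp (|s| * (k * v)))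
      (fun ω hω => (abs_sub _ _).trans (add_le_add
        (abs_expDeviation_le fb ρ T hG hgv s (k + 1) ω hω)
        (abs_expDeviation_le fb ρ T hG hgv s k ω hω))) k fun ω hω => ?_
    have hk (p : ℝ) : expDeviation fb vmax ρ T G g v s k (Function.update ω k ((ω k).1, p))
        = expDeviation fb vmax ρ T G g v s k ω := by
      rw [expDeviation, expDeviation, state_update fb vmax ρ T ω le_rfl,
        deviation_congr G g (update_eq_of_mem_observed fb vmax ρ T ω le_rfl _)]
    -- Which case occurs does not depend on the bid. An unrecorded bid changes nothing; a recorded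
    -- one multiplies the process by a factor whose mean is at most `1` by Hoeffding's lemma.
    rcases observed_succ_eq_or fb vmax ρ T ω k with h | h
    · have hk' (p : ℝ) : expDeviation fb vmax ρ T G g v s (k + 1)
          (Function.update ω k ((ω k).1, p)) = expDeviation fb vmax ρ T G g v s k ω := by
        rw [← hk p, expDeviation, expDeviation, observed_succ_update_price, h,
          state_update fb vmax ρ T ω le_rfl]
      simp [hk, hk']
    · have hk' (p : ℝ) : expDeviation fb vmax ρ T G g v s (k + 1)
          (Function.update ω k ((ω k).1, p)) = expDeviation fb vmax ρ T G g v s k ω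
            * Real.exp (s * (g v p - ∫ q, g v q ∂G) - s ^ 2 * v ^ 2 / 8) := by
        rw [expDeviation, expDeviation, observed_succ_update_price, h, deviation,
          Finset.sum_insert (notMem_observed fb vmax ρ T ω k), ← deviation, ← Real.exp_add,
          Finset.card_insert_of_notMem (notMem_observed fb vmax ρ T ω k),
          deviation_congr G g (update_eq_of_mem_observed fb vmax ρ T ω le_rfl _),
          Function.update_self]
        push_cast
        congr 1
        ring
      simp only [hk, hk']
      have hint : Integrable (fun p => Real.exp (s * (g v p - ∫ q, g v q ∂G)
          - s ^ 2 * v ^ 2 / 8)) G := by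
        have hmean := integral_price_mem_Icc (hG.mono hgv)
        refine Integrable.of_bound (Real.measurable_exp.comp
          ((((hg.comp measurable_prodMk_left).sub_const _).const_mul s).sub_const
            _)).aestronglyMeasurable (Real.exp (|s| * v)) (hG.mono fun p hp => ?_)
        have h2 := hgv _ hp
        rw [Real.norm_eq_abs, Real.abs_exp, Real.exp_le_exp]
        have h3 : |g v p - ∫ q, g v q ∂G| ≤ v :=
          abs_le.2 ⟨by linarith [h2.1, hmean.2], by linarith [h2.2, hmean.1]⟩
        have h4 := le_abs_self (s * (g v p - ∫ q, g v q ∂G))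
        rw [abs_mul] at h4
        have h5 := mul_le_mul_of_nonneg_left h3 (abs_nonneg s)
        have h6 : 0 ≤ s ^ 2 * v ^ 2 / 8 := by positivity
        linarith
      rw [integral_sub (hint.const_mul _) (integrable_const _), integral_const_mul]
      have := mul_le_mul_of_nonneg_left (integral_exp_sub_mean_le hg (hG.mono hgv) s)
        (show 0 ≤ expDeviation fb vmax ρ T G g v s k ω from (Real.exp_pos _).le)
      simp only [integral_const, probReal_univ, smul_eq_mul, one_mul]
      linarith

/-- The best slope depends on the random number of observations, so `Z` sums the exponential
processes over all possible numbers and both signs. Its mean is at most `2 T`, it is at least `2 T²`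
on the bad event, and Markov's inequality gives `1 / T`. -/
theorem measureReal_deviation_le (hF : ∀ᵐ v ∂F, v ∈ Icc 0 vmax) (hG : ∀ᵐ p ∂G, p ∈ Icc 0 vmax)
    (hg : Measurable fun z : ℝ × ℝ => g z.1 z.2) (hv : 0 ≤ v)
    (hgv : ∀ p ∈ Icc 0 vmax, g v p ∈ Icc 0 v) (hT : 0 < T) {k : ℕ} (hk : k ≤ T) :
    (marketLaw F G).real {ω | (state fb vmax ρ T ω k).observed.card
        * radius T (state fb vmax ρ T ω k).observed.card * v
      < |deviation G g ω (state fb vmax ρ T ω k).observed v|} ≤ 1 / T := by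
  have hT' : (0 : ℝ) < T := by exact_mod_cast hT
  -- At `v = 0` the slope is meaningless, but all outcomes vanish almost surely and so does the
  -- deviation.
  rcases hv.eq_or_lt with rfl | hv
  · have h0 : marketLaw F G {ω | (state fb vmax ρ T ω k).observed.card
        * radius T (state fb vmax ρ T ω k).observed.card * 0
      < |deviation G g ω (state fb vmax ρ T ω k).observed 0|} = 0 := by
      refine measure_mono_null (t := {ω | ¬ InBox vmax ω}) (fun ω hlt hω => ?_) (ae_inBox hF hG)
      have hz : ∀ p ∈ Icc 0 vmax, g 0 p = 0 := fun p hp => le_antisymm (hgv p hp).2 (hgv p hp).1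
      have hmean : ∫ p, g 0 p ∂G = 0 := integral_eq_zero_of_ae (hG.mono hz)
      have hdev : deviation G g ω (state fb vmax ρ T ω k).observed 0 = 0 :=
        Finset.sum_eq_zero fun τ _ => by rw [hmean, hz _ (hω τ).2, sub_zero]
      simp [hdev] at hlt
    rw [Measure.real, h0]
    simp
  set Z : (ℕ → ℝ × ℝ) → ℝ := fun ω => ∑ n ∈ Finset.Icc 1 k,
    (expDeviation fb vmax ρ T G g v (1 * (4 * radius T n / v)) k ω
      + expDeviation fb vmax ρ T G g v (-1 * (4 * radius T n / v)) k ω) with hZ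
  have hYi (s : ℝ) := integrable_expDeviation (F := F) fb ρ T hF hG hg hgv s k
  have hY1 (s : ℝ) := integral_expDeviation_le (F := F) fb ρ T hF hG hg hgv s k
  have hZi : Integrable Z (marketLaw F G) :=
    integrable_finsetSum _ fun n _ => (hYi _).add (hYi _)
  have hZint : ∫ ω, Z ω ∂marketLaw F G ≤ 2 * T := by
    have hpair (n : ℕ) : Integrable (fun ω =>
        expDeviation fb vmax ρ T G g v (1 * (4 * radius T n / v)) k ω
        + expDeviation fb vmax ρ T G g v (-1 * (4 * radius T n / v)) k ω) (marketLaw F G) :=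
      (hYi _).add (hYi _)
    simp only [hZ]
    rw [integral_finsetSum _ fun n _ => hpair n]
    have h1 := Finset.sum_le_card_nsmul (Finset.Icc 1 k) (fun n => ∫ ω,
      (expDeviation fb vmax ρ T G g v (1 * (4 * radius T n / v)) k ω
      + expDeviation fb vmax ρ T G g v (-1 * (4 * radius T n / v)) k ω) ∂marketLaw F G) 2
      fun n _ => by
        rw [integral_add (hYi _) (hYi _)]
        linarith [hY1 (1 * (4 * radius T n / v)), hY1 (-1 * (4 * radius T n / v))]
    rw [Nat.card_Icc, nsmul_eq_mul, Nat.add_sub_cancel] at h1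
    have h2 : (k : ℝ) ≤ T := by exact_mod_cast hk
    linarith
  have hpos (s ω) : 0 ≤ expDeviation fb vmax ρ T G g v s k ω := (Real.exp_pos _).le
  have hmarkov := mul_meas_ge_le_integral_of_nonneg (μ := marketLaw F G) (f := Z)
    (Filter.Eventually.of_forall fun ω => Finset.sum_nonneg fun n _ =>
      add_nonneg (hpos _ _) (hpos _ _)) hZi (2 * (T : ℝ) ^ 2)
  have hsub : {ω | (state fb vmax ρ T ω k).observed.card
        * radius T (state fb vmax ρ T ω k).observed.card * v
      < |deviation G g ω (state fb vmax ρ T ω k).observed v|}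
      ⊆ {ω | 2 * (T : ℝ) ^ 2 ≤ Z ω} := by
    intro ω hlt
    rw [mem_ofPred_eq] at hlt ⊢
    have hn : 0 < (state fb vmax ρ T ω k).observed.card := by
      rw [Finset.card_pos, Finset.nonempty_iff_ne_empty]
      intro he
      simp [he, deviation] at hlt
    have hnk : (state fb vmax ρ T ω k).observed.card ∈ Finset.Icc 1 k := by
      have := Finset.card_le_card (observed_subset_range fb vmax ρ T ω k)
      rw [Finset.card_range] at this
      exact Finset.mem_Icc.2 ⟨hn, this⟩
    have hterm := Finset.single_le_sum (f := fun n =>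
      (expDeviation fb vmax ρ T G g v (1 * (4 * radius T n / v)) k ω
      + expDeviation fb vmax ρ T G g v (-1 * (4 * radius T n / v)) k ω))
      (fun n _ => add_nonneg (hpos _ _) (hpos _ _)) hnk
    refine le_trans ?_ hterm
    rcases lt_abs.1 hlt with h | h
    · exact (le_expDeviation fb ρ (σ := 1) hT hv (by norm_num) hn (by linarith)).trans
        (le_add_of_nonneg_right (hpos _ _))
    · exact (le_expDeviation fb ρ (σ := -1) hT hv (by norm_num) hn (by linarith)).trans
        (le_add_of_nonneg_left (hpos _ _))
  have hmono := measureReal_mono (μ := marketLaw F G) hsub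
  refine hmono.trans ?_
  rw [le_div_iff₀ hT']
  have h3 : (T : ℝ) * (2 * T * (marketLaw F G).real {ω | 2 * (T : ℝ) ^ 2 ≤ Z ω}) ≤ T * 2 := by
    linarith
  have h4 := le_of_mul_le_mul_left h3 hT'
  linarith

/-- The current value is independent of the observed bids, so resampling the round reduces the event
to a fixed value. -/
theorem integral_misestimated_le (hF : ∀ᵐ v ∂F, v ∈ Icc 0 vmax) (hG : ∀ᵐ p ∂G, p ∈ Icc 0 vmax)
    (hg : Measurable fun z : ℝ × ℝ => g z.1 z.2)
    (hgv : ∀ v ∈ Icc 0 vmax, ∀ p ∈ Icc 0 vmax, g v p ∈ Icc 0 v) (hT : 0 < T) {k : ℕ}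
    (hk : k ≤ T) :
    ∫ ω, (misestimated fb vmax ρ T G g k).indicator 1 ω ∂marketLaw F G ≤ 1 / (T : ℝ) := by
  have hs := measurableSet_misestimated fb vmax ρ T hg G k
  rw [integral_indicator_one hs]
  have h := measure_le_of_resample (F := F) hF hG hs k (ENNReal.ofReal (1 / T)) fun z hz => by
    rw [← ofReal_measureReal]
    refine ENNReal.ofReal_le_ofReal ?_
    convert measureReal_deviation_le (F := F) fb ρ T hF hG hg hz.1.1 (hgv z.1 hz.1) hT hk using 3
    ext ω
    simp only [misestimated, mem_ofPred_eq, radiusAt, state_update fb vmax ρ T ω le_rfl,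
      deviation_congr G g (update_eq_of_mem_observed fb vmax ρ T ω le_rfl z),
      Function.update_self]
  exact ENNReal.toReal_le_of_le_ofReal (by positivity) h

theorem integrable_errors (hF : ∀ᵐ v ∂F, v ∈ Icc 0 vmax) (hG : ∀ᵐ p ∂G, p ∈ Icc 0 vmax)
    (k : ℕ) : Integrable (errors fb vmax ρ T G k) (marketLaw F G) := by
  have h1 := measurableSet_misestimated fb vmax ρ T measurable_roundRevenue G k
  have h2 := measurableSet_misestimated fb vmax ρ T measurable_roundCost G k
  refine integrable_of_inBox hF hG ((measurable_one.indicator h1).add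
    (measurable_one.indicator h2)) 2 fun ω _ => ?_
  have h0 := errors_nonneg (fb := fb) (vmax := vmax) (ρ := ρ) (T := T) (G := G) (ω := ω) k
  have h3 := errors_le (fb := fb) (vmax := vmax) (ρ := ρ) (T := T) (G := G) (ω := ω) k
  rwa [abs_of_nonneg h0]

theorem integral_errors_le (hF : ∀ᵐ v ∂F, v ∈ Icc 0 vmax) (hG : ∀ᵐ p ∂G, p ∈ Icc 0 vmax)
    (hT : 0 < T) {k : ℕ} (hk : k ≤ T) :
    ∫ ω, errors fb vmax ρ T G k ω ∂marketLaw F G ≤ 2 / T := by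
  have h1 := measurableSet_misestimated fb vmax ρ T measurable_roundRevenue G k
  have h2 := measurableSet_misestimated fb vmax ρ T measurable_roundCost G k
  have h3 := integral_misestimated_le (F := F) fb ρ T hF hG measurable_roundRevenue
    (fun v hv p hp => roundRevenue_mem_Icc hv hp) hT hk
  have h4 := integral_misestimated_le (F := F) fb ρ T hF hG measurable_roundCost
    (fun v hv p hp => roundCost_mem_Icc hv hp) hT hk
  unfold errors
  rw [integral_add ((integrable_const 1).indicator h1) ((integrable_const 1).indicator h2)]
  refine (add_le_add h3 h4).trans_eq ?_
  ring

end

/-! ### OGD-CB: expectations. -/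

variable {F G : Measure ℝ} [IsProbabilityMeasure F] [IsProbabilityMeasure G] {vmax : ℝ}

theorem integral_mean_roundCost (hF : ∀ᵐ v ∂F, v ∈ Icc 0 vmax) (hG : ∀ᵐ p ∂G, p ∈ Icc 0 vmax) :
    ∫ z : ℝ × ℝ, (∫ p, roundCost z.1 p ∂G) ∂(F.prod G) = meanCost F G := by
  rw [integral_fun_fst (fun v => ∫ p, roundCost v p ∂G), meanCost,
    integral_prod _ (integrable_roundCost hF hG)]
  simp

theorem integrable_mean_roundCost (hF : ∀ᵐ v ∂F, v ∈ Icc 0 vmax)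
    (hG : ∀ᵐ p ∂G, p ∈ Icc 0 vmax) :
    Integrable (fun z : ℝ × ℝ => ∫ p, roundCost z.1 p ∂G) (F.prod G) :=
  integrable_round_of_mem hF hG ((measurable_mean measurable_roundCost G).comp measurable_fst) vmax
    fun z hz => by
      have h := mean_roundCost_mem_Icc hG hz.1
      rw [abs_of_nonneg h.1]
      exact h.2.trans hz.1.2

theorem integral_price_sub_mean {g : ℝ → ℝ} (hg : Integrable g G) :
    ∫ p, (g p - ∫ q, g q ∂G) ∂G = 0 := by
  rw [integral_sub hg (integrable_const _)]
  simp

theorem integrable_price {g : ℝ → ℝ → ℝ} (hg : Measurable fun z : ℝ × ℝ => g z.1 z.2) {v : ℝ}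
    (hgv : ∀ᵐ p ∂G, g v p ∈ Icc 0 v) : Integrable (fun p => g v p) G :=
  Integrable.of_bound (hg.comp measurable_prodMk_left).aestronglyMeasurable v
    (hgv.mono fun p hp => by rw [Real.norm_eq_abs, abs_of_nonneg hp.1]; exact hp.2)

theorem abs_roundCost_sub_mean_le (hG : ∀ᵐ p ∂G, p ∈ Icc 0 vmax) {ω : ℕ → ℝ × ℝ}
    (hω : InBox vmax ω) (k : ℕ) :
    |roundCost (ω k).1 (ω k).2 - ∫ p, roundCost (ω k).1 p ∂G| ≤ vmax := by
  have h1 := mean_roundCost_mem_Icc hG (hω k).1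
  have h2 := roundCost_mem_Icc (hω k).1 (hω k).2
  have h3 := (hω k).1.2
  exact abs_le.2 ⟨by linarith [h1.2, h2.1], by linarith [h1.1, h2.2]⟩

theorem abs_roundRevenue_sub_mean_le (hG : ∀ᵐ p ∂G, p ∈ Icc 0 vmax) {ω : ℕ → ℝ × ℝ}
    (hω : InBox vmax ω) (k : ℕ) :
    |roundRevenue (ω k).1 (ω k).2 - ∫ p, roundRevenue (ω k).1 p ∂G| ≤ vmax := by
  have h1 := mean_roundRevenue_mem_Icc hG (hω k).1
  have h2 := roundRevenue_mem_Icc (hω k).1 (hω k).2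
  have h3 := (hω k).1.2
  exact abs_le.2 ⟨by linarith [h1.2, h2.1], by linarith [h1.1, h2.2]⟩

theorem measurable_mean_eval {g : ℝ → ℝ → ℝ} (hg : Measurable fun z : ℝ × ℝ => g z.1 z.2)
    (G : Measure ℝ) [IsProbabilityMeasure G] (k : ℕ) :
    Measurable fun ω : ℕ → ℝ × ℝ => ∫ p, g (ω k).1 p ∂G :=
  (measurable_mean hg G).comp (measurable_value k)

/-- The payments of OGD-CB concentrate around their conditional means. -/
theorem integral_abs_entry_cost_le (fb : Feedback) (ρ : ℝ) (hvmax : 0 < vmax)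
    (hF : ∀ᵐ v ∂F, v ∈ Icc 0 vmax) (hG : ∀ᵐ p ∂G, p ∈ Icc 0 vmax) {T : ℕ} (hT : 0 < T) :
    Integrable (fun ω => |∑ k ∈ Finset.range T, entry fb vmax ρ T ω k
        * (roundCost (ω k).1 (ω k).2 - ∫ p, roundCost (ω k).1 p ∂G)|) (marketLaw F G) ∧
    ∫ ω, |∑ k ∈ Finset.range T, entry fb vmax ρ T ω k
        * (roundCost (ω k).1 (ω k).2 - ∫ p, roundCost (ω k).1 p ∂G)| ∂marketLaw F G
      ≤ vmax * √T := by
  set D : ℕ → (ℕ → ℝ × ℝ) → ℝ := fun k ω => entry fb vmax ρ T ω k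
        * (roundCost (ω k).1 (ω k).2 - ∫ p, roundCost (ω k).1 p ∂G) with hD
  have hDm (k : ℕ) : Measurable (D k) := (measurable_entry fb vmax ρ T k).mul
    ((measurable_roundCost_eval k).sub (measurable_mean_eval measurable_roundCost G k))
  have hDK (k : ℕ) (ω) (hω : InBox vmax ω) : |D k ω| ≤ vmax := by
    rcases entry_eq_zero_or_one fb vmax ρ T ω k with h | h <;> simp only [hD, h]
    · simpa using hvmax.le
    · simpa using abs_roundCost_sub_mean_le hG hω k
  refine ⟨(integrable_finsetSum _ fun k _ => integrable_of_inBox hF hG (hDm k) vmax (hDK k)).abs,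
    integral_abs_sum_le hF hG hDm hvmax hDK (fun n => ?_) T hT⟩
  refine integral_eq_zero_of_price hF hG
    ((Finset.measurable_fun_sum _ fun k _ => hDm k).mul (hDm n)) (n * vmax * vmax)
    (fun ω hω => ?_) n fun ω hω => ?_
  · rw [abs_mul]
    refine mul_le_mul ?_ (hDK n ω hω) (abs_nonneg _) (by positivity)
    refine (Finset.abs_sum_le_sum_abs _ _).trans ?_
    simpa using Finset.sum_le_card_nsmul (Finset.range n) _ vmax fun k _ => hDK k ω hω
  · have h1 (p : ℝ) : ∑ k ∈ Finset.range n, D k (Function.update ω n ((ω n).1, p))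
        = ∑ k ∈ Finset.range n, D k ω := by
      refine Finset.sum_congr rfl fun k hk => ?_
      have hk' := Finset.mem_range.1 hk
      simp only [hD]
      rw [entry_update_price fb vmax ρ T ω hk'.le, Function.update_of_ne hk'.ne]
    have h2 (p : ℝ) : D n (Function.update ω n ((ω n).1, p))
        = entry fb vmax ρ T ω n * (roundCost (ω n).1 p - ∫ p, roundCost (ω n).1 p ∂G) := by
      simp only [hD]
      rw [entry_update_price fb vmax ρ T ω le_rfl, Function.update_self]
    simp_rw [h1, h2]
    rw [integral_const_mul, integral_const_mul, integral_price_sub_mean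
      (integrable_price measurable_roundCost
        (hG.mono fun p hp => roundCost_mem_Icc (hω n).1 hp)), mul_zero, mul_zero]

theorem integral_missed_revenue (fb : Feedback) (ρ : ℝ) (hF : ∀ᵐ v ∂F, v ∈ Icc 0 vmax)
    (hG : ∀ᵐ p ∂G, p ∈ Icc 0 vmax) (T k : ℕ) :
    Integrable (fun ω => (1 - entry fb vmax ρ T ω k)
        * (roundRevenue (ω k).1 (ω k).2 - ∫ p, roundRevenue (ω k).1 p ∂G)) (marketLaw F G) ∧
    ∫ ω, (1 - entry fb vmax ρ T ω k)
        * (roundRevenue (ω k).1 (ω k).2 - ∫ p, roundRevenue (ω k).1 p ∂G) ∂marketLaw F G = 0 := by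
  have hm : Measurable fun ω => (1 - entry fb vmax ρ T ω k)
        * (roundRevenue (ω k).1 (ω k).2 - ∫ p, roundRevenue (ω k).1 p ∂G) :=
    (measurable_const.sub (measurable_entry fb vmax ρ T k)).mul
    ((measurable_roundRevenue_eval k).sub (measurable_mean_eval measurable_roundRevenue G k))
  have hK (ω) (hω : InBox vmax ω) : |(1 - entry fb vmax ρ T ω k)
        * (roundRevenue (ω k).1 (ω k).2 - ∫ p, roundRevenue (ω k).1 p ∂G)| ≤ vmax := by
    rcases entry_eq_zero_or_one fb vmax ρ T ω k with h | h <;> rw [h]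
    · simpa using abs_roundRevenue_sub_mean_le hG hω k
    · simpa using hω.vmax_nonneg
  refine ⟨integrable_of_inBox hF hG hm vmax hK,
    integral_eq_zero_of_price hF hG hm vmax hK k fun ω hω => ?_⟩
  simp_rw [entry_update_price fb vmax ρ T ω le_rfl, Function.update_self]
  rw [integral_const_mul, integral_price_sub_mean (integrable_price measurable_roundRevenue
        (hG.mono fun p hp => roundRevenue_mem_Icc (hω k).1 hp)), mul_zero]

/-- Here the whole round is resampled, value included: the cost is at most `ρ` only on average over
values, and the price and the running flag depend on earlier rounds alone. -/
theorem integral_priced_cost (fb : Feedback) {ρ : ℝ} (hρ : 0 < ρ) (hρv : ρ ≤ vmax)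
    (hF : ∀ᵐ v ∂F, v ∈ Icc 0 vmax) (hG : ∀ᵐ p ∂G, p ∈ Icc 0 vmax) (hc : meanCost F G ≤ ρ)
    (T k : ℕ) :
    Integrable (fun ω => active fb vmax ρ T ω k * lamAt fb vmax ρ T ω k
        * ((∫ p, roundCost (ω k).1 p ∂G) - ρ)) (marketLaw F G) ∧
    ∫ ω, active fb vmax ρ T ω k * lamAt fb vmax ρ T ω k
        * ((∫ p, roundCost (ω k).1 p ∂G) - ρ) ∂marketLaw F G ≤ 0 := by
  have hvmax : 0 < vmax := hρ.trans_le hρv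
  have hm : Measurable fun ω => active fb vmax ρ T ω k * lamAt fb vmax ρ T ω k
        * ((∫ p, roundCost (ω k).1 p ∂G) - ρ) :=
    ((measurable_active fb vmax ρ T k).mul (measurable_state fb vmax ρ T k).2.1).mul
      ((measurable_mean_eval measurable_roundCost G k).sub_const ρ)
  have hpos (ω) : 0 ≤ active fb vmax ρ T ω k * lamAt fb vmax ρ T ω k := by
    refine mul_nonneg ?_ (lamAt_nonneg k)
    rcases active_eq_zero_or_one fb vmax ρ T ω k with h | h <;> rw [h]
    exact zero_le_one
  have hle (ω) (hω : InBox vmax ω) :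
      active fb vmax ρ T ω k * lamAt fb vmax ρ T ω k ≤ lamBound vmax ρ := by
    rcases active_eq_zero_or_one fb vmax ρ T ω k with h | h <;> rw [h]
    · simpa using lamBound_nonneg hρ hvmax
    · simpa using lamAt_le hρ hvmax hω k
  have hK (ω) (hω : InBox vmax ω) : |active fb vmax ρ T ω k * lamAt fb vmax ρ T ω k
        * ((∫ p, roundCost (ω k).1 p ∂G) - ρ)| ≤ lamBound vmax ρ * vmax := by
    have h1 := mean_roundCost_mem_Icc hG (hω k).1
    have h3 := (hω k).1.2
    rw [abs_mul, abs_of_nonneg (hpos ω)]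
    exact mul_le_mul (hle ω hω) (abs_le.2 ⟨by linarith [h1.1], by linarith [h1.2]⟩)
      (abs_nonneg _) (lamBound_nonneg hρ hvmax)
  refine ⟨integrable_of_inBox hF hG hm _ hK, integral_nonpos_of_round hF hG hm _ hK k
    fun ω hω => ?_⟩
  have h1 (z : ℝ × ℝ) : active fb vmax ρ T (Function.update ω k z) k
      * lamAt fb vmax ρ T (Function.update ω k z) k
      = active fb vmax ρ T ω k * lamAt fb vmax ρ T ω k := by
    simp only [active, lamAt, state_update fb vmax ρ T ω (le_refl k)]
  simp_rw [h1, Function.update_self]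
  rw [integral_const_mul, integral_sub (integrable_mean_roundCost hF hG) (integrable_const _),
    integral_mean_roundCost hF hG]
  refine mul_nonpos_of_nonneg_of_nonpos (hpos ω) ?_
  simpa using hc

theorem revenue_nonneg {fb : Feedback} {ρ : ℝ} {T : ℕ} (ω : ℕ → ℝ × ℝ) :
    0 ≤ revenue fb vmax ρ T ω :=
  Finset.sum_nonneg fun k _ => by
    split_ifs
    exacts [le_max_right _ _, le_rfl]

theorem revenue_le {fb : Feedback} {ρ : ℝ} {T : ℕ} (ω : ℕ → ℝ × ℝ) :
    revenue fb vmax ρ T ω ≤ ∑ k ∈ Finset.range T, roundRevenue (ω k).1 (ω k).2 :=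
  Finset.sum_le_sum fun k _ => by
    split_ifs
    exacts [le_rfl, le_max_right _ _]

theorem expectedRevenue_le (fb : Feedback) (ρ : ℝ) (hF : ∀ᵐ v ∂F, v ∈ Icc 0 vmax)
    (hG : ∀ᵐ p ∂G, p ∈ Icc 0 vmax) (T : ℕ) :
    expectedRevenue fb vmax ρ T F G ≤ T * meanRevenue F G :=
  le_mean_of_le hF hG (fun ω _ => revenue_nonneg ω) fun ω _ => revenue_le ω

/-- If entering always costs at most `ρ` per round on average, OGD-CB loses at most of the order of
`√(T log T)`. -/
theorem expectedRevenue_ge (fb : Feedback) {ρ : ℝ} (hρ : 0 < ρ) (hρv : ρ ≤ vmax)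
    (hF : ∀ᵐ v ∂F, v ∈ Icc 0 vmax) (hG : ∀ᵐ p ∂G, p ∈ Icc 0 vmax) (hc : meanCost F G ≤ ρ)
    {T : ℕ} (hT : 0 < T) :
    T * meanRevenue F G - (2 * (vmax / ρ * vmax + (1 + lamBound vmax ρ) * vmax)
        + vmax / ρ * (vmax * √T) + lossBound vmax ρ T)
      ≤ expectedRevenue fb vmax ρ T F G := by
  have hvmax : 0 < vmax := hρ.trans_le hρv
  have hT' : (0 : ℝ) < T := by exact_mod_cast hT
  set K := vmax / ρ * vmax + (1 + lamBound vmax ρ) * vmax with hK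
  have hK0 : 0 ≤ K := by
    have := lamBound_nonneg hρ hvmax
    positivity
  have hU (k : ℕ) := integral_missed_revenue fb ρ hF hG T k
  have hW (k : ℕ) := integral_priced_cost fb hρ hρv hF hG hc T k
  have hE (k : ℕ) := (integrable_errors (F := F) fb ρ T hF hG k).const_mul K
  have hM := integral_abs_entry_cost_le fb ρ hvmax hF hG hT
  have hUW (k : ℕ) : Integrable (fun ω => (1 - entry fb vmax ρ T ω k)
            * (roundRevenue (ω k).1 (ω k).2 - ∫ p, roundRevenue (ω k).1 p ∂G)
          + active fb vmax ρ T ω k * lamAt fb vmax ρ T ω k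
            * ((∫ p, roundCost (ω k).1 p ∂G) - ρ)) (marketLaw F G) := (hU k).1.add (hW k).1
  have hterm (k : ℕ) : Integrable (fun ω => (1 - entry fb vmax ρ T ω k)
            * (roundRevenue (ω k).1 (ω k).2 - ∫ p, roundRevenue (ω k).1 p ∂G)
          + active fb vmax ρ T ω k * lamAt fb vmax ρ T ω k
            * ((∫ p, roundCost (ω k).1 p ∂G) - ρ)
          + K * errors fb vmax ρ T G k ω) (marketLaw F G) := (hUW k).add (hE k)
  have hsum := integrable_finsetSum (Finset.range T) fun k _ => hterm k
  have hsumM := hsum.add (hM.1.const_mul (vmax / ρ))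
  have key := mean_sub_le_of_loss (T := T) hF hG (measurable_revenue fb vmax ρ T) (T * vmax)
    (fun ω hω => ?_) (hsumM.add (integrable_const (lossBound vmax ρ T)))
    fun ω hω => loss_le hρ hρv hG hω
  · rw [integral_add' hsumM (integrable_const _), integral_add' hsum (hM.1.const_mul _),
      integral_finsetSum _ fun k _ => hterm k, integral_const_mul] at key
    have hk (k : ℕ) (hkT : k ∈ Finset.range T) : ∫ ω, ((1 - entry fb vmax ρ T ω k)
            * (roundRevenue (ω k).1 (ω k).2 - ∫ p, roundRevenue (ω k).1 p ∂G)
          + active fb vmax ρ T ω k * lamAt fb vmax ρ T ω k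
            * ((∫ p, roundCost (ω k).1 p ∂G) - ρ)
          + K * errors fb vmax ρ T G k ω) ∂marketLaw F G ≤ K * (2 / T) := by
      rw [integral_add (hUW k) (hE k), integral_add (hU k).1 (hW k).1, (hU k).2,
        integral_const_mul]
      have h1 := mul_le_mul_of_nonneg_left (integral_errors_le (F := F) fb ρ T hF hG hT
        (Finset.mem_range.1 hkT).le) hK0
      linarith [(hW k).2]
    -- The `T` rounds together contribute `T * (K * (2 / T)) = 2 K`, a constant.
    have hsumk := Finset.sum_le_card_nsmul (Finset.range T) _ _ hk
    rw [Finset.card_range, nsmul_eq_mul, mul_left_comm, mul_div_cancel₀ _ hT'.ne'] at hsumk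
    have hMk := mul_le_mul_of_nonneg_left hM.2 (by positivity : 0 ≤ vmax / ρ)
    simp only [integral_const, probReal_univ, smul_eq_mul, one_mul] at key
    refine le_trans ?_ key
    linarith
  · rw [abs_of_nonneg (revenue_nonneg ω)]
    refine (revenue_le ω).trans ?_
    simpa using Finset.sum_le_card_nsmul (Finset.range T)
      (fun k => roundRevenue (ω k).1 (ω k).2) vmax
      fun k _ => le_of_abs_le (abs_roundRevenue_le (hω k))

end OGDCB

/-! ### Constants and conclusion. -/

theorem sqrt_le_two_mul_sqrt_mul_log {T : ℕ} (hT : 2 ≤ T) :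
    √(T : ℝ) ≤ 2 * √(T * Real.log T) := by
  have hT' : (2 : ℝ) ≤ T := by exact_mod_cast hT
  have hlog : 1 / 4 ≤ Real.log T := by
    have := Real.log_le_log two_pos hT'
    linarith [Real.log_two_gt_d9]
  rw [show (2 : ℝ) = √4 by rw [show (4 : ℝ) = 2 ^ 2 by norm_num, Real.sqrt_sq two_pos.le],
    ← Real.sqrt_mul zero_le_four]
  refine Real.sqrt_le_sqrt ?_
  nlinarith

theorem sqrt_logFactor_mul_sqrt_le {T : ℕ} (hT : 2 ≤ T) :
    √(OGDCB.logFactor T) * √(T : ℝ) ≤ 2 * √(T * Real.log T) := by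
  have hT' : (2 : ℝ) ≤ T := by exact_mod_cast hT
  have hlog := Real.log_le_log two_pos hT'
  have hlog2 := Real.log_pos one_lt_two
  rw [← Real.sqrt_mul (OGDCB.logFactor_nonneg T),
    show (2 : ℝ) = √4 by rw [show (4 : ℝ) = 2 ^ 2 by norm_num, Real.sqrt_sq two_pos.le],
    ← Real.sqrt_mul zero_le_four]
  refine Real.sqrt_le_sqrt ?_
  rw [OGDCB.logFactor]
  nlinarith

theorem meanRevenue_le {F G : Measure ℝ} [IsProbabilityMeasure F] [IsProbabilityMeasure G]
    {vmax : ℝ} (hF : ∀ᵐ v ∂F, v ∈ Icc 0 vmax) (hG : ∀ᵐ p ∂G, p ∈ Icc 0 vmax) :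
    meanRevenue F G ≤ vmax := by
  have := integral_mono_ae (integrable_round_of_mem hF hG measurable_roundRevenue vmax
    fun _ hz => abs_roundRevenue_le hz) (integrable_const vmax)
    ((ae_mem_box hF hG).mono fun z hz => (roundRevenue_mem_Icc hz.1 hz.2).2.trans hz.1.2)
  simpa [meanRevenue] using this

theorem Pacing.expectedRevenue_ge_sqrt {F G : Measure ℝ} [IsProbabilityMeasure F]
    [IsProbabilityMeasure G] {vmax ρ μbar μ₁ ε a b : ℝ} (hρ : 0 < ρ) (hρv : ρ ≤ vmax)
    (hμbar : vmax / ρ ≤ μbar) (hμ₁ : μ₁ ∈ Icc 0 μbar) (ha : 0 < a)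
    (hF : ∀ᵐ v ∂F, v ∈ Icc 0 vmax) (hG : ∀ᵐ p ∂G, p ∈ Icc 0 vmax) (hc : meanCost F G ≤ ρ)
    {T : ℕ} (hT : 2 ≤ T) (hεa : a / √T ≤ ε) (hεb : ε ≤ b / √T) :
    T * meanRevenue F G - (vmax / ρ * (vmax + μbar / a) + μbar ^ 2 / (2 * a) + b * vmax ^ 2) * √T
      ≤ expectedRevenue ρ μbar μ₁ ε T F G := by
  have hvmax : 0 < vmax := hρ.trans_le hρv
  have hμbar0 : 0 ≤ μbar := (by positivity : 0 ≤ vmax / ρ).trans hμbar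
  have hT' : (1 : ℝ) ≤ T := by exact_mod_cast one_le_two.trans hT
  have hs1 : 1 ≤ √(T : ℝ) := Real.one_le_sqrt.2 hT'
  have hs : 0 < √(T : ℝ) := by linarith
  have hsq : √(T : ℝ) * √T = T := Real.mul_self_sqrt (by linarith)
  have hε : 0 < ε := lt_of_lt_of_le (by positivity) hεa
  have hb : 0 < b := by
    have := (div_pos_iff_of_pos_right hs).1 (hε.trans_le hεb)
    exact this
  rw [div_le_iff₀ hs] at hεa
  rw [le_div_iff₀ hs] at hεb
  rcases le_or_gt (ε * vmax) 1 with h | h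
  · refine le_trans ?_ (expectedRevenue_ge hρ hρv hμbar hμ₁ hε h hF hG hc T)
    have h1 : μbar / ε ≤ μbar / a * √T := by
      rw [div_le_iff₀ hε, div_mul_eq_mul_div, div_mul_eq_mul_div, le_div_iff₀ ha]
      have := mul_le_mul_of_nonneg_left hεa hμbar0
      linarith
    have h2 : μbar ^ 2 / (2 * ε) ≤ μbar ^ 2 / (2 * a) * √T := by
      rw [div_le_iff₀ (by positivity), div_mul_eq_mul_div, div_mul_eq_mul_div,
        le_div_iff₀ (by positivity)]
      have := mul_le_mul_of_nonneg_left hεa (sq_nonneg μbar)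
      linarith
    have h3 : ε * vmax ^ 2 / 2 * T ≤ b * vmax ^ 2 * √T := by
      have h6 : ε * vmax ^ 2 / 2 * T = ε * √(T : ℝ) * (vmax ^ 2 * √(T : ℝ)) / 2 := by
        linear_combination (-(ε * vmax ^ 2 / 2)) * hsq
      rw [h6]
      have h4 := mul_le_mul_of_nonneg_right hεb (by positivity : 0 ≤ vmax ^ 2 * √(T : ℝ))
      have h5 : 0 ≤ ε * √(T : ℝ) * (vmax ^ 2 * √(T : ℝ)) := by positivity
      linarith
    have h4 : vmax / ρ * (vmax + μbar / ε) ≤ vmax / ρ * (vmax + μbar / a) * √T := by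
      rw [mul_assoc]
      refine mul_le_mul_of_nonneg_left ?_ (by positivity)
      have := mul_le_mul_of_nonneg_left hs1 hvmax.le
      linarith
    linarith
  -- For large steps the analysis of the multiplier fails, but then `√T < b vmax`, so the whole
  -- benchmark `T vmax` is at most `b vmax² √T`.
  · have h0 := expectedRevenue_nonneg (ρ := ρ) (ε := ε) hμbar0 hμ₁ hF hG T
    have h1 : T * meanRevenue F G ≤ T * vmax := by gcongr; exact meanRevenue_le hF hG
    have h2 : √(T : ℝ) ≤ b * vmax := by
      have h3 := mul_le_mul_of_nonneg_right hεb hvmax.le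
      have h4 := mul_le_mul_of_nonneg_right h.le hs.le
      linarith
    have h3 : T * vmax ≤ b * vmax ^ 2 * √T := by
      have h4 := mul_le_mul_of_nonneg_right h2 (by positivity : 0 ≤ vmax * √(T : ℝ))
      calc T * vmax = √(T : ℝ) * (vmax * √T) := by linear_combination (-vmax) * hsq
        _ ≤ _ := h4
        _ = _ := by ring
    have h4 : 0 ≤ (vmax / ρ * (vmax + μbar / a) + μbar ^ 2 / (2 * a)) * √T := by positivity
    linarith

theorem OGDCB.loss_le_sqrt_mul_log {vmax ρ : ℝ} (hρ : 0 < ρ) (hρv : ρ ≤ vmax) {T : ℕ}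
    (hT : 2 ≤ T) :
    2 * (vmax / ρ * vmax + (1 + lamBound vmax ρ) * vmax)
        + vmax / ρ * (vmax * √T) + lossBound vmax ρ T
      ≤ 2 * (2 * (vmax / ρ * vmax + (1 + lamBound vmax ρ) * vmax) + vmax / ρ * vmax
        + vmax / ρ * (2 * vmax + 9 * vmax + lamBound vmax ρ * vmax)
        + (vmax / 2 * lamBound vmax ρ ^ 2 + vmax + 6 * lamBound vmax ρ * vmax) + 6 * vmax)
        * √(T * Real.log T) := by
  have hvmax : 0 < vmax := hρ.trans_le hρv
  have hΛ := lamBound_nonneg hρ hvmax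
  have hT' : (1 : ℝ) ≤ T := by exact_mod_cast one_le_two.trans hT
  have hs1 : 1 ≤ √(T : ℝ) := Real.one_le_sqrt.2 hT'
  have h1 := sqrt_le_two_mul_sqrt_mul_log hT
  have h2 := sqrt_logFactor_mul_sqrt_le hT
  have h0 := hs1.trans h1
  unfold lossBound
  -- The terms are sorted by growth: constants, `√T`, and `√(logFactor T) * √T`; each of these is at
  -- most `2 √(T log T)`.
  have e0 : 0 ≤ 2 * (vmax / ρ * vmax + (1 + lamBound vmax ρ) * vmax) + vmax / ρ * (2 * vmax) := by
    positivity
  have e1 : 0 ≤ vmax / ρ * vmax + vmax / ρ * (lamBound vmax ρ * vmax)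
    + (vmax / 2 * lamBound vmax ρ ^ 2 + vmax) := by positivity
  have e2 : 0 ≤ vmax / ρ * (9 * vmax) + 6 * lamBound vmax ρ * vmax + 6 * vmax := by positivity
  have m0 := mul_le_mul_of_nonneg_left h0 e0
  have m1 := mul_le_mul_of_nonneg_left h1 e1
  have m2 := mul_le_mul_of_nonneg_left h2 e2
  linarith

end Auction

theorem mainTheorem10
    (vmax ρ : ℝ) (hρ : 0 < ρ) (hρv : ρ ≤ vmax)
    (μbar a b : ℝ) (hμbar : vmax / ρ ≤ μbar) (ha : 0 < a) :
    ∃ C : ℝ, ∀ (fb : Auction.Feedback) (F G : Measure ℝ)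
      [IsProbabilityMeasure F] [IsProbabilityMeasure G],
      (∀ᵐ v ∂F, v ∈ Icc 0 vmax) → (∀ᵐ p ∂G, p ∈ Icc 0 vmax) →
      ∫ z, Auction.roundCost z.1 z.2 ∂(F.prod G) ≤ ρ →
      ∀ (T : ℕ), 2 ≤ T → ∀ (μ₁ ε : ℝ), μ₁ ∈ Icc 0 μbar → a / √T ≤ ε → ε ≤ b / √T →
        (∃ R : ℝ, IsLUB (Auction.throttlingRevenues fb vmax ρ T F G) R ∧
          |R - Auction.Pacing.expectedRevenue ρ μbar μ₁ ε T F G| ≤ C * √(T * Real.log T)) ∧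
        |Auction.OGDCB.expectedRevenue fb vmax ρ T F G
            - Auction.Pacing.expectedRevenue ρ μbar μ₁ ε T F G| ≤ C * √(T * Real.log T) := by
  have hvmax : 0 < vmax := hρ.trans_le hρv
  have hμbar0 : 0 ≤ μbar := (by positivity : 0 ≤ vmax / ρ).trans hμbar
  set Λ := Auction.OGDCB.lamBound vmax ρ with hΛdef
  have hΛ : 0 ≤ Λ := Auction.OGDCB.lamBound_nonneg hρ hvmax
  set C₁ := 2 * (vmax / ρ * (vmax + vmax)) with hC₁
  -- `|b|` appears because the constant is chosen before any step size; `b > 0` follows only once an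
  -- admissible `ε` is given.
  set C₂ := 2 * (vmax / ρ * (vmax + μbar / a) + μbar ^ 2 / (2 * a) + |b| * vmax ^ 2) with hC₂
  set C₃ := 2 * (2 * (vmax / ρ * vmax + (1 + Λ) * vmax) + vmax / ρ * vmax
        + vmax / ρ * (2 * vmax + 9 * vmax + Λ * vmax)
        + (vmax / 2 * Λ ^ 2 + vmax + 6 * Λ * vmax) + 6 * vmax) with hC₃
  have hC₁0 : 0 ≤ C₁ := by positivity
  have hC₂0 : 0 ≤ C₂ := by positivity
  have hC₃0 : 0 ≤ C₃ := by positivity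
  refine ⟨C₁ + C₂ + C₃, fun fb F G _ _ hF hG hc T hT μ₁ ε hμ₁ hεa hεb => ?_⟩
  have hT0 : 0 < T := by omega
  have hT' : (1 : ℝ) ≤ T := by exact_mod_cast hT0
  have hs1 : 1 ≤ √(T : ℝ) := Real.one_le_sqrt.2 hT'
  have hsq := Auction.sqrt_le_two_mul_sqrt_mul_log hT
  set q := √(T * Real.log T) with hq
  have hq0 : 0 ≤ q := Real.sqrt_nonneg _
  have hc' : Auction.meanCost F G ≤ ρ := hc
  have hPu := Auction.Pacing.expectedRevenue_le (ρ := ρ) (ε := ε) hμbar0 hμ₁ hF hG T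
  have hPl := Auction.Pacing.expectedRevenue_ge_sqrt hρ hρv hμbar hμ₁ ha hF hG hc' hT hεa hεb
  have hOu := Auction.OGDCB.expectedRevenue_le fb ρ hF hG T
  have hOl := Auction.OGDCB.expectedRevenue_ge fb hρ hρv hF hG hc' hT0
  have hOl' := Auction.OGDCB.loss_le_sqrt_mul_log hρ hρv hT
  rw [← hΛdef] at hOl hOl'
  rw [← hC₃, ← hq] at hOl'
  have hSl := Auction.ThrottlingStrategy.expectedRevenue_enterWhileSolvent_ge hρ hvmax hF hG hc'
    fb T hT0
  have hPl' : (vmax / ρ * (vmax + μbar / a) + μbar ^ 2 / (2 * a) + b * vmax ^ 2) * √T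
      ≤ C₂ * q := by
    have h1 : vmax / ρ * (vmax + μbar / a) + μbar ^ 2 / (2 * a) + b * vmax ^ 2 ≤ C₂ / 2 := by
      rw [hC₂, mul_div_cancel_left₀ _ two_ne_zero]
      gcongr
      exact le_abs_self b
    have h2 := mul_le_mul_of_nonneg_right h1 (Real.sqrt_nonneg (T : ℝ))
    have h3 := mul_le_mul_of_nonneg_left hsq (by positivity : 0 ≤ C₂ / 2)
    linarith
  have hSl' : vmax / ρ * (vmax + vmax * √T) ≤ C₁ * q := by
    have h0 : 0 ≤ vmax / ρ * vmax := by positivity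
    have h1 := mul_le_mul_of_nonneg_left (hs1.trans hsq) h0
    have h2 := mul_le_mul_of_nonneg_left hsq h0
    rw [hC₁]
    linarith
  have hC₁q := mul_nonneg hC₁0 hq0
  have hC₂q := mul_nonneg hC₂0 hq0
  have hC₃q := mul_nonneg hC₃0 hq0
  -- Each revenue lies below the benchmark by at most its own constant times `q`, so any two differ
  -- by at most the sum of the constants times `q`.
  refine ⟨?_, abs_le.2 ⟨by linarith, by linarith⟩⟩
  have hmem : (Auction.ThrottlingStrategy.enterWhileSolvent vmax (ρ * T)).expectedRevenue fb T F G
      ∈ Auction.throttlingRevenues fb vmax ρ T F G :=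
    ⟨_, Auction.ThrottlingStrategy.respectsBudget_enterWhileSolvent fb vmax hρ.le T, rfl⟩
  have hub : T * Auction.meanRevenue F G
      ∈ upperBounds (Auction.throttlingRevenues fb vmax ρ T F G) := by
    rintro _ ⟨β, -, rfl⟩
    exact Auction.ThrottlingStrategy.expectedRevenue_le hF hG fb β T
  obtain ⟨R, hR⟩ := Real.exists_isLUB ⟨_, hmem⟩ ⟨_, hub⟩
  have hRl := hR.1 hmem
  have hRu := hR.2 hub
  exact ⟨R, hR, abs_le.2 ⟨by linarith, by linarith⟩⟩
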